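/- \textbf{Theorem.} A \emph{$k$-ASHG} $\Gamma$ consists of a finite set $N=\{1,\dots,n\}$ of agents, a value $v_i(j)\in\mathbb{Z}$ for all $i,j\in N$ with $v_i(i)=0$, and a number $k\in\mathbb{N}$. Its valuations are \emph{binary} if all values lie in $\{-1,0,1\}$ (they need not be symmetric). A \emph{coalition structure} is a partition $\pi$ of $N$ into nonempty coalitions; writing $\pi(i)$ for the coalition that contains $i$, it is \emph{individually rational (IR)} if $\sum_{j\in\pi(i)}v_i(j)\ge v_i(i)=0$ for every agent $i$. Let $G=G_\Gamma$ be the graph on $N$ in which distinct agents $i,j$ are adjacent if and only if $v_i(j)\neq 0$ or $v_j(i)\neq 0$, and let $\mathrm{tw}(G)$ be its treewidth (the minimum over all tree-decompositions of the maximum bag size minus one; set to $0$ if $n=0$). (1) With binary valuations, deciding whether a $k$-ASHG $\Gamma$ admits an IR coalition structure with exactly $k$ coalitions is in XP parameterized by $\mathrm{tw}(G_\Gamma)$. That is, let $L$ be the set of all pairs $(\langle\Gamma\rangle,\mathrm{tw}(G_\Gamma))$ such that $\Gamma$ is a $k$-ASHG with binary valuations that admits an IR coalition structure with exactly $k$ coalitions,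 where $\langle\Gamma\rangle$ is the encoding of $\Gamma$ as a word over a finite alphabet that lists $n$ in unary, $k$ in binary, and the matrix $(v_i(j))_{i,j}$. Then there are a computable function $f\colon\mathbb{N}\to\mathbb{N}$ and a single algorithm (a program of a unit-cost random-access machine with addition and truncated subtraction as its only arithmetic) which, for every word $x$ and every $p\in\mathbb{N}$, decides whether $(x,p)\in L$ within $\max(|x|,2)^{f(p)}$ steps. (2) If the valuations of $\Gamma$ are binary and $\mathrm{tw}(G)+1\le k\le n$, then $\Gamma$ admits an IR coalition structure with exactly $k$ coalitions, each of which is an independent set of $G$. -/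

import Mathlib

/-! ### Random-access machines with a step count -/

namespace RAM

/-- Programs of a random-access machine in structured form.  The machine has registers
`r0, r1, ...` (a program names finitely many of them) and a memory that is addressed indirectly;
all cells hold natural numbers.  The only arithmetic is addition and truncated subtraction, so in
`t` steps the bit length of a number grows by `O(t)` only, and running times are polynomially
related to those of Turing machines. -/
inductive Prog : Type
  /-- do nothing -/
  | skip : Prog
  /-- `r_d := c` -/
  | const (d c : ℕ) : Prog
  /-- `r_d := r_a + r_b` -/
  | add (d a b : ℕ) : Prog
  /-- `r_d := max (r_a - r_b) 0` -/
  | sub (d a b : ℕ) : Prog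
  /-- `r_d := mem[r_a]` -/
  | load (d a : ℕ) : Prog
  /-- `mem[r_a] := r_b` -/
  | store (a b : ℕ) : Prog
  /-- first `p`, then `q` -/
  | seq (p q : Prog) : Prog
  /-- if `r_a ≠ 0` then `p` else `q` -/
  | ite (a : ℕ) (p q : Prog) : Prog
  /-- while `r_a ≠ 0` do `p` -/
  | while (a : ℕ) (p : Prog) : Prog

/-- A configuration: the contents of the registers and of the memory. -/
structure State where
  reg : ℕ → ℕ
  mem : ℕ → ℕ

/-- `Exec p s s' t`: the program `p`, started in configuration `s`, halts in configuration `s'`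
after exactly `t` steps.  Every elementary instruction and every evaluation of the guard of
a conditional or of a loop is one step. -/
inductive Exec : Prog → State → State → ℕ → Prop
  | skip (s : State) : Exec Prog.skip s s 1
  | const (d c : ℕ) (s : State) :
      Exec (Prog.const d c) s ⟨Function.update s.reg d c, s.mem⟩ 1
  | add (d a b : ℕ) (s : State) :
      Exec (Prog.add d a b) s ⟨Function.update s.reg d (s.reg a + s.reg b), s.mem⟩ 1
  | sub (d a b : ℕ) (s : State) :
      Exec (Prog.sub d a b) s ⟨Function.update s.reg d (s.reg a - s.reg b), s.mem⟩ 1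
  | load (d a : ℕ) (s : State) :
      Exec (Prog.load d a) s ⟨Function.update s.reg d (s.mem (s.reg a)), s.mem⟩ 1
  | store (a b : ℕ) (s : State) :
      Exec (Prog.store a b) s ⟨s.reg, Function.update s.mem (s.reg a) (s.reg b)⟩ 1
  | seq {p q : Prog} {s s' s'' : State} {t t' : ℕ} :
      Exec p s s' t → Exec q s' s'' t' → Exec (Prog.seq p q) s s'' (t + t')
  | ite_pos {a : ℕ} {p q : Prog} {s s' : State} {t : ℕ} :
      s.reg a ≠ 0 → Exec p s s' t → Exec (Prog.ite a p q) s s' (t + 1)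
  | ite_zero {a : ℕ} {p q : Prog} {s s' : State} {t : ℕ} :
      s.reg a = 0 → Exec q s s' t → Exec (Prog.ite a p q) s s' (t + 1)
  | while_pos {a : ℕ} {p : Prog} {s s' s'' : State} {t t' : ℕ} :
      s.reg a ≠ 0 → Exec p s s' t → Exec (Prog.while a p) s' s'' t' →
        Exec (Prog.while a p) s s'' (t + t' + 1)
  | while_zero {a : ℕ} {p : Prog} {s : State} :
      s.reg a = 0 → Exec (Prog.while a p) s s 1

/-- The initial configuration on input `(x, k)`, for a word `x` over the alphabet
`{0, ..., c - 1}` and a number `k`: `r0` holds the length of `x`, `r1` holds `k`, the letters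
of `x` stand in the memory cells `0, ..., |x| - 1`, and everything else is zero. -/
def State.init {c : ℕ} (x : List (Fin c)) (k : ℕ) : State where
  reg r := if r = 0 then x.length else if r = 1 then k else 0
  mem i := if h : i < x.length then (x[i]'h : ℕ) else 0

/-- `p` halts on input `(x, k)` within `T` steps, and its output (the final value of `r0`) is `1`
if `A` holds and `0` if not. -/
def DecidesWithin (p : Prog) {c : ℕ} (x : List (Fin c)) (k : ℕ) (A : Prop) (T : ℕ) : Prop :=
  ∃ s t, Exec p (State.init x k) s t ∧ t ≤ T ∧ (A → s.reg 0 = 1) ∧ (¬ A → s.reg 0 = 0)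

end RAM

/-- A parameterized problem over the finite alphabet `{0, ..., c - 1}`: the set of its
(yes-)instances `(x, k)`, where `x` is a word and `k` is the parameter. -/
abbrev ParameterizedProblem (c : ℕ) : Type := Set (List (Fin c) × ℕ)

/-- The class XP: a single algorithm decides, for all words `x` and all `k`, whether `(x, k)`
belongs to the problem, in time `|x| ^ f(k)` for a computable function `f`.  (For words of length
`0` and `1`, where `|x| ^ f(k)` is no meaningful time bound, the base is replaced by `2`.) -/
def InXP {c : ℕ} (L : ParameterizedProblem c) : Prop :=
  ∃ (p : RAM.Prog) (f : ℕ → ℕ), Computable f ∧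
    ∀ (x : List (Fin c)) (k : ℕ),
      RAM.DecidesWithin p x k ((x, k) ∈ L) ((max x.length 2) ^ f k)

/-! ### Treewidth -/

/-- A tree-decomposition of a graph `G`; its tree is a finite tree, with the nodes named
`0, ..., m - 1`. -/
structure TreeDecomposition {V : Type*} (G : SimpleGraph V) where
  m : ℕ
  tree : SimpleGraph (Fin m)
  isTree : tree.IsTree
  bag : Fin m → Finset V
  edge_mem : ∀ u v, G.Adj u v → ∃ t, u ∈ bag t ∧ v ∈ bag t
  /-- the nodes whose bags contain `v` induce a (nonempty) connected subtree -/
  connected : ∀ v, (tree.induce {t | v ∈ bag t}).Connected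

/-- The width: maximum size of a bag, minus one. -/
def TreeDecomposition.width {V : Type*} {G : SimpleGraph V} (D : TreeDecomposition G) : ℕ :=
  (Finset.univ.sup fun t => (D.bag t).card) - 1

/-- The treewidth: minimum width of a tree-decomposition. (The graph without vertices gets
the value `0`.) -/
noncomputable def treewidth {V : Type*} (G : SimpleGraph V) : ℕ :=
  sInf {w | ∃ D : TreeDecomposition G, D.width = w}

/-! ### Additively separable hedonic games with a prescribed number of coalitions -/

/-- A `k`-ASHG: the agents are `0, ..., n - 1`, `val i j` is the value that agent `i` has for
agent `j`, and `k` is the desired number of coalitions. -/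
structure KASHG where
  n : ℕ
  val : Fin n → Fin n → ℤ
  val_self : ∀ i, val i i = 0
  k : ℕ

namespace KASHG

variable (Γ : KASHG)

/-- All values are in `{-1, 0, 1}`; symmetry is not required. -/
def IsBinary : Prop := ∀ i j, Γ.val i j = -1 ∨ Γ.val i j = 0 ∨ Γ.val i j = 1

/-- The utility of agent `i` in the coalition `C`. -/
def utility (i : Fin Γ.n) (C : Finset (Fin Γ.n)) : ℤ := ∑ j ∈ C, Γ.val i j

/-- A coalition structure is a partition of the agents into nonempty coalitions. -/
abbrev CoalitionStructure : Type := Finpartition (Finset.univ : Finset (Fin Γ.n))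

/-- Individual rationality: no agent prefers being alone to its coalition. -/
def IsIR (π : Γ.CoalitionStructure) : Prop := ∀ i, Γ.utility i {i} ≤ Γ.utility i (π.part i)

/-- The game admits an individually rational coalition structure with exactly `k` coalitions. -/
def AdmitsIR : Prop := ∃ π : Γ.CoalitionStructure, π.parts.card = Γ.k ∧ Γ.IsIR π

/-- The underlying undirected graph of the weighted digraph of the game: distinct agents are
adjacent if at least one of them has a nonzero value for the other. -/
def graph : SimpleGraph (Fin Γ.n) where
  Adj i j := Γ.val i j ≠ 0 ∨ Γ.val j i ≠ 0
  symm := ⟨fun _ _ h => h.symm⟩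
  loopless := ⟨fun i h => by simp [Γ.val_self i] at h⟩

/-- The letter for a value: `0`, `1`, and the letter `2` for `-1`.  (Used for binary
valuations only.) -/
def letter (v : ℤ) : Fin 4 := if v = 1 then 1 else if v = -1 then 2 else 0

/-- The encoding of a binary `k`-ASHG as a word over `{0, 1, 2, 3}`, with `3` as a separator:
the number of agents in unary, the number of coalitions in binary (least significant bit first),
and the matrix of values, row by row. -/
def encode : List (Fin 4) :=
  List.replicate Γ.n 1 ++ [3] ++ Γ.k.bits.map (fun b => if b then 1 else 0) ++ [3] ++
    (List.finRange Γ.n).flatMap fun i => (List.finRange Γ.n).map fun j => letter (Γ.val i j)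

/-- The problem of deciding whether a `k`-ASHG with binary valuations admits an individually
rational coalition structure, parameterized by the treewidth of its graph. -/
def irProblem : ParameterizedProblem 4 :=
  {q | ∃ Γ : KASHG, Γ.IsBinary ∧ q.1 = Γ.encode ∧ q.2 = treewidth Γ.graph ∧ Γ.AdmitsIR}

end KASHG

/-! Both parts rest on building tree-decompositions bottom-up. In a derivation `Separated G b F U S`
the vertices of `U` have been forgotten behind a bag `S` of size at most `b`. A vertex is forgotten
only when all its neighbours lie in `U ∪ S`, so the bag separates `U` from the rest of the graph.
Derivations that end with all vertices forgotten and an empty bag exist exactly when there is a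
tree-decomposition with bags of size at most `b` (`TreeDecomposition.separated`,
`Separated.exists_treeDecomposition`).

Part (2): undo a derivation with `b = tw + 1` and colour greedily. When a vertex comes back, the
rest of its bag uses at most `tw` colours, so one is free (`Separated.exists_coloring`). As long as
there are fewer colours than vertices, some class has two members and can be split; this reaches
every number of classes from the number of colours in use up to `n`. Independent coalitions give
everybody utility zero.

Part (1): let `p` be the parameter. If `p = tw` and `k > p`, the answer is `k ≤ n` by part (2). If
`k ≤ p`, coalitions are colours, and "exactly `k` colours" is enforced by guessing one
representative vertex for each of the at most `p` colours. A dynamic program then runs along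
derivations. A state assigns to each vertex of the bag its colour and the utility it has collected
so far from forgotten vertices, a number between `-n` and `n`. When a vertex is forgotten all its
neighbours have appeared, so its utility is known and is tested. `StateRule.sound` turns table
entries into derivations with colourings, `Separated.state_complete` is the converse.

No decomposition is given, so the program searches for it at the same time: entries are pairs of a
forgotten set and a state. There are too many sets `U` in general, but a small family suffices: a
component of `G - S`, intersected with the union of those components of `G - S'` that meet an
initial segment of the vertices, where `S` and `S'` have at most `p + 1` elements (one of the two
conditions may be dropped). The reason is that a component can be forgotten by choosing a vertex of
it to be forgotten last and adding the smaller components one at a time in the order of the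
vertices. Such sets have names of bounded length. The same program without values decides `tw ≤ p`
and `tw ≤ p - 1`, so the algorithm also verifies that `p` is the treewidth.

On the machine every table (binary numerals, sets, reachability, names, states) is the least fixed
point of a monotone rule and is filled by saturation (`saturate_spec`). A small calculus of
expressions, predicates and commands, closed under bounded sums, quantifiers and loops, shows that
all of this is polynomial in a bound `B` on the numbers that occur. Here `B = (a ^ 3 + 1) ^ (p + 1)`
with `a = |x| + p + 2`, which is at most `max(|x|, 2)` to a power depending on `p` only. This is the
XP bound. -/

set_option linter.unusedSectionVars false

/-! ### Running times of structured random-access programs -/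

namespace RAM

/-- The values that stand in the registers `0, ..., 5` while expressions are evaluated: the length
of the input, the parameter, a bound for all loops, an auxiliary bound, the number of agents, and
the position in the input where the matrix of values begins. -/
structure Env where
  len : ℕ
  par : ℕ
  big : ℕ
  aux : ℕ
  num : ℕ
  start : ℕ

/-- The environment that is stored in the first six registers. -/
def State.env (s : State) : Env :=
  ⟨s.reg 0, s.reg 1, s.reg 2, s.reg 3, s.reg 4, s.reg 5⟩

/-- The registers `loc 0, ..., loc (N - 1)` of `s` hold the values of the variables
`w 0, ..., w (N - 1)`, and `B ≥ 2` bounds these, the memory, and the environment. -/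
structure Holds (N : ℕ) (loc : ℕ → ℕ) (s : State) (w : ℕ → ℕ) (B : ℕ) : Prop where
  two_le : 2 ≤ B
  mem_le : ∀ a, s.mem a ≤ B
  env_le : ∀ i < 6, s.reg i ≤ B
  var_eq : ∀ i < N, s.reg (loc i) = w i
  var_le : ∀ i < N, w i ≤ B

theorem State.env_congr {s s' : State} (h : ∀ i < 6, s'.reg i = s.reg i) : s'.env = s.env := by
  simp [State.env, h]

theorem Holds.congr {N loc s w B r} {s' : State} (h : Holds N loc s w B) (hr : 6 ≤ r)
    (hl : ∀ i < N, loc i < r) (hm : s'.mem = s.mem) (hreg : ∀ i < r, s'.reg i = s.reg i) :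
    Holds N loc s' w B :=
  ⟨h.two_le, hm ▸ h.mem_le, fun i hi => (hreg i (by omega)) ▸ h.env_le i hi,
    fun i hi => (hreg _ (hl i hi)).trans (h.var_eq i hi), h.var_le⟩

theorem Holds.mono {N N' loc s w B} (h : Holds N loc s w B) (hN : N' ≤ N) : Holds N' loc s w B :=
  ⟨h.two_le, h.mem_le, h.env_le, fun i hi => h.var_eq i (by omega), fun i hi => h.var_le i (by omega)⟩

/-- Prepend a value to a stream of variables. -/
def cons (x : ℕ) (w : ℕ → ℕ) : ℕ → ℕ
  | 0 => x
  | i + 1 => w i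

@[simp] theorem cons_zero (x w) : cons x w 0 = x := rfl
@[simp] theorem cons_succ (x w i) : cons x w (i + 1) = w i := rfl

/-- `f` is computed by a random-access program, in time and with a value polynomial in any bound
for the numbers that it reads. -/
def PolyTime (f : (ℕ → ℕ) → Env → (ℕ → ℕ) → ℕ) : Prop :=
  ∃ N, ∀ (loc : ℕ → ℕ) (r : ℕ), 6 ≤ r → (∀ i < N, loc i < r) → ∃ (p : Prog) (C : ℕ),
    ∀ s w B, Holds N loc s w B → f s.mem s.env w ≤ B ^ C ∧
      ∃ s' t, Exec p s s' t ∧ t ≤ B ^ C ∧ s'.mem = s.mem ∧ (∀ i < r, s'.reg i = s.reg i) ∧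
        s'.reg r = f s.mem s.env w

/-- All bounds are kept in the form `B ^ C` with `C` depending on the program only. A factor `2` is
absorbed by one more factor `B ≥ 2`. -/
theorem pow_bound_add {B a b x y : ℕ} (hB : 2 ≤ B) (ha : a ≤ B ^ x) (hb : b ≤ B ^ y) :
    a + b ≤ B ^ (x + y + 1) := by
  have h1 : B ^ x ≤ B ^ (x + y) := Nat.pow_le_pow_right (by omega) (by omega)
  have h2 : B ^ y ≤ B ^ (x + y) := Nat.pow_le_pow_right (by omega) (by omega)
  rw [pow_succ]
  nlinarith

theorem pow_bound_mul {B a b x y : ℕ} (ha : a ≤ B ^ x) (hb : b ≤ B ^ y) :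
    a * b ≤ B ^ (x + y) := by
  rw [pow_add]; exact Nat.mul_le_mul ha hb

theorem pow_bound_const {B : ℕ} (hB : 2 ≤ B) (c : ℕ) : c ≤ B ^ c :=
  (Nat.lt_two_pow_self).le.trans (Nat.pow_le_pow_left hB c)

theorem pow_bound_mono {B a x y : ℕ} (hB : 2 ≤ B) (ha : a ≤ B ^ x) (hxy : x ≤ y) : a ≤ B ^ y :=
  ha.trans (Nat.pow_le_pow_right (by omega) hxy)

/-! ### Arithmetic expressions evaluated in polynomial time -/

namespace PolyTime

theorem const (c : ℕ) : PolyTime fun _ _ _ => c := by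
  refine ⟨0, fun loc r hr hl => ⟨.const r c, c, fun s w B h =>
    ⟨pow_bound_const h.two_le c, _, _, Exec.const r c s, ?_, rfl, ?_, ?_⟩⟩⟩
  · exact Nat.one_le_pow _ _ (by have := h.two_le; omega)
  · intro i hi; simp [Function.update, hi.ne]
  · simp

/-- There is no move instruction; a register is copied by clearing the target and adding the source.
-/
theorem of_register {q : ℕ} (f : Env → ℕ) (hq : q < 6) (hf : ∀ s : State, f s.env = s.reg q) :
    PolyTime fun _ e _ => f e := by
  refine ⟨0, fun loc r hr hl => ⟨.seq (.const r 0) (.add r r q), 1, fun s w B h =>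
    ⟨?_, _, _, Exec.seq (Exec.const r 0 s) (Exec.add r r q _), ?_, rfl, ?_, ?_⟩⟩⟩
  · simpa [hf] using h.env_le q hq
  · simpa using h.two_le
  · intro i hi; simp [Function.update, hi.ne]
  · have : q ≠ r := by omega
    simp [Function.update, this, hf]

theorem len : PolyTime fun _ e _ => e.len := of_register Env.len (q := 0) (by omega) fun _ => rfl
theorem par : PolyTime fun _ e _ => e.par := of_register Env.par (q := 1) (by omega) fun _ => rfl
theorem big : PolyTime fun _ e _ => e.big := of_register Env.big (q := 2) (by omega) fun _ => rfl
theorem aux : PolyTime fun _ e _ => e.aux := of_register Env.aux (q := 3) (by omega) fun _ => rfl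
theorem num : PolyTime fun _ e _ => e.num := of_register Env.num (q := 4) (by omega) fun _ => rfl
theorem start : PolyTime fun _ e _ => e.start :=
  of_register Env.start (q := 5) (by omega) fun _ => rfl

theorem var (j : ℕ) : PolyTime fun _ _ w => w j := by
  refine ⟨j + 1, fun loc r hr hl => ⟨.seq (.const r 0) (.add r r (loc j)), 1, fun s w B h =>
    ⟨?_, _, _, Exec.seq (Exec.const r 0 s) (Exec.add r r (loc j) _), ?_, rfl, ?_, ?_⟩⟩⟩
  · simpa using h.var_le j (by omega)
  · simpa using h.two_le
  · intro i hi; simp [Function.update, hi.ne]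
  · have : loc j ≠ r := (hl j (by omega)).ne
    simp [Function.update, this, h.var_eq j (by omega)]

variable {f g b : (ℕ → ℕ) → Env → (ℕ → ℕ) → ℕ}

/-- Evaluate two expressions, one after the other, into neighbouring registers. -/
theorem exec_two (hf : PolyTime f) (hg : PolyTime g) :
    ∃ N, ∀ (loc : ℕ → ℕ) (r : ℕ), 6 ≤ r → (∀ i < N, loc i < r) → ∃ (p : Prog) (C : ℕ),
    ∀ s w B, Holds N loc s w B → f s.mem s.env w ≤ B ^ C ∧ g s.mem s.env w ≤ B ^ C ∧
      ∃ s' t, Exec p s s' t ∧ t ≤ B ^ C ∧ s'.mem = s.mem ∧ (∀ i < r, s'.reg i = s.reg i) ∧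
        s'.reg r = f s.mem s.env w ∧ s'.reg (r + 1) = g s.mem s.env w := by
  obtain ⟨N, hf⟩ := hf
  obtain ⟨N', hg⟩ := hg
  refine ⟨max N N', fun loc r hr hl => ?_⟩
  obtain ⟨p, C, hp⟩ := hf loc r hr fun i hi => hl i (by omega)
  obtain ⟨q, C', hq⟩ := hg loc (r + 1) (by omega) fun i hi => (hl i (by omega)).trans (by omega)
  refine ⟨.seq p q, C + C' + 1, fun s w B h => ?_⟩
  obtain ⟨hfB, s₁, t₁, e₁, ht₁, hm₁, hr₁, hv₁⟩ := hp s w B (h.mono (by omega))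
  have henv : s₁.env = s.env := State.env_congr fun i hi => hr₁ i (by omega)
  obtain ⟨hgB, s₂, t₂, e₂, ht₂, hm₂, hr₂, hv₂⟩ :=
    hq s₁ w B ((h.congr hr hl hm₁ hr₁).mono (by omega))
  rw [hm₁, henv] at hgB hv₂
  refine ⟨pow_bound_mono h.two_le hfB (by omega), pow_bound_mono h.two_le hgB (by omega),
    s₂, _, e₁.seq e₂, pow_bound_add h.two_le ht₁ ht₂, hm₂.trans hm₁,
    fun i hi => (hr₂ i (by omega)).trans (hr₁ i hi), ?_, hv₂⟩
  rw [hr₂ r (by omega), hv₁]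

theorem add (hf : PolyTime f) (hg : PolyTime g) :
    PolyTime fun m e w => f m e w + g m e w := by
  obtain ⟨N, H⟩ := exec_two hf hg
  refine ⟨N, fun loc r hr hl => ?_⟩
  obtain ⟨p, C, hp⟩ := H loc r hr hl
  refine ⟨.seq p (.add r r (r + 1)), C + C + 1, fun s w B h => ?_⟩
  obtain ⟨hfB, hgB, s₁, t₁, e₁, ht₁, hm₁, hr₁, hv₁, hv₂⟩ := hp s w B h
  have h1 : 1 ≤ B ^ C := Nat.one_le_pow _ _ (by have := h.two_le; omega)
  refine ⟨pow_bound_add h.two_le hfB hgB, _, _, e₁.seq (Exec.add r r (r + 1) s₁),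
    pow_bound_add h.two_le ht₁ h1, hm₁, fun i hi => ?_, ?_⟩
  · simp [Function.update, hi.ne, hr₁ i hi]
  · simp [hv₁, hv₂]

theorem sub (hf : PolyTime f) (hg : PolyTime g) :
    PolyTime fun m e w => f m e w - g m e w := by
  obtain ⟨N, H⟩ := exec_two hf hg
  refine ⟨N, fun loc r hr hl => ?_⟩
  obtain ⟨p, C, hp⟩ := H loc r hr hl
  refine ⟨.seq p (.sub r r (r + 1)), C + C + 1, fun s w B h => ?_⟩
  obtain ⟨hfB, hgB, s₁, t₁, e₁, ht₁, hm₁, hr₁, hv₁, hv₂⟩ := hp s w B h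
  have h1 : 1 ≤ B ^ C := Nat.one_le_pow _ _ (by have := h.two_le; omega)
  refine ⟨(Nat.sub_le _ _).trans (pow_bound_mono h.two_le hfB (by omega)), _, _,
    e₁.seq (Exec.sub r r (r + 1) s₁), pow_bound_add h.two_le ht₁ h1, hm₁, fun i hi => ?_, ?_⟩
  · simp [Function.update, hi.ne, hr₁ i hi]
  · simp [hv₁, hv₂]

theorem get (hf : PolyTime f) : PolyTime fun m e w => m (f m e w) := by
  obtain ⟨N, hf⟩ := hf
  refine ⟨N, fun loc r hr hl => ?_⟩
  obtain ⟨p, C, hp⟩ := hf loc r hr hl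
  refine ⟨.seq p (.load r r), C + 1 + 1, fun s w B h => ?_⟩
  obtain ⟨hfB, s₁, t₁, e₁, ht₁, hm₁, hr₁, hv₁⟩ := hp s w B h
  have hB := h.two_le
  refine ⟨pow_bound_mono h.two_le (by simpa using h.mem_le _ : _ ≤ B ^ 1) (by omega), _, _,
    e₁.seq (Exec.load r r s₁), pow_bound_add h.two_le ht₁ (by simp; omega : 1 ≤ B ^ 1), hm₁,
    fun i hi => ?_, ?_⟩
  · simp [Function.update, hi.ne, hr₁ i hi]
  · simp [hv₁, hm₁]

end PolyTime

/-- A loop that counts a register down to zero. -/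
theorem exec_countdown {c n T : ℕ} {q : Prog} (Inv : ℕ → State → Prop)
    (hreg : ∀ i s, i ≤ n → Inv i s → s.reg c = n - i)
    (step : ∀ i s, i < n → Inv i s → ∃ s' t, Exec q s s' t ∧ t ≤ T ∧ Inv (i + 1) s') :
    ∀ d i s, i + d = n → Inv i s →
      ∃ s' t, Exec (.while c q) s s' t ∧ t ≤ d * (T + 1) + 1 ∧ Inv n s' := by
  intro d
  induction d with
  | zero =>
    intro i s hi h
    obtain rfl : i = n := by omega
    exact ⟨s, 1, Exec.while_zero (by simp [hreg _ s le_rfl h]), by simp, h⟩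
  | succ d ih =>
    intro i s hi h
    obtain ⟨s₁, t₁, e₁, ht₁, h₁⟩ := step i s (by omega) h
    obtain ⟨s₂, t₂, e₂, ht₂, h₂⟩ := ih (i + 1) s₁ (by omega) h₁
    refine ⟨s₂, _, Exec.while_pos (by rw [hreg i s (by omega) h]; omega) e₁ e₂, ?_, h₂⟩
    calc t₁ + t₂ + 1 ≤ T + (d * (T + 1) + 1) + 1 := by omega
      _ = (d + 1) * (T + 1) + 1 := by ring

theorem pow_bound_loop {B d T y z : ℕ} (hB : 2 ≤ B) (hd : d ≤ B ^ y) (hT : T + 1 ≤ B ^ z) :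
    d * (T + 1) + 1 ≤ B ^ (y + z + 0 + 1) :=
  pow_bound_add (x := y + z) (y := 0) hB (pow_bound_mul hd hT) (by simp)

/-- Iterate a function of an accumulator and of a loop index. -/
def iterate (F : ℕ → ℕ → ℕ) (a : ℕ) : ℕ → ℕ
  | 0 => a
  | i + 1 => F (iterate F a i) i

/-- A loop that iterates a function, provided that the intermediate values are bounded. -/
theorem exec_iterate {b : (ℕ → ℕ) → Env → (ℕ → ℕ) → ℕ} {F : (ℕ → ℕ) → Env → (ℕ → ℕ) → ℕ → ℕ → ℕ}
    (hb : PolyTime b) (hF : PolyTime fun m e w => F m e (fun j => w (j + 2)) (w 0) (w 1))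
    (a : ℕ) (C₀ : ℕ) :
    ∃ N, ∀ (loc : ℕ → ℕ) (r : ℕ), 6 ≤ r → (∀ i < N, loc i < r) → ∃ (p : Prog) (C : ℕ),
    ∀ s w B, Holds N loc s w B →
      (∀ i ≤ b s.mem s.env w, iterate (F s.mem s.env w) a i ≤ B ^ C₀) →
      ∃ s' t, Exec p s s' t ∧ t ≤ B ^ C ∧ s'.mem = s.mem ∧ (∀ i < r, s'.reg i = s.reg i) ∧
        s'.reg r = iterate (F s.mem s.env w) a (b s.mem s.env w) := by
  obtain ⟨N, hb⟩ := hb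
  obtain ⟨N', hF⟩ := hF
  refine ⟨max N N', fun loc r hr hl => ?_⟩
  obtain ⟨p, C, hp⟩ := hb loc (r + 2) (by omega) fun i hi => (hl i (by omega)).trans (by omega)
  obtain ⟨q, C', hq⟩ := hF (cons r (cons (r + 1) loc)) (r + 3) (by omega) (by
    intro i hi
    match i with
    | 0 => simp
    | 1 => simp
    | i + 2 => exact (hl i (by omega)).trans (by omega))
  -- In the loop the accumulator is at most `B ^ C₀` and the index at most `B ^ C`, so the body runs
  -- under the common bound `B ^ (C₀ + C + 1)` and costs at most its `C'`-th power. Register `r`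
  -- holds the accumulator, `r + 1` the index, `r + 2` the countdown; the body uses the registers
  -- from `r + 3` on.
  set z := (C₀ + C + 1) * C' with hz
  refine ⟨.seq p (.seq (.const r a) (.seq (.const (r + 1) 0) (.while (r + 2)
    (.seq q (.seq (.const (r + 4) 0) (.seq (.add r (r + 3) (r + 4)) (.seq (.const (r + 4) 1)
      (.seq (.add (r + 1) (r + 1) (r + 4)) (.sub (r + 2) (r + 2) (r + 4)))))))))),
    C + (3 + (C + (z + 6 + 1) + 0 + 1) + 1) + 1, fun s w B h hA => ?_⟩
  obtain ⟨hbB, s₁, t₁, e₁, ht₁, hm₁, hr₁, hv₁⟩ := hp s w B (h.mono (by omega))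
  have hB := h.two_le
  set n := b s.mem s.env w with hn
  let Inv : ℕ → State → Prop := fun i s' => s'.mem = s.mem ∧ (∀ j < r, s'.reg j = s.reg j) ∧
    s'.reg r = iterate (F s.mem s.env w) a i ∧ s'.reg (r + 1) = i ∧ s'.reg (r + 2) = n - i
  have step : ∀ i s', i < n → Inv i s' → ∃ s'' t, Exec (.seq q (.seq (.const (r + 4) 0)
      (.seq (.add r (r + 3) (r + 4)) (.seq (.const (r + 4) 1)
      (.seq (.add (r + 1) (r + 1) (r + 4)) (.sub (r + 2) (r + 2) (r + 4))))))) s' s'' t ∧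
      t ≤ B ^ z + 5 ∧ Inv (i + 1) s'' := by
    rintro i s' hi ⟨hm, hs, h0, h1, h2⟩
    have hB1 : B ≤ B ^ (C₀ + C + 1) := by
      calc B = B ^ 1 := (pow_one B).symm
        _ ≤ _ := Nat.pow_le_pow_right (by omega) (by omega)
    have hold : Holds N' (cons r (cons (r + 1) loc)) s' (cons (iterate (F s.mem s.env w) a i)
        (cons i w)) (B ^ (C₀ + C + 1)) := by
      refine ⟨hB.trans hB1, fun x => hm ▸ (h.mem_le x).trans hB1,
        fun x hx => (hs x (by omega)) ▸ (h.env_le x hx).trans hB1, fun x hx => ?_, fun x hx => ?_⟩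
      · match x with
        | 0 => simpa using h0
        | 1 => simpa using h1
        | x + 2 => exact (hs _ (hl x (by omega))).trans (h.var_eq x (by omega))
      · match x with
        | 0 => exact pow_bound_mono hB (hA i hi.le) (by omega)
        | 1 => exact hi.le.trans (pow_bound_mono hB hbB (by omega))
        | x + 2 => exact (h.var_le x (by omega)).trans hB1
    obtain ⟨-, s₂, t₂, e₂, ht₂, hm₂, hr₂, hv₂⟩ := hq s' _ _ hold
    have henv : s'.env = s.env := State.env_congr fun i hi => hs i (by omega)
    rw [← pow_mul, ← hz] at ht₂
    refine ⟨_, _, e₂.seq (Exec.seq (Exec.const _ _ _) (Exec.seq (Exec.add _ _ _ _)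
      (Exec.seq (Exec.const _ _ _) (Exec.seq (Exec.add _ _ _ _) (Exec.sub _ _ _ _))))),
      by omega, hm₂.trans hm, fun j hj => ?_, ?_, ?_, ?_⟩
    · have a0 : j ≠ r := by omega
      have a1 : j ≠ r + 1 := by omega
      have a2 : j ≠ r + 2 := by omega
      have a4 : j ≠ r + 4 := by omega
      simp [Function.update, a0, a1, a2, a4, hr₂ j (by omega), hs j hj]
    · simp [Function.update, hv₂, iterate, hm, henv]
    · simp [Function.update, hr₂ (r + 1) (by omega), h1]
    · simp [Function.update, hr₂ (r + 2) (by omega), h2]; omega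
  let s₃ : State := ⟨Function.update (Function.update s₁.reg r a) (r + 1) 0, s₁.mem⟩
  have hinv : Inv 0 s₃ := by
    refine ⟨hm₁, fun j hj => ?_, ?_, ?_, ?_⟩
    · have a0 : j ≠ r := by omega
      have a1 : j ≠ r + 1 := by omega
      simp [s₃, Function.update, a0, a1, hr₁ j (by omega)]
    · simp [s₃, Function.update, iterate]
    · simp [s₃]
    · simp [s₃, Function.update, hv₁, hn]
  obtain ⟨s₄, t₄, e₄, ht₄, h₄⟩ := exec_countdown (c := r + 2) Inv (fun i s _ h => h.2.2.2.2) step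
    n 0 s₃ (by omega) hinv
  refine ⟨s₄, _, e₁.seq ((Exec.const r a s₁).seq ((Exec.const (r + 1) 0 _).seq e₄)), ?_, h₄.1,
    h₄.2.1, h₄.2.2.1⟩
  have hT : (B ^ z + 5) + 1 ≤ B ^ (z + 6 + 1) := by
    have := pow_bound_add hB (le_refl (B ^ z)) (pow_bound_const hB 6)
    omega
  have h5 := ht₄.trans (pow_bound_loop hB hbB hT)
  have := pow_bound_add hB ht₁ (pow_bound_add hB
    (show 2 ≤ B ^ 3 from (by omega : 2 ≤ 3).trans (pow_bound_const hB 3)) h5)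
  omega

namespace PolyTime

variable {f g b : (ℕ → ℕ) → Env → (ℕ → ℕ) → ℕ}

theorem iterate_add_eq (F : ℕ → ℕ) (n : ℕ) :
    iterate (fun a i => a + F i) 0 n = ∑ i ∈ Finset.range n, F i := by
  induction n with
  | zero => simp [iterate]
  | succ n ih => rw [iterate, ih, Finset.sum_range_succ]

/-- Polynomial bounds on the values, for fixed sets of variables. -/
theorem exists_bound (hf : PolyTime f) : ∃ N C, ∀ m e w B, 2 ≤ B → (∀ a, m a ≤ B) →
    e.len ≤ B → e.par ≤ B → e.big ≤ B → e.aux ≤ B → e.num ≤ B → e.start ≤ B →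
    (∀ i < N, w i ≤ B) → f m e w ≤ B ^ C := by
  obtain ⟨N, h⟩ := hf
  -- The exponent in `PolyTime` may depend on the register layout. Fixing one layout gives an
  -- exponent for the value alone, which is needed before the layout of a surrounding loop is known.
  obtain ⟨p, C, h⟩ := h (fun i => i + 6) (N + 6) (by omega) (by omega)
  refine ⟨N, C, fun m e w B hB hm h0 h1 h2 h3 h4 h5 hw => ?_⟩
  let s : State := ⟨fun i => match i with
    | 0 => e.len | 1 => e.par | 2 => e.big | 3 => e.aux | 4 => e.num | 5 => e.start
    | i + 6 => w i, m⟩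
  have hs : s.env = e := rfl
  refine hs ▸ (h s w B ⟨hB, hm, fun i hi => ?_, fun i hi => rfl, hw⟩).1
  interval_cases i <;> assumption

/-- Partial sums of polynomially many polynomially bounded terms stay polynomially bounded, so the
loop with an accumulator applies. Products, bounded quantifiers and division are all derived from
this one construct. -/
theorem sum {F : (ℕ → ℕ) → Env → (ℕ → ℕ) → ℕ → ℕ} (hb : PolyTime b)
    (hF : PolyTime fun m e w => F m e (fun j => w (j + 1)) (w 0)) :
    PolyTime fun m e w => ∑ i ∈ Finset.range (b m e w), F m e w i := by
  -- In the loop variable `0` is the accumulator and variable `1` the index, so the summand must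
  -- skip the accumulator.
  have hF' : PolyTime fun m e w => F m e (fun j => w (j + 2)) (w 1) := by
    obtain ⟨N, hF⟩ := hF
    refine ⟨N + 1, fun loc r hr hl => ?_⟩
    obtain ⟨p, C, hp⟩ := hF (fun j => loc (j + 1)) r hr fun i hi => hl _ (by omega)
    refine ⟨p, C, fun s w B h => ?_⟩
    exact hp s (fun j => w (j + 1)) B ⟨h.two_le, h.mem_le, h.env_le,
      fun i hi => h.var_eq _ (by omega), fun i hi => h.var_le _ (by omega)⟩
  obtain ⟨N₁, C₁, h₁⟩ := hb.exists_bound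
  obtain ⟨N₂, C₂, h₂⟩ := hF.exists_bound
  obtain ⟨N, h⟩ := exec_iterate (F := fun m e w a i => a + F m e w i) hb
    ((var 0).add hF') 0 (C₁ + (C₁ + 1) * C₂)
  refine ⟨max N (max N₁ N₂), fun loc r hr hl => ?_⟩
  obtain ⟨p, C, hp⟩ := h loc r hr fun i hi => hl i (by omega)
  refine ⟨p, C₁ + (C₁ + 1) * C₂ + C, fun s w B hs => ?_⟩
  have hB := hs.two_le
  have hbB : b s.mem s.env w ≤ B ^ C₁ := h₁ _ _ _ B hB hs.mem_le (hs.env_le 0 (by omega))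
    (hs.env_le 1 (by omega)) (hs.env_le 2 (by omega)) (hs.env_le 3 (by omega))
    (hs.env_le 4 (by omega)) (hs.env_le 5 (by omega)) fun i hi => hs.var_le i (by omega)
  have hB1 : B ≤ B ^ (C₁ + 1) := by
    calc B = B ^ 1 := (pow_one B).symm
      _ ≤ _ := Nat.pow_le_pow_right (by omega) (by omega)
  have hFB : ∀ i < b s.mem s.env w, F s.mem s.env w i ≤ B ^ ((C₁ + 1) * C₂) := by
    intro i hi
    rw [pow_mul]
    refine h₂ s.mem s.env (cons i w) _ (hB.trans hB1) (fun a => (hs.mem_le a).trans hB1)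
      ((hs.env_le 0 (by omega)).trans hB1)
      ((hs.env_le 1 (by omega)).trans hB1) ((hs.env_le 2 (by omega)).trans hB1)
      ((hs.env_le 3 (by omega)).trans hB1)
      ((hs.env_le 4 (by omega)).trans hB1) ((hs.env_le 5 (by omega)).trans hB1) fun j hj => ?_
    match j with
    | 0 => exact hi.le.trans (pow_bound_mono hB hbB (by omega))
    | j + 1 => exact (hs.var_le j (by omega)).trans hB1
  have hsum : ∀ i ≤ b s.mem s.env w,
      ∑ j ∈ Finset.range i, F s.mem s.env w j ≤ B ^ (C₁ + (C₁ + 1) * C₂) := by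
    intro i hi
    refine (Finset.sum_le_card_nsmul _ _ (B ^ ((C₁ + 1) * C₂)) fun j hj => hFB j ?_).trans ?_
    · have := Finset.mem_range.1 hj; omega
    · rw [Finset.card_range, smul_eq_mul]
      exact pow_bound_mul (hi.trans hbB) le_rfl
  refine ⟨pow_bound_mono hB (hsum _ le_rfl) (by omega), ?_⟩
  obtain ⟨s', t, e, ht, hm, hreg, hv⟩ := hp s w B (hs.mono (by omega)) fun i hi => by
    rw [iterate_add_eq]; exact hsum i hi
  exact ⟨s', t, e, pow_bound_mono hB ht (by omega), hm, hreg, by rw [hv, iterate_add_eq]⟩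

/-- Weakening: an expression remains one when a new variable is bound. -/
theorem shift (hf : PolyTime f) : PolyTime fun m e w => f m e fun j => w (j + 1) := by
  obtain ⟨N, hF⟩ := hf
  refine ⟨N + 1, fun loc r hr hl => ?_⟩
  obtain ⟨p, C, hp⟩ := hF (fun j => loc (j + 1)) r hr fun i hi => hl _ (by omega)
  exact ⟨p, C, fun s w B h => hp s (fun j => w (j + 1)) B ⟨h.two_le, h.mem_le, h.env_le,
    fun i hi => h.var_eq _ (by omega), fun i hi => h.var_le _ (by omega)⟩⟩

theorem mul (hf : PolyTime f) (hg : PolyTime g) :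
    PolyTime fun m e w => f m e w * g m e w := by
  have := sum (F := fun m e w _ => g m e w) hf hg.shift
  simpa using this

end PolyTime

/-- A property that is decided in polynomial time, in the sense of `PolyTime`. -/
def PolyPred (φ : (ℕ → ℕ) → Env → (ℕ → ℕ) → Prop) : Prop :=
  ∃ f, PolyTime f ∧ ∀ m e w, f m e w = (open Classical in if φ m e w then 1 else 0)

/-! ### Predicates: Boolean connectives and bounded quantifiers -/

namespace PolyPred

variable {φ ψ : (ℕ → ℕ) → Env → (ℕ → ℕ) → Prop} {f g b : (ℕ → ℕ) → Env → (ℕ → ℕ) → ℕ}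

theorem of_iff (hφ : PolyPred φ) (h : ∀ m e w, ψ m e w ↔ φ m e w) : PolyPred ψ := by
  obtain rfl : ψ = φ := by funext m e w; exact propext (h m e w)
  exact hφ

theorem of_pos (hf : PolyTime f) : PolyPred fun m e w => 0 < f m e w := by
  -- With truncated subtraction, `1 - (1 - x)` is `1` for positive `x` and `0` for `x = 0`.
  refine ⟨_, (PolyTime.const 1).sub ((PolyTime.const 1).sub hf), fun m e w => ?_⟩
  split_ifs <;> omega

theorem lt (hf : PolyTime f) (hg : PolyTime g) : PolyPred fun m e w => f m e w < g m e w :=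
  (of_pos (hg.sub hf)).of_iff fun m e w => by omega

theorem not (hφ : PolyPred φ) : PolyPred fun m e w => ¬ φ m e w := by
  obtain ⟨f, hf, h⟩ := hφ
  refine ⟨_, (PolyTime.const 1).sub hf, fun m e w => ?_⟩
  rw [h]; split_ifs <;> simp_all

theorem or (hφ : PolyPred φ) (hψ : PolyPred ψ) : PolyPred fun m e w => φ m e w ∨ ψ m e w := by
  obtain ⟨f, hf, h⟩ := hφ
  obtain ⟨g, hg, h'⟩ := hψ
  refine (of_pos (hf.add hg)).of_iff fun m e w => ?_
  rw [h, h']; split_ifs <;> simp_all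

theorem and (hφ : PolyPred φ) (hψ : PolyPred ψ) : PolyPred fun m e w => φ m e w ∧ ψ m e w :=
  (hφ.not.or hψ.not).not.of_iff fun m e w => by tauto

theorem imp (hφ : PolyPred φ) (hψ : PolyPred ψ) : PolyPred fun m e w => φ m e w → ψ m e w :=
  (hφ.not.or hψ).of_iff fun m e w => by tauto

theorem iff (hφ : PolyPred φ) (hψ : PolyPred ψ) : PolyPred fun m e w => φ m e w ↔ ψ m e w :=
  ((hφ.imp hψ).and (hψ.imp hφ)).of_iff fun m e w => by tauto

theorem le (hf : PolyTime f) (hg : PolyTime g) : PolyPred fun m e w => f m e w ≤ g m e w :=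
  (lt hg hf).not.of_iff fun m e w => by omega

theorem eq (hf : PolyTime f) (hg : PolyTime g) : PolyPred fun m e w => f m e w = g m e w :=
  ((le hf hg).and (le hg hf)).of_iff fun m e w => by omega

theorem ne (hf : PolyTime f) (hg : PolyTime g) : PolyPred fun m e w => f m e w ≠ g m e w :=
  (eq hf hg).not

/-- A sum of indicators is positive exactly when one of them is. -/
theorem exists_lt {φ : (ℕ → ℕ) → Env → (ℕ → ℕ) → ℕ → Prop} (hb : PolyTime b)
    (hφ : PolyPred fun m e w => φ m e (fun j => w (j + 1)) (w 0)) :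
    PolyPred fun m e w => ∃ i < b m e w, φ m e w i := by
  obtain ⟨f, hf, h⟩ := hφ
  refine (of_pos (PolyTime.sum (F := fun m e w i => f m e (cons i w)) hb ?_)).of_iff
    fun m e w => ?_
  · convert hf using 5 with m e w
    funext j; cases j <;> rfl
  · rw [Finset.sum_pos_iff]
    refine exists_congr fun i => ?_
    rw [Finset.mem_range, h]
    refine and_congr_right fun _ => ?_
    by_cases hi : φ m e w i <;> simp [hi]

theorem forall_lt {φ : (ℕ → ℕ) → Env → (ℕ → ℕ) → ℕ → Prop} (hb : PolyTime b)
    (hφ : PolyPred fun m e w => φ m e (fun j => w (j + 1)) (w 0)) :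
    PolyPred fun m e w => ∀ i < b m e w, φ m e w i :=
  (exists_lt (φ := fun m e w i => ¬ φ m e w i) hb hφ.not).not.of_iff fun m e w => by push Not; rfl

end PolyPred

namespace PolyTime

variable {φ : (ℕ → ℕ) → Env → (ℕ → ℕ) → Prop} {f g b : (ℕ → ℕ) → Env → (ℕ → ℕ) → ℕ}

theorem ite {_ : ∀ m e w, Decidable (φ m e w)} (hφ : PolyPred φ) (hf : PolyTime f)
    (hg : PolyTime g) :
    PolyTime fun m e w => if φ m e w then f m e w else g m e w := by
  obtain ⟨d, hd, h⟩ := hφ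
  convert (hd.mul hf).add (((const 1).sub hd).mul hg) using 4 with m e w
  rw [h]; split_ifs <;> simp

theorem div (hf : PolyTime f) (hg : PolyTime g) :
    PolyTime fun m e w => f m e w / g m e w := by
  -- The quotient is the number of `q < x` with `(q + 1) * y ≤ x`. The subtracted `1 - y` cancels
  -- all terms when `y = 0`, in accordance with `x / 0 = 0`.
  have h := sum (F := fun m e w q => (1 - ((q + 1) * g m e w - f m e w)) - (1 - g m e w)) hf
    (((const 1).sub ((((var 0).add (const 1)).mul hg.shift).sub hf.shift)).sub
      ((const 1).sub hg.shift))
  convert h using 4 with m e w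
  generalize f m e w = x
  generalize g m e w = y
  rcases Nat.eq_zero_or_pos y with rfl | hy
  · simp
  · have : ∀ q, 1 - ((q + 1) * y - x) - (1 - y) = if q < x / y then 1 else 0 := by
      intro q
      have : q < x / y ↔ (q + 1) * y ≤ x := by
        rw [← Nat.le_div_iff_mul_le hy]; rfl
      split_ifs <;> omega
    rw [Finset.sum_congr rfl fun q _ => this q, Finset.sum_boole]
    have : (Finset.range x).filter (fun q => q < x / y) = Finset.range (x / y) := by
      ext q
      simp only [Finset.mem_filter, Finset.mem_range]
      have := Nat.div_le_self x y
      omega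
    simp [this]

theorem mod (hf : PolyTime f) (hg : PolyTime g) :
    PolyTime fun m e w => f m e w % g m e w := by
  convert hf.sub (hg.mul (hf.div hg)) using 4 with m e w
  have := Nat.div_add_mod (f m e w) (g m e w)
  omega

end PolyTime

end RAM

namespace RAM

/-! ### Commands that write bits into the memory -/

/-- `c` is a transformation of the memory that is computed in polynomial time, in the sense of
`PolyTime`, and that writes only bits. -/
def PolyCmd (c : (ℕ → ℕ) → Env → (ℕ → ℕ) → ℕ → ℕ) : Prop :=
  (∀ m e w a, c m e w a ≤ 1 ∨ c m e w a = m a) ∧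
  ∃ N, ∀ (loc : ℕ → ℕ) (r : ℕ), 6 ≤ r → (∀ i < N, loc i < r) → ∃ (p : Prog) (C : ℕ),
    ∀ s w B, Holds N loc s w B →
      ∃ s' t, Exec p s s' t ∧ t ≤ B ^ C ∧ s'.mem = c s.mem s.env w ∧ ∀ i < r, s'.reg i = s.reg i

/-- Repeat a transformation of the memory that depends on a loop index. -/
def loop (c : ℕ → (ℕ → ℕ) → ℕ → ℕ) (m : ℕ → ℕ) : ℕ → ℕ → ℕ
  | 0 => m
  | i + 1 => c i (loop c m i)

namespace PolyCmd

open Classical in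
theorem store {f : (ℕ → ℕ) → Env → (ℕ → ℕ) → ℕ} {φ : (ℕ → ℕ) → Env → (ℕ → ℕ) → Prop}
    (hf : PolyTime f) (hφ : PolyPred φ) :
    PolyCmd fun m e w => Function.update m (f m e w) (if φ m e w then 1 else 0) := by
  obtain ⟨g, hg, h⟩ := hφ
  obtain ⟨N, H⟩ := hf.exec_two hg
  refine ⟨fun m e w a => ?_, N, fun loc r hr hl => ?_⟩
  · simp only [Function.update_apply]
    split_ifs <;> simp
  obtain ⟨p, C, hp⟩ := H loc r hr hl
  refine ⟨.seq p (.store r (r + 1)), C + C + 1, fun s w B hs => ?_⟩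
  obtain ⟨-, -, s₁, t₁, e₁, ht₁, hm₁, hr₁, hv₁, hv₂⟩ := hp s w B hs
  have hB := hs.two_le
  have h1 : 1 ≤ B ^ C := Nat.one_le_pow _ _ (by omega)
  refine ⟨_, _, e₁.seq (Exec.store r (r + 1) s₁), pow_bound_add hB ht₁ h1, ?_, hr₁⟩
  · simp [hv₁, hv₂, hm₁, h]

theorem seq {c d : (ℕ → ℕ) → Env → (ℕ → ℕ) → ℕ → ℕ} (hc : PolyCmd c) (hd : PolyCmd d) :
    PolyCmd fun m e w => d (c m e w) e w := by
  obtain ⟨hc1, N, hc⟩ := hc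
  obtain ⟨hd1, N', hd⟩ := hd
  refine ⟨fun m e w a => ?_, max N N', fun loc r hr hl => ?_⟩
  · rcases hd1 (c m e w) e w a with h | h
    · exact .inl h
    · exact (hc1 m e w a).imp (fun h' => h.trans_le h') h.trans
  obtain ⟨p, C, hp⟩ := hc loc r hr fun i hi => hl i (by omega)
  obtain ⟨q, C', hq⟩ := hd loc r hr fun i hi => hl i (by omega)
  refine ⟨.seq p q, C + C' + 1, fun s w B h => ?_⟩
  obtain ⟨s₁, t₁, e₁, ht₁, hm₁, hr₁⟩ := hp s w B (h.mono (by omega))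
  have henv : s₁.env = s.env := State.env_congr fun i hi => hr₁ i (by omega)
  have hB := h.two_le
  obtain ⟨s₂, t₂, e₂, ht₂, hm₂, hr₂⟩ := hq s₁ w B ⟨hB, fun a => by
      have := h.mem_le a
      rw [hm₁]
      rcases hc1 s.mem s.env w a with h | h <;> omega,
    fun i hi => hr₁ i (by omega) ▸ h.env_le i hi,
    fun i hi => (hr₁ _ (hl i (by omega))).trans (h.var_eq i (by omega)),
    fun i hi => h.var_le i (by omega)⟩
  rw [hm₁, henv] at hm₂
  exact ⟨s₂, _, e₁.seq e₂, pow_bound_add h.two_le ht₁ ht₂, hm₂,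
    fun i hi => (hr₂ i hi).trans (hr₁ i hi)⟩

/-- After any number of rounds each cell is unchanged or at most `1`, so the bound on the memory
never deteriorates and all rounds obey one time bound. This is why commands are required to write
only bits. -/
theorem loop {b : (ℕ → ℕ) → Env → (ℕ → ℕ) → ℕ} {c : (ℕ → ℕ) → Env → (ℕ → ℕ) → ℕ → ℕ → ℕ}
    (hb : PolyTime b) (hc : PolyCmd fun m e w => c m e (fun j => w (j + 1)) (w 0)) :
    PolyCmd fun m e w => RAM.loop (fun i m => c m e w i) m (b m e w) := by
  obtain ⟨N, hb⟩ := hb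
  obtain ⟨hc1, N', hc⟩ := hc
  have bit : ∀ m e w n a, RAM.loop (fun i m => c m e w i) m n a ≤ 1 ∨
      RAM.loop (fun i m => c m e w i) m n a = m a := by
    intro m e w n a
    induction n with
    | zero => exact .inr rfl
    | succ n ih =>
      rcases hc1 (RAM.loop (fun i m => c m e w i) m n) e (cons n w) a with h | h
      · exact .inl h
      · exact ih.imp (fun h' => h.trans_le h') h.trans
  refine ⟨fun m e w a => bit m e w _ a, max N N', fun loc r hr hl => ?_⟩
  obtain ⟨p, C, hp⟩ := hb loc (r + 1) (by omega) fun i hi => (hl i (by omega)).trans (by omega)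
  obtain ⟨q, C', hq⟩ := hc (cons r loc) (r + 2) (by omega) (by
    intro i hi
    match i with
    | 0 => simp
    | i + 1 => exact (hl i (by omega)).trans (by omega))
  set z := (C + 1) * C' with hz
  refine ⟨.seq p (.seq (.const r 0) (.while (r + 1)
    (.seq q (.seq (.const (r + 2) 1)
      (.seq (.add r r (r + 2)) (.sub (r + 1) (r + 1) (r + 2))))))),
    C + (1 + (C + (z + 4 + 1) + 0 + 1) + 1) + 1, fun s w B h => ?_⟩
  obtain ⟨hbB, s₁, t₁, e₁, ht₁, hm₁, hr₁, hv₁⟩ := hp s w B (h.mono (by omega))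
  have hB := h.two_le
  set n := b s.mem s.env w with hn
  have hB1 : B ≤ B ^ (C + 1) := by
    calc B = B ^ 1 := (pow_one B).symm
      _ ≤ _ := Nat.pow_le_pow_right (by omega) (by omega)
  set M : ℕ → ℕ → ℕ := RAM.loop (fun i m => c m s.env w i) s.mem with hM
  let Inv : ℕ → State → Prop := fun i s' => s'.mem = M i ∧ (∀ j < r, s'.reg j = s.reg j) ∧
    s'.reg r = i ∧ s'.reg (r + 1) = n - i
  have step : ∀ i s', i < n → Inv i s' → ∃ s'' t, Exec (.seq q (.seq (.const (r + 2) 1)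
      (.seq (.add r r (r + 2)) (.sub (r + 1) (r + 1) (r + 2))))) s' s'' t ∧
      t ≤ B ^ z + 3 ∧ Inv (i + 1) s'' := by
    rintro i s' hi ⟨hm, hs, h0, h1⟩
    have henv : s'.env = s.env := State.env_congr fun i hi => hs i (by omega)
    have hold : Holds N' (cons r loc) s' (cons i w) (B ^ (C + 1)) := by
      refine ⟨hB.trans hB1, fun x => ?_,
        fun x hx => (hs x (by omega)) ▸ (h.env_le x hx).trans hB1, fun x hx => ?_, fun x hx => ?_⟩
      · rw [hm]
        have := h.mem_le x
        rcases bit s.mem s.env w i x with h | h <;> rw [hM] <;> omega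
      · match x with
        | 0 => simpa using h0
        | x + 1 => exact (hs _ (hl x (by omega))).trans (h.var_eq x (by omega))
      · match x with
        | 0 => exact hi.le.trans (pow_bound_mono hB hbB (by omega))
        | x + 1 => exact (h.var_le x (by omega)).trans hB1
    obtain ⟨s₂, t₂, e₂, ht₂, hm₂, hr₂⟩ := hq s' _ _ hold
    rw [← pow_mul, ← hz] at ht₂
    refine ⟨_, _, e₂.seq (Exec.seq (Exec.const _ _ _) (Exec.seq (Exec.add _ _ _ _)
      (Exec.sub _ _ _ _))), by omega, ?_, fun j hj => ?_, ?_, ?_⟩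
    · simp only [hm₂, hm, henv, hM]; rfl
    · have a0 : j ≠ r := by omega
      have a1 : j ≠ r + 1 := by omega
      have a2 : j ≠ r + 2 := by omega
      simp [Function.update, a0, a1, a2, hr₂ j (by omega), hs j hj]
    · simp [Function.update, hr₂ r (by omega), h0]
    · simp [Function.update, hr₂ (r + 1) (by omega), h1]; omega
  let s₃ : State := ⟨Function.update s₁.reg r 0, s₁.mem⟩
  have hinv : Inv 0 s₃ := by
    refine ⟨hm₁, fun j hj => ?_, ?_, ?_⟩
    · have a0 : j ≠ r := by omega
      simp [s₃, Function.update, a0, hr₁ j (by omega)]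
    · simp [s₃]
    · simp [s₃, Function.update, hv₁, hn]
  obtain ⟨s₄, t₄, e₄, ht₄, h₄⟩ := exec_countdown (c := r + 1) Inv (fun i s _ h => h.2.2.2) step
    n 0 s₃ (by omega) hinv
  refine ⟨s₄, _, e₁.seq ((Exec.const r 0 s₁).seq e₄), ?_, h₄.1, h₄.2.1⟩
  have hT : (B ^ z + 3) + 1 ≤ B ^ (z + 4 + 1) := by
    simpa [add_assoc] using pow_bound_add hB (le_refl (B ^ z)) (pow_bound_const hB 4)
  exact pow_bound_add hB ht₁ (pow_bound_add hB (pow_bound_const hB 1)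
    (ht₄.trans (pow_bound_loop hB hbB hT)))

end PolyCmd

/-! ### Least fixed points -/

/-- The least fixed point, below `K`, of a monotone operator on sets of numbers. -/
def Lfp (K : ℕ) (Φ : Set ℕ → ℕ → Prop) (c : ℕ) : Prop :=
  ∀ X : Set ℕ, (∀ d, d < K → Φ X d → d ∈ X) → c ∈ X

theorem Lfp.step {K : ℕ} {Φ : Set ℕ → ℕ → Prop} (hΦ : ∀ X Y c, X ⊆ Y → Φ X c → Φ Y c) {c : ℕ}
    (hc : c < K) (h : Φ {d | d < K ∧ Lfp K Φ d} c) : Lfp K Φ c := fun X hX =>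
  hX c hc (hΦ _ _ _ (fun _ hd => hd.2 X hX) h)

open Classical in
/-- Mark the entry `c` of the table at address `β` if the rule `φ` applies. -/
noncomputable def mark (β : ℕ) (φ : (ℕ → ℕ) → ℕ → Prop) (c : ℕ) (m : ℕ → ℕ) : ℕ → ℕ :=
  Function.update m (β + c) (if m (β + c) ≠ 0 ∨ φ m c then 1 else 0)

/-- Saturate the table of length `K` at address `β` under the rule `φ`. -/
noncomputable def saturate (β K : ℕ) (φ : (ℕ → ℕ) → ℕ → Prop) (m : ℕ → ℕ) : ℕ → ℕ :=
  loop (fun _ m => loop (fun c m => mark β φ c m) m K) m K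

theorem PolyCmd.saturate {β K : Env → ℕ} {φ : (ℕ → ℕ) → Env → ℕ → Prop}
    (hβ : PolyTime fun _ e _ => β e) (hK : PolyTime fun _ e _ => K e)
    (hφ : PolyPred fun m e w => φ m e (w 0)) :
    PolyCmd fun m e _ => RAM.saturate (β e) (K e) (fun m c => φ m e c) m := by
  refine PolyCmd.loop (c := fun m e w i => RAM.loop (fun c m => mark (β e) (fun m c => φ m e c) c m)
    m (K e)) hK (PolyCmd.loop (c := fun m e w c => mark (β e) (fun m c => φ m e c) c m) hK ?_)
  have := hβ.add (PolyTime.var 0)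
  simp only [mark]
  convert store this ((PolyPred.ne this.get (.const 0)).or hφ)

/-! ### Saturation computes the least fixed point -/

section saturate

variable {β K : ℕ} {φ : (ℕ → ℕ) → ℕ → Prop} {Φ : Set ℕ → ℕ → Prop} {m₀ : ℕ → ℕ}

/-- The table of length `K` at address `β`. -/
def table (β K : ℕ) (m : ℕ → ℕ) : Set ℕ := {c | c < K ∧ m (β + c) ≠ 0}

theorem mark_of_lt {c a : ℕ} {m : ℕ → ℕ} (hc : c < K) (ha : a < β ∨ β + K ≤ a) :
    mark β φ c m a = m a := by
  rw [mark, Function.update_apply, if_neg (by omega)]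

theorem table_mark {c : ℕ} (hc : c < K) (m : ℕ → ℕ) :
    table β K (mark β φ c m) = table β K m ∪ {d | d = c ∧ φ m c} := by
  ext d
  by_cases h : d = c
  · subst h
    by_cases h1 : m (β + d) = 0 <;> by_cases h2 : φ m d <;> simp [table, mark, h1, h2, hc]
  · simp [table, mark, Function.update_apply, h]

theorem saturate_of_outside (m : ℕ → ℕ) {a : ℕ} (ha : a < β ∨ β + K ≤ a) :
    saturate β K φ m a = m a := by
  have h1 : ∀ m, ∀ k ≤ K, loop (fun c m => mark β φ c m) m k a = m a := by
    intro m k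
    induction k with
    | zero => exact fun _ => rfl
    | succ k ih => exact fun hk => (mark_of_lt (by omega) ha).trans (ih (by omega))
  have h2 : ∀ k, loop (fun _ m => loop (fun c m => mark β φ c m) m K) m k a = m a := by
    intro k
    induction k with
    | zero => rfl
    | succ k ih => exact (h1 _ K le_rfl).trans ih
  exact h2 K

/-- What saturation computes. -/
theorem saturate_spec (hzero : ∀ c < K, m₀ (β + c) = 0) (hΦ : ∀ X Y c, X ⊆ Y → Φ X c → Φ Y c)
    (hφ : ∀ m, (∀ a, (a < β ∨ β + K ≤ a) → m a = m₀ a) → ∀ c < K,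
      (φ m c ↔ Φ (table β K m) c)) :
    ∀ c < K, (saturate β K φ m₀ (β + c) ≠ 0 ↔ Lfp K Φ c) := by
  -- Soundness invariant: the memory outside the table is untouched and only members of the least
  -- fixed point are marked.
  let P : (ℕ → ℕ) → Prop := fun m => (∀ a, (a < β ∨ β + K ≤ a) → m a = m₀ a) ∧
    ∀ c ∈ table β K m, Lfp K Φ c
  have hmark : ∀ m c, c < K → P m → P (mark β φ c m) := by
    rintro m c hc ⟨h1, h2⟩
    refine ⟨fun a ha => (mark_of_lt hc ha).trans (h1 a ha), fun d hd => ?_⟩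
    rw [table_mark hc] at hd
    rcases hd with hd | ⟨rfl, hd⟩
    · exact h2 d hd
    · exact Lfp.step hΦ hc (hΦ _ _ _ (fun x hx => ⟨hx.1, h2 x hx⟩) ((hφ m h1 _ hc).1 hd))
  -- Marks made earlier in a round may already be used later in it. By monotonicity this can only
  -- help: a full round marks at least what one application of the rule to the old table yields.
  have hround : ∀ m, P m → ∀ k ≤ K, P (loop (fun c m => mark β φ c m) m k) ∧
      table β K m ⊆ table β K (loop (fun c m => mark β φ c m) m k) ∧
      ∀ c < k, Φ (table β K m) c → c ∈ table β K (loop (fun c m => mark β φ c m) m k) := by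
    intro m hm k
    induction k with
    | zero => exact fun _ => ⟨hm, subset_rfl, fun c hc => absurd hc (by omega)⟩
    | succ k ih =>
      intro hk
      obtain ⟨h1, h2, h3⟩ := ih (by omega)
      refine ⟨hmark _ k (by omega) h1, ?_, fun c hc hc' => ?_⟩
      · rw [loop, table_mark (by omega)]; exact h2.trans Set.subset_union_left
      · rw [loop, table_mark (by omega)]
        rcases Nat.lt_succ_iff_lt_or_eq.1 hc with h | rfl
        · exact .inl (h3 c h hc')
        · exact .inr ⟨rfl, (hφ _ h1.1 _ (by omega)).2 (hΦ _ _ _ h2 hc')⟩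
  set R := loop (fun _ m => loop (fun c m => mark β φ c m) m K) m₀ with hR
  have hP : ∀ i, P (R i) := by
    intro i
    induction i with
    | zero =>
      refine ⟨fun a _ => rfl, fun c hc => absurd (hzero c hc.1) hc.2⟩
    | succ i ih => exact (hround _ ih K le_rfl).1
  have hmono : ∀ i, table β K (R i) ⊆ table β K (R (i + 1)) := fun i => (hround _ (hP i) K le_rfl).2.1
  have hmono' : Monotone fun i => table β K (R i) := monotone_nat_of_le_succ hmono
  have hfin : ∀ i, (table β K (R i)).Finite := fun i =>
    (Set.finite_Iio K).subset fun c hc => hc.1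
  -- Either some round adds nothing, and then the table is closed under the rule, or each of the `K`
  -- rounds adds an entry, and then the table of length `K` is full.
  have hgrow : (∃ i < K, table β K (R (i + 1)) = table β K (R i)) ∨
      ∀ i ≤ K, i ≤ (table β K (R i)).ncard := by
    by_contra! hcon
    obtain ⟨hne, i, hi, hlt⟩ := hcon
    suffices ∀ i ≤ K, i ≤ (table β K (R i)).ncard by have := this i hi; omega
    intro i
    induction i with
    | zero => simp
    | succ i ih =>
      intro hi
      have := Set.ncard_lt_ncard ((hmono i).ssubset_of_ne (hne i (by omega)).symm) (hfin _)
      have := ih (by omega)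
      omega
  refine fun c hc => ⟨fun h => (hP K).2 c ⟨hc, h⟩, fun h => ?_⟩
  rcases hgrow with ⟨i, hi, heq⟩ | hcard
  · have := h (table β K (R i)) fun d hd hd' => heq ▸ (hround _ (hP i) K le_rfl).2.2 d hd hd'
    exact (hmono' hi.le this).2
  · have : table β K (R K) = Set.Iio K := by
      refine Set.eq_of_subset_of_ncard_le (fun c hc => hc.1) ?_ (Set.finite_Iio K)
      simpa using hcard K le_rfl
    have hc' : c ∈ table β K (R K) := this ▸ hc
    exact hc'.2

end saturate

end RAM

/-! ### Derivations that build tree-decompositions -/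

section Derivation

variable {V : Type*} [DecidableEq V] {G : SimpleGraph V}

/-- `Separated G b F U S`: a tree-decomposition of `G[U ∪ S]` with bags of size at most `b` and with
`S` inside the root bag can be built bottom-up, where all vertices of `U` have been forgotten
and no other ones; all sets of forgotten vertices that occur belong to the family `F`. -/
inductive Separated (G : SimpleGraph V) (b : ℕ) (F : Set (Finset V)) : Finset V → Finset V → Prop
  | leaf (S : Finset V) : S.card ≤ b → ∅ ∈ F → Separated G b F ∅ S
  | introduce {U S S' : Finset V} : Separated G b F U S → S ⊆ S' → Disjoint U S' → S'.card ≤ b →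
      Separated G b F U S'
  | forget {U S : Finset V} {u : V} : Separated G b F U (insert u S) → u ∉ S →
      (∀ w, G.Adj u w → w ∈ U ∪ S) → insert u U ∈ F → Separated G b F (insert u U) S
  | join {U₁ U₂ S : Finset V} : Separated G b F U₁ S → Separated G b F U₂ S → Disjoint U₁ U₂ →
      U₁ ∪ U₂ ∈ F → Separated G b F (U₁ ∪ U₂) S

namespace Separated

variable {b : ℕ} {F : Set (Finset V)} {U S : Finset V}

theorem mem_family (h : Separated G b F U S) : U ∈ F := by
  induction h with
  | leaf S h1 h2 => exact h2
  | introduce _ h1 h2 h3 ih => exact ih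
  | forget _ h1 h2 h3 ih => exact h3
  | join _ _ h1 h2 ih1 ih2 => exact h2

theorem disjoint (h : Separated G b F U S) : Disjoint U S := by
  induction h with
  | leaf S h1 h2 => simp
  | introduce _ h1 h2 h3 ih => exact h2
  | forget _ h1 h2 h3 ih =>
    rw [Finset.disjoint_insert_left]
    exact ⟨h1, ih.mono_right (Finset.subset_insert _ _)⟩
  | join _ _ h1 h2 ih1 ih2 => exact Finset.disjoint_union_left.2 ⟨ih1, ih2⟩

theorem card_le (h : Separated G b F U S) : S.card ≤ b := by
  induction h with
  | leaf S h1 h2 => exact h1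
  | introduce _ h1 h2 h3 ih => exact h3
  | forget _ h1 h2 h3 ih => exact (Finset.card_le_card (Finset.subset_insert _ _)).trans ih
  | join _ _ h1 h2 ih1 ih2 => exact ih1

/-- The neighbours of a vertex are checked when it is forgotten, and afterwards a vertex leaves the
bag only by being forgotten itself. -/
theorem mem_of_adj (h : Separated G b F U S) : ∀ u ∈ U, ∀ w, G.Adj u w → w ∈ U ∪ S := by
  induction h with
  | leaf S h1 h2 => simp
  | introduce _ h1 h2 h3 ih =>
    intro u hu w hw
    have := ih u hu w hw
    simp only [Finset.mem_union] at this ⊢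
    exact this.imp_right (h1 ·)
  | @forget U S u _ h1 h2 h3 ih =>
    intro v hv w hw
    rcases Finset.mem_insert.1 hv with rfl | hv
    · have := h2 w hw
      simp only [Finset.mem_union, Finset.mem_insert] at this ⊢; tauto
    · have := ih v hv w hw
      simp only [Finset.mem_union, Finset.mem_insert] at this ⊢; tauto
  | join _ _ h1 h2 ih1 ih2 =>
    intro u hu w hw
    rcases Finset.mem_union.1 hu with hu | hu
    · have := ih1 u hu w hw
      simp only [Finset.mem_union] at this ⊢; tauto
    · have := ih2 u hu w hw
      simp only [Finset.mem_union] at this ⊢; tauto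

/-- Proper colourings of the bag extend to the forgotten vertices. -/
theorem exists_coloring (h : Separated G b F U S) : ∀ c : V → Fin b, Set.InjOn c S →
    ∃ c' : V → Fin b, (∀ v ∈ S, c' v = c v) ∧
      ∀ u ∈ U, ∀ w, G.Adj u w → c' u ≠ c' w := by
  induction h with
  | leaf S h1 h2 => exact fun c hc => ⟨c, by simp, by simp⟩
  | @introduce U S S' h h1 h2 h3 ih =>
    intro c hc
    obtain ⟨c', hc1, hc2⟩ := ih c (hc.mono (by exact_mod_cast h1))
    -- Overwriting the colours on `S' \ S` is harmless: forgotten vertices have neighbours only in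
    -- `U ∪ S`, where nothing changes.
    refine ⟨fun v => if v ∈ S' then c v else c' v, fun v hv => by simp [hv], fun u hu w hw => ?_⟩
    have hu' : u ∉ S' := Finset.disjoint_left.1 h2 hu
    have hw' := h.mem_of_adj u hu w hw
    have := hc2 u hu w hw
    simp only [hu', if_false]
    split_ifs with hwS
    · rcases Finset.mem_union.1 hw' with h' | h'
      · exact absurd hwS (Finset.disjoint_left.1 h2 h')
      · rwa [← hc1 w h']
    · exact this
  | @forget U S u h h1 h2 h3 ih =>
    intro c hc
    have hcard := h.card_le
    rw [Finset.card_insert_of_notMem h1] at hcard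
    -- The bag `insert u S` has at most `b` elements, so `S` uses fewer than `b` colours. Giving `u`
    -- a colour unused on `S` keeps the colouring injective on the bag.
    obtain ⟨x, hx⟩ : ∃ x : Fin b, x ∉ S.image c := by
      by_contra! hcon
      have := Finset.card_le_card (fun x _ => hcon x : Finset.univ ⊆ S.image c)
      have h' := Finset.card_image_le (s := S) (f := c)
      simp at this
      omega
    have hx' : ∀ v ∈ S, c v ≠ x := fun v hv h => hx (Finset.mem_image.2 ⟨v, hv, h⟩)
    obtain ⟨c', hc1, hc2⟩ := ih (Function.update c u x) (by
      intro v hv w hw hvw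
      simp only [Finset.coe_insert, Set.mem_insert_iff, Finset.mem_coe] at hv hw
      simp only [Function.update_apply] at hvw
      split_ifs at hvw with a1 a2 a2
      · exact a1.trans a2.symm
      · exact absurd hvw.symm (hx' w (by tauto))
      · exact absurd hvw (hx' v (by tauto))
      · exact hc (by tauto) (by tauto) hvw)
    have hcu : c' u = x := by simpa using hc1 u (by simp)
    have hcS : ∀ v ∈ S, c' v = c v := fun v hv => by
      have hne : v ≠ u := fun h => h1 (h ▸ hv)
      simpa [hne] using hc1 v (by simp [hv])
    refine ⟨c', hcS, fun v hv w hw => ?_⟩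
    rcases Finset.mem_insert.1 hv with rfl | hv
    · rcases Finset.mem_union.1 (h2 w hw) with hwU | hwS
      · exact (hc2 w hwU _ hw.symm).symm
      · rw [hcu, hcS w hwS]; exact (hx' w hwS).symm
    · exact hc2 v hv w hw
  | @join U₁ U₂ S hU₁ hU₂ h1 h2 ih1 ih2 =>
    intro c hc
    obtain ⟨c₁, a1, a2⟩ := ih1 c hc
    obtain ⟨c₂, b1, b2⟩ := ih2 c hc
    have hS : ∀ v ∈ S, v ∉ U₁ ∧ v ∉ U₂ := fun v hv =>
      ⟨fun h => Finset.disjoint_left.1 hU₁.disjoint h hv,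
        fun h => Finset.disjoint_left.1 hU₂.disjoint h hv⟩
    refine ⟨fun v => if v ∈ U₁ then c₁ v else c₂ v, fun v hv => by simp [hS v hv, b1 v hv],
      fun u hu w hw => ?_⟩
    rcases Finset.mem_union.1 hu with hu | hu
    · have hne := a2 u hu w hw
      simp only [hu, if_true]
      split_ifs with h'
      · exact hne
      · have hwS : w ∈ S := by have := hU₁.mem_of_adj u hu w hw; simp_all
        rwa [b1 w hwS, ← a1 w hwS]
    · have hne := b2 u hu w hw
      have hu1 : u ∉ U₁ := fun h => Finset.disjoint_left.1 h1 h hu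
      have hw1 : w ∉ U₁ := fun h => by
        have := hU₂.mem_of_adj u hu w hw
        rcases Finset.mem_union.1 this with h' | h'
        · exact Finset.disjoint_left.1 h1 h h'
        · exact (hS w h').1 h
      simpa [hu1, hw1] using hne

/-- The elimination scheme of a derivation: the neighbours `B u` of `u` that are eliminated later
than `u`, in a chordal graph that contains `G`. -/
theorem exists_elimination (h : Separated G b F U S) : ∃ (r : V → ℕ) (B : V → Finset V), ∀ u ∈ U,
    (B u).card < b ∧ B u ⊆ U ∪ S ∧ (∀ x ∈ B u, x ∈ U → r u < r x) ∧
    (∀ w, G.Adj u w → w ∈ B u ∨ w ∈ U ∧ u ∈ B w) ∧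
    ∀ x ∈ B u, x ∈ U → ∀ w ∈ B u, w ≠ x → w ∈ B x ∨ w ∈ U ∧ x ∈ B w := by
  induction h with
  | leaf S h1 h2 => exact ⟨fun _ => 0, fun _ => ∅, by simp⟩
  | @introduce U S S' h h1 h2 h3 ih =>
    obtain ⟨r, B, H⟩ := ih
    refine ⟨r, B, fun u hu => ?_⟩
    obtain ⟨a1, a2, a3⟩ := H u hu
    exact ⟨a1, a2.trans (Finset.union_subset_union_right h1), a3⟩
  | @forget U S u h h1 h2 h3 ih =>
    obtain ⟨r, B, H⟩ := ih
    have hd := h.disjoint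
    have huU : u ∉ U := fun h' => Finset.disjoint_left.1 hd h' (by simp)
    have hSU : ∀ v ∈ S, v ∉ U := fun v hv h' => Finset.disjoint_left.1 hd h' (by simp [hv])
    have hcard := h.card_le
    rw [Finset.card_insert_of_notMem h1] at hcard
    -- The vertex `u` is eliminated after all of `U`. In the chordal graph that makes every bag a
    -- clique, its later neighbours are the remaining bag `S`.
    refine ⟨Function.update r u (U.sup r + 1), Function.update B u S, fun v hv => ?_⟩
    have hne : ∀ w ∈ U, w ≠ u := fun w hw h' => huU (h' ▸ hw)
    have hneS : ∀ w ∈ S, w ≠ u := fun w hw h' => h1 (h' ▸ hw)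
    rcases Finset.mem_insert.1 hv with rfl | hvU
    · simp only [Function.update_self]
      refine ⟨by omega, fun x hx => by simp [hx], fun x hx hxU => ?_, fun w hw => ?_,
        fun x hx hxU => ?_⟩
      · exact absurd (Finset.mem_of_mem_insert_of_ne hxU (hneS x hx)) (hSU x hx)
      · rcases Finset.mem_union.1 (h2 w hw) with hwU | hwS
        · obtain ⟨-, -, -, a4, -⟩ := H w hwU
          have := a4 v hw.symm
          simp only [Function.update_of_ne (hne w hwU), Finset.mem_insert]
          tauto
        · exact .inl hwS
      · exact absurd (Finset.mem_of_mem_insert_of_ne hxU (hneS x hx)) (hSU x hx)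
    · obtain ⟨a1, a2, a3, a4, a5⟩ := H v hvU
      simp only [Function.update_of_ne (hne v hvU)]
      refine ⟨a1, fun x hx => ?_, fun x hx hxU => ?_, fun w hw => ?_, fun x hx hxU w hw hwx => ?_⟩
      · have := a2 hx
        simp only [Finset.mem_union, Finset.mem_insert] at this ⊢; tauto
      · by_cases hxu : x = u
        · subst hxu
          have := Finset.le_sup (f := r) hvU
          simp only [Function.update_self]; omega
        · rw [Function.update_of_ne hxu]
          exact a3 x hx (Finset.mem_of_mem_insert_of_ne hxU hxu)
      · rcases a4 w hw with h' | ⟨h', h''⟩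
        · exact .inl h'
        · refine .inr ⟨by simp [h'], ?_⟩
          rwa [Function.update_of_ne (hne w h')]
      · have hw2 := a2 hw
        by_cases hxu : x = u
        · subst hxu
          simp only [Function.update_self]
          simp only [Finset.mem_union, Finset.mem_insert] at hw2
          rcases hw2 with hwU | hwu | hwS
          · refine .inr ⟨by simp [hwU], ?_⟩
            rw [Function.update_of_ne hwx]
            rcases a5 w hw hwU x hx (Ne.symm hwx) with h' | ⟨h', -⟩
            · exact h'
            · exact absurd h' huU
          · exact absurd hwu hwx
          · exact .inl hwS
        · have hxU := Finset.mem_of_mem_insert_of_ne hxU hxu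
          rw [Function.update_of_ne hxu]
          rcases a5 x hx hxU w hw hwx with h' | ⟨h', h''⟩
          · exact .inl h'
          · exact .inr ⟨by simp [h'], by rwa [Function.update_of_ne (hne w h')]⟩
  | @join U₁ U₂ S hU₁ hU₂ h1 h2 ih1 ih2 =>
    obtain ⟨r₁, B₁, H₁⟩ := ih1
    obtain ⟨r₂, B₂, H₂⟩ := ih2
    have d1 := Finset.disjoint_left.1 hU₁.disjoint
    have d2 := Finset.disjoint_left.1 hU₂.disjoint
    have d := Finset.disjoint_left.1 h1
    -- The ranks of the two sides need not be comparable: later neighbours of a vertex of `U₁` lie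
    -- in `U₁ ∪ S`, hence outside `U₂`, and symmetrically.
    refine ⟨fun v => if v ∈ U₁ then r₁ v else r₂ v, fun v => if v ∈ U₁ then B₁ v else B₂ v,
      fun u hu => ?_⟩
    rcases Finset.mem_union.1 hu with hu | hu
    · obtain ⟨a1, a2, a3, a4, a5⟩ := H₁ u hu
      have hB : ∀ x ∈ B₁ u, x ∈ U₁ ∪ U₂ → x ∈ U₁ := fun x hx hx' => by
        have := a2 hx
        simp only [Finset.mem_union] at this hx'
        rcases this with h' | h'
        · exact h'
        · exact hx'.resolve_right fun h'' => d2 h'' h'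
      simp only [hu, if_true]
      refine ⟨a1, fun x hx => ?_, fun x hx hxU => ?_, fun w hw => ?_, fun x hx hxU w hw hwx => ?_⟩
      · have := a2 hx
        simp only [Finset.mem_union] at this ⊢; tauto
      · simp only [hB x hx hxU, if_true]; exact a3 x hx (hB x hx hxU)
      · rcases a4 w hw with h' | ⟨h', h''⟩
        · exact .inl h'
        · exact .inr ⟨by simp [h'], by simpa [h'] using h''⟩
      · simp only [hB x hx hxU, if_true]
        rcases a5 x hx (hB x hx hxU) w hw hwx with h' | ⟨h', h''⟩
        · exact .inl h'
        · exact .inr ⟨by simp [h'], by simpa [h'] using h''⟩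
    · obtain ⟨a1, a2, a3, a4, a5⟩ := H₂ u hu
      have hn : ∀ x ∈ U₂, x ∉ U₁ := fun x hx hx' => d hx' hx
      have hB : ∀ x ∈ B₂ u, x ∈ U₁ ∪ U₂ → x ∈ U₂ := fun x hx hx' => by
        have := a2 hx
        simp only [Finset.mem_union] at this hx'
        rcases this with h' | h'
        · exact h'
        · exact hx'.resolve_left fun h'' => d1 h'' h'
      simp only [hn u hu, if_false]
      refine ⟨a1, fun x hx => ?_, fun x hx hxU => ?_, fun w hw => ?_, fun x hx hxU w hw hwx => ?_⟩
      · have := a2 hx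
        simp only [Finset.mem_union] at this ⊢; tauto
      · simp only [hn x (hB x hx hxU), if_false]; exact a3 x hx (hB x hx hxU)
      · rcases a4 w hw with h' | ⟨h', h''⟩
        · exact .inl h'
        · exact .inr ⟨by simp [h'], by simpa [hn w h'] using h''⟩
      · simp only [hn x (hB x hx hxU), if_false]
        rcases a5 x hx (hB x hx hxU) w hw hwx with h' | ⟨h', h''⟩
        · exact .inl h'
        · exact .inr ⟨by simp [h'], by simpa [hn w h'] using h''⟩

end Separated

end Derivation

/-! ### From derivations to tree-decompositions -/

section Treewidth

open SimpleGraph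

/-- A derivation yields a tree-decomposition. -/
theorem Separated.exists_treeDecomposition {n b : ℕ} {G : SimpleGraph (Fin n)}
    {F : Set (Finset (Fin n))} (h : Separated G b F Finset.univ ∅) :
    ∃ D : TreeDecomposition G, ∀ t, (D.bag t).card ≤ b := by
  rcases Nat.eq_zero_or_pos n with rfl | hn
  · refine ⟨⟨1, ⊥, ?_, fun _ => ∅, fun u => u.elim0, fun u => u.elim0⟩, by simp⟩
    exact IsTree.of_subsingleton
  obtain ⟨r, B, H⟩ := h.exists_elimination
  simp only [Finset.mem_univ, true_and, forall_const, Finset.union_empty] at H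
  have hcard := fun u => (H u).1
  have hrank := fun u => (H u).2.2.1
  have hadj := fun u => (H u).2.2.2.1
  have hclique := fun u => (H u).2.2.2.2
  have : Nonempty (Fin n) := ⟨⟨0, hn⟩⟩
  obtain ⟨z, -, hz⟩ := Finset.exists_max_image Finset.univ r Finset.univ_nonempty
  have hz : ∀ u, r u ≤ r z := fun u => hz u (by simp)
  -- The parent of `u` is the first vertex of `B u` to be eliminated; since `B u` is a clique, the
  -- rest of `B u` lies in `B` of the parent. Vertices with empty `B u` are attached to the last
  -- vertex `z`, which joins the pieces into one tree.
  have hpar : ∀ u, ∃ x, ((B u).Nonempty → x ∈ B u ∧ ∀ w ∈ B u, w ≠ x → w ∈ B x) ∧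
      (¬ (B u).Nonempty → x = z) := by
    intro u
    by_cases hu : (B u).Nonempty
    · obtain ⟨x, hx, hmin⟩ := Finset.exists_min_image (B u) r hu
      refine ⟨x, fun _ => ⟨hx, fun w hw hwx => ?_⟩, fun h => absurd hu h⟩
      refine (hclique u x hx w hw hwx).resolve_right fun h' => ?_
      have := hrank w x h'
      have := hmin w hw
      omega
    · exact ⟨z, fun h => absurd h hu, fun _ => rfl⟩
  choose par hpar using hpar
  have hBz : ¬ (B z).Nonempty := by
    rintro ⟨x, hx⟩
    have := hrank z x hx
    have := hz x
    omega
  let T : SimpleGraph (Fin n) := SimpleGraph.fromRel fun u x => par u = x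
  have hT : ∀ u, u ≠ par u → T.Adj u (par u) := fun u hu => by
    simp [T, SimpleGraph.fromRel_adj, hu]
  -- Induction from the root downwards, on the difference to the maximal rank.
  have hdesc : ∀ {P : Fin n → Prop}, (∀ u, (∀ x, r u < r x → P x) → P u) → ∀ u, P u := by
    intro P hP
    have : ∀ d u, r z - r u = d → P u := by
      intro d
      induction d using Nat.strong_induction_on with
      | _ d ih =>
        intro u hu
        refine hP u fun x hx => ih _ ?_ x rfl
        have := hz x
        omega
    exact fun u => this _ u rfl
  have hne : ∀ u, (B u).Nonempty → u ≠ par u := fun u hu h => by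
    have := hrank u _ ((hpar u).1 hu).1
    rw [← h] at this
    omega
  have hconn : T.Connected := by
    have : ∀ u, T.Reachable u z := by
      refine hdesc fun u ih => ?_
      by_cases hu : (B u).Nonempty
      · exact (hT u (hne u hu)).reachable.trans (ih _ (hrank u _ ((hpar u).1 hu).1))
      · by_cases huz : u = z
        · rw [huz]
        · have h1 := (hpar u).2 hu
          have := hT u (h1 ▸ huz)
          rw [h1] at this
          exact this.reachable
    exact ⟨fun u v => (this u).trans (this v).symm⟩
  -- Every edge joins some `u ≠ z` to its parent, so there are at most `n - 1` edges; a connected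
  -- graph with so few edges is a tree.
  have hedge : T.edgeSet ⊆ (fun u => s(u, par u)) '' {u | u ≠ z} := by
    intro e he
    induction e with
    | _ u v =>
    rw [mem_edgeSet, SimpleGraph.fromRel_adj] at he
    have hparz : par z = z := (hpar z).2 hBz
    rcases he with ⟨huv, rfl | rfl⟩
    · exact ⟨u, fun h => huv (by have h : u = z := h; rw [h, hparz]), rfl⟩
    · exact ⟨v, fun h => huv (by have h : v = z := h; rw [h, hparz]), Sym2.eq_swap⟩
  have hTree : T.IsTree := by
    rw [isTree_iff_connected_and_card]
    refine ⟨hconn, le_antisymm ?_ hconn.card_vert_le_card_edgeSet_add_one⟩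
    have h1 : T.edgeSet.ncard ≤ _ := Set.ncard_le_ncard hedge (Set.toFinite _)
    have h2 := h1.trans (Set.ncard_image_le (Set.toFinite {u | u ≠ z}))
    have h3 : ({u | u ≠ z} : Set (Fin n)).ncard = n - 1 := by
      have : ({u | u ≠ z} : Set (Fin n)) = {z}ᶜ := by ext; simp
      rw [this, Set.ncard_compl]
      simp
    have h4 : Nat.card T.edgeSet = T.edgeSet.ncard := rfl
    have h5 : Nat.card (Fin n) = n := by simp
    omega
  refine ⟨⟨n, T, hTree, fun u => insert u (B u), fun u w huw => ?_, fun v => ?_⟩, fun u => ?_⟩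
  · rcases hadj u w huw with h' | h'
    · exact ⟨u, by simp, by simp [h']⟩
    · exact ⟨w, by simp [h'], by simp⟩
  · have hv : v ∈ {t | v ∈ insert t (B t)} := by simp
    -- From any node whose bag contains `v`, going to the parent keeps `v` in the bag until the node
    -- `v` itself is reached.
    have : ∀ t (ht : t ∈ {t | v ∈ insert t (B t)}),
        (T.induce {t | v ∈ insert t (B t)}).Reachable ⟨t, ht⟩ ⟨v, hv⟩ := by
      refine hdesc fun t ih ht => ?_
      by_cases htv : t = v
      · subst htv; exact Reachable.refl _
      · have hvt : v ∈ B t := Finset.mem_of_mem_insert_of_ne ht (Ne.symm htv)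
        obtain ⟨h1, h2⟩ := (hpar t).1 ⟨v, hvt⟩
        have hmem : par t ∈ {t | v ∈ insert t (B t)} := by
          by_cases hvx : v = par t
          · simp [← hvx]
          · exact Finset.mem_insert_of_mem (h2 v hvt hvx)
        have hadj : (T.induce {t | v ∈ insert t (B t)}).Adj ⟨t, ht⟩ ⟨par t, hmem⟩ :=
          hT t (hne t ⟨v, hvt⟩)
        exact hadj.reachable.trans (ih _ (hrank t _ h1) hmem)
    have hN : Nonempty {t | v ∈ insert t (B t)} := ⟨⟨v, hv⟩⟩
    exact ⟨fun s t => (this s.1 s.2).trans (this t.1 t.2).symm⟩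
  · exact (Finset.card_insert_le _ _).trans (hcard u)

/-- The decomposition with a single bag shows that the set of widths is nonempty, so the infimum is
attained. Writing the bound as `card ≤ q + 1` avoids truncated subtraction. -/
theorem treewidth_le_iff {n q : ℕ} {G : SimpleGraph (Fin n)} :
    treewidth G ≤ q ↔ ∃ D : TreeDecomposition G, ∀ t, (D.bag t).card ≤ q + 1 := by
  have key : ∀ D : TreeDecomposition G, D.width ≤ q ↔ ∀ t, (D.bag t).card ≤ q + 1 := by
    intro D
    rw [TreeDecomposition.width, Nat.sub_le_iff_le_add, Finset.sup_le_iff]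
    simp
  constructor
  · intro h
    have hne : {w | ∃ D : TreeDecomposition G, D.width = w}.Nonempty := by
      refine ⟨_, ⟨1, ⊥, IsTree.of_subsingleton, fun _ => Finset.univ, fun u v _ => ⟨0, by simp⟩,
        fun v => ?_⟩, rfl⟩
      have : Nonempty {t : Fin 1 | v ∈ (Finset.univ : Finset (Fin n))} := ⟨⟨0, Finset.mem_univ v⟩⟩
      exact ⟨fun a b => by rw [Subsingleton.elim a b]⟩
    obtain ⟨D, hD⟩ := Nat.sInf_mem hne
    exact ⟨D, (key D).1 (hD.le.trans h)⟩
  · rintro ⟨D, hD⟩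
    have : D.width ∈ {w | ∃ D : TreeDecomposition G, D.width = w} := ⟨D, rfl⟩
    exact (Nat.sInf_le this).trans ((key D).2 hD)

end Treewidth

/-! ### Components of the graph without a vertex set -/

section Components

variable {V : Type*} (G : SimpleGraph V)

/-- `v` can be reached from `u` in the graph without the vertices in `S`. -/
def ConnectedAvoiding (S : Finset V) (u v : V) : Prop :=
  u ∉ S ∧ Relation.ReflTransGen (fun x y => G.Adj x y ∧ y ∉ S) u v

namespace ConnectedAvoiding

variable {G} {S S' : Finset V} {u v w : V}

theorem refl (h : u ∉ S) : ConnectedAvoiding G S u u := ⟨h, .refl⟩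

theorem notMem (h : ConnectedAvoiding G S u v) : v ∉ S := by
  rcases Relation.ReflTransGen.cases_tail h.2 with rfl | ⟨_, _, h'⟩
  · exact h.1
  · exact h'.2

theorem trans (h : ConnectedAvoiding G S u v) (h' : ConnectedAvoiding G S v w) :
    ConnectedAvoiding G S u w := ⟨h.1, h.2.trans h'.2⟩

theorem tail (h : ConnectedAvoiding G S u v) (h' : G.Adj v w) (hw : w ∉ S) :
    ConnectedAvoiding G S u w := ⟨h.1, h.2.tail ⟨h', hw⟩⟩

theorem symm (h : ConnectedAvoiding G S u v) : ConnectedAvoiding G S v u := by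
  obtain ⟨hu, h⟩ := h
  induction h with
  | refl => exact refl hu
  | @tail x y hx hxy ih =>
    exact ((refl hxy.2).tail hxy.1.symm (ConnectedAvoiding.notMem ⟨hu, hx⟩)).trans ih

theorem mono (hS : S' ⊆ S) (h : ConnectedAvoiding G S u v) : ConnectedAvoiding G S' u v :=
  ⟨fun h' => h.1 (hS h'), Relation.ReflTransGen.mono (fun _ _ h => ⟨h.1, fun h' => h.2 (hS h')⟩) _ _ h.2⟩

end ConnectedAvoiding

end Components

section
variable {V : Type*} [Fintype V] {G : SimpleGraph V}

open Classical in
/-- The component of `u` in the graph without the vertices in `S`. -/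
noncomputable def component (G : SimpleGraph V) (S : Finset V) (u : V) : Finset V :=
  {w | ConnectedAvoiding G S u w}

theorem mem_component {S : Finset V} {u w : V} :
    w ∈ component G S u ↔ ConnectedAvoiding G S u w := by simp [component]

open Classical in
/-- The union of the components of the graph without `S` that meet the set `X`. -/
noncomputable def components (G : SimpleGraph V) (S : Finset V) (X : Set V) : Finset V :=
  {w | ∃ x ∈ X, ConnectedAvoiding G S x w}

theorem mem_components {S : Finset V} {X : Set V} {w : V} :
    w ∈ components G S X ↔ ∃ x ∈ X, ConnectedAvoiding G S x w := by simp [components]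

end

/-- A derivation for each component of a set yields one for the set. -/
theorem separated_of_components {n b : ℕ} {G : SimpleGraph (Fin n)} {F : Set (Finset (Fin n))}
    {C S : Finset (Fin n)} (hS : S.card ≤ b)
    (hC : ∀ w ∈ C, ∀ w', ConnectedAvoiding G S w w' → w' ∈ C) (hCS : Disjoint C S)
    (hcomp : ∀ w ∈ C, Separated G b F (component G S w) S)
    (hF : ∀ j ≤ n, C ∩ components G S {x | (x : ℕ) < j} ∈ F) : Separated G b F C S := by
  have hall : C ∩ components G S {x | (x : ℕ) < n} = C := by
    refine Finset.inter_eq_left.2 fun w hw => mem_components.2 ⟨w, w.2, .refl ?_⟩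
    exact Finset.disjoint_left.1 hCS hw
  -- Components are joined in the order of the vertices: step `j` adds the component of vertex `j`
  -- if that vertex is in `C` and not yet covered. Hence the only intermediate unions are the ones
  -- indexed by initial segments.
  suffices ∀ j ≤ n, Separated G b F (C ∩ components G S {x | (x : ℕ) < j}) S from
    hall ▸ this n le_rfl
  intro j
  induction j with
  | zero =>
    intro hj
    have h0 : C ∩ components G S {x | (x : ℕ) < 0} = ∅ := by
      ext w; simp [mem_components]
    have := hF 0 hj
    rw [h0] at this ⊢
    exact .leaf S hS this
  | succ j ih =>
    intro hj
    have hFj := hF (j + 1) hj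
    have ih := ih (by omega)
    let x : Fin n := ⟨j, by omega⟩
    have hx : ∀ y : Fin n, (y : ℕ) < j + 1 ↔ (y : ℕ) < j ∨ y = x := fun y => by
      rw [Fin.ext_iff]; show _ ↔ _ ∨ (y : ℕ) = j; omega
    by_cases hnew : x ∈ C ∧ x ∉ components G S {x | (x : ℕ) < j}
    · have heq : C ∩ components G S {x | (x : ℕ) < j + 1} =
          (C ∩ components G S {x | (x : ℕ) < j}) ∪ component G S x := by
        ext w
        simp only [Finset.mem_inter, mem_components, Finset.mem_union, mem_component, hx,
          Set.mem_ofPred_eq]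
        constructor
        · rintro ⟨h1, y, hy | rfl, h2⟩
          · exact .inl ⟨h1, y, hy, h2⟩
          · exact .inr h2
        · rintro (⟨h1, y, hy, h2⟩ | h2)
          · exact ⟨h1, y, .inl hy, h2⟩
          · exact ⟨hC x hnew.1 w h2, x, .inr rfl, h2⟩
      rw [heq] at hFj ⊢
      refine .join ih (hcomp x hnew.1) ?_ hFj
      rw [Finset.disjoint_left]
      intro w hw hw'
      obtain ⟨y, hy, h2⟩ := mem_components.1 (Finset.mem_inter.1 hw).2
      exact hnew.2 (mem_components.2 ⟨y, hy, h2.trans (mem_component.1 hw').symm⟩)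
    · have heq : C ∩ components G S {x | (x : ℕ) < j + 1} =
          C ∩ components G S {x | (x : ℕ) < j} := by
        ext w
        simp only [Finset.mem_inter, mem_components, hx, Set.mem_ofPred_eq]
        refine and_congr_right fun hw => ⟨?_, ?_⟩
        · rintro ⟨y, hy | rfl, h2⟩
          · exact ⟨y, hy, h2⟩
          · have hxC := hC w hw _ h2.symm
            have : x ∈ components G S {x | (x : ℕ) < j} := by tauto
            obtain ⟨y, hy, h3⟩ := mem_components.1 this
            exact ⟨y, hy, h3.trans h2⟩
        · rintro ⟨y, hy, h2⟩
          exact ⟨y, .inl hy, h2⟩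
      rwa [heq]

/-! ### From tree-decompositions to derivations -/

section

open SimpleGraph

/-- The key fact on tree-decompositions: if a connected set `C` avoids the bag of `t` and the edge
from `t` to `t'` leads towards `C`, then the neighbours of `C` in the bag of `t` are in the bag of `t'`. -/
theorem TreeDecomposition.mem_bag_of_adj {V : Type*} [Fintype V] [DecidableEq V]
    {G : SimpleGraph V} (D : TreeDecomposition G)
    {S : Finset V} {u y s : V} {t t' x : Fin D.m} (htt' : D.tree.Adj t t')
    (p : D.tree.Walk t' x) (hp : t ∉ p.support) (hux : u ∈ D.bag x)
    (hC : ∀ w ∈ component G S u, w ∉ D.bag t) (hy : y ∈ component G S u)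
    (hys : G.Adj y s) (hs : s ∈ D.bag t) : s ∈ D.bag t' := by
  by_contra hst'
  -- The edge from `t` to `t'` is a bridge. If `s` were missing from the bag of `t'`, then the nodes
  -- of the vertices of the component, followed by those of `s`, would lead from the side of `t'` to
  -- `t` without this edge.
  set H := D.tree.deleteEdges {s(t, t')} with hH
  have hbridge : ¬ H.Reachable t t' := by
    have := isAcyclic_iff_forall_isBridge.1 D.isTree.isAcyclic
      ((mem_edgeSet D.tree).2 htt')
    rw [isBridge_iff] at this
    exact this
  -- walks inside the nodes of a vertex that is missing at `t` or at `t'`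
  have hbag : ∀ v : V, (v ∉ D.bag t ∨ v ∉ D.bag t') → ∀ a b : Fin D.m, v ∈ D.bag a →
      v ∈ D.bag b → H.Reachable a b := by
    intro v hv a b ha hb
    have := (D.connected v).preconnected ⟨a, ha⟩ ⟨b, hb⟩
    refine this.map (⟨Subtype.val, ?_⟩ : D.tree.induce {t | v ∈ D.bag t} →g H)
    rintro ⟨a, ha⟩ ⟨b, hb⟩ hab
    rw [hH, deleteEdges_adj]
    refine ⟨hab, fun h => ?_⟩
    simp only [Set.mem_singleton_iff, Sym2.eq_iff, Set.mem_ofPred_eq] at h ha hb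
    rcases h with ⟨rfl, rfl⟩ | ⟨rfl, rfl⟩ <;> tauto
  have hnode : ∀ v, ∃ a, v ∈ D.bag a := fun v => by
    obtain ⟨⟨a, ha⟩⟩ := (D.connected v).nonempty
    exact ⟨a, ha⟩
  have hcomp : ∀ w, ConnectedAvoiding G S u w → ∀ a, w ∈ D.bag a → H.Reachable x a := by
    rintro w ⟨hu, hw⟩
    induction hw with
    | refl => exact fun a ha => hbag u (.inl (hC u (mem_component.2 (.refl hu)))) _ _ hux ha
    | @tail w w' hw hww' ih =>
      intro a ha
      obtain ⟨c, hc, hc'⟩ := D.edge_mem w w' hww'.1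
      refine (ih c hc).trans (hbag w' (.inl (hC _ (mem_component.2 ?_))) _ _ hc' ha)
      exact ⟨hu, hw.tail hww'⟩
  obtain ⟨c, hc, hc'⟩ := D.edge_mem y s hys
  have h1 : H.Reachable x c := hcomp y (mem_component.1 hy) c hc
  have h2 : H.Reachable c t := hbag s (.inr hst') _ _ hc' hs
  have h3 : H.Reachable t' x := by
    refine ⟨p.toDeleteEdges _ fun e he h => ?_⟩
    rw [Set.mem_singleton_iff] at h
    subst h
    exact hp (p.fst_mem_support_of_mem_edges he)
  exact hbridge ((h3.trans h1).trans h2).symm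

/-- A tree-decomposition yields a derivation, in any family that contains certain unions of
components. -/
theorem TreeDecomposition.separated {n b : ℕ} {G : SimpleGraph (Fin n)} (D : TreeDecomposition G)
    (hD : ∀ t, (D.bag t).card ≤ b) {F : Set (Finset (Fin n))}
    (hF : ∀ S u, S.card ≤ b → component G S u ∈ F)
    (hF' : ∀ S S' u j, S.card ≤ b → S'.card ≤ b → j ≤ n →
      component G S u ∩ components G S' {x | (x : ℕ) < j} ∈ F)
    (hF'' : ∀ j ≤ n, components G ∅ {x | (x : ℕ) < j} ∈ F) :
    Separated G b F Finset.univ ∅ := by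
  have hcard : ∀ t, ∀ S ⊆ D.bag t, S.card ≤ b := fun t S hS => (Finset.card_le_card hS).trans (hD t)
  -- Induction on the size of the component. For a fixed component, a second induction walks from
  -- `t` towards a node whose bag contains `u` until the bag meets the component.
  have main : ∀ N, ∀ S u t, u ∉ S → (component G S u).card = N → S ⊆ D.bag t →
      Separated G b F (component G S u) S := by
    intro N
    induction N using Nat.strong_induction_on with
    | _ N ih =>
    -- the case where the bag meets the component
    have hmeet : ∀ S u t, u ∉ S → (component G S u).card = N → S ⊆ D.bag t →
        (∃ y ∈ component G S u, y ∈ D.bag t) → Separated G b F (component G S u) S := by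
      rintro S u t hu hN hSt ⟨y, hyC, hyt⟩
      have huy := mem_component.1 hyC
      have hyS := huy.notMem
      have hS' : insert y S ⊆ D.bag t := Finset.insert_subset hyt hSt
      have hins : insert y ((component G S u).erase y) = component G S u := Finset.insert_erase hyC
      -- The vertex `y` is forgotten last. Without it the component falls apart into smaller
      -- components of `G - insert y S`, whose partial unions are the intersections provided by
      -- `hF'`.
      have : Separated G b F ((component G S u).erase y) (insert y S) := by
        refine separated_of_components (hcard t _ hS') (fun w hw w' hww' => ?_) ?_ (fun w hw => ?_)
          (fun j hj => ?_)
        · have hw1 := mem_component.1 (Finset.mem_of_mem_erase hw)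
          have hw' := hww'.notMem
          simp only [Finset.mem_insert, not_or] at hw'
          exact Finset.mem_erase.2 ⟨hw'.1, mem_component.2
            (hw1.trans (hww'.mono (Finset.subset_insert _ _)))⟩
        · rw [Finset.disjoint_left]
          intro w hw hw'
          obtain ⟨h1, h2⟩ := Finset.mem_erase.1 hw
          rcases Finset.mem_insert.1 hw' with h | h
          · exact h1 h
          · exact (mem_component.1 h2).notMem h
        · obtain ⟨h1, h2⟩ := Finset.mem_erase.1 hw
          have h3 := mem_component.1 h2
          have hwS : w ∉ insert y S := by simp [h1, h3.notMem]
          refine ih _ ?_ _ w t hwS rfl hS'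
          rw [← hN]
          refine Finset.card_lt_card ⟨fun v hv => mem_component.2
            (h3.trans ((mem_component.1 hv).mono (Finset.subset_insert _ _))), fun hsub => ?_⟩
          exact (mem_component.1 (hsub hyC)).notMem (by simp)
        · have := hF' S (insert y S) u j (hcard t _ hSt) (hcard t _ hS') hj
          convert this using 1
          ext v
          simp only [Finset.mem_inter, Finset.mem_erase, mem_components]
          constructor
          · rintro ⟨⟨-, h1⟩, h2⟩; exact ⟨h1, h2⟩
          · rintro ⟨h1, z, hz, h2⟩
            refine ⟨⟨?_, h1⟩, z, hz, h2⟩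
            have := h2.notMem
            simp only [Finset.mem_insert, not_or] at this
            exact this.1
      have hfin : insert y ((component G S u).erase y) ∈ F := by
        rw [hins]; exact hF S u (hcard t _ hSt)
      have := Separated.forget this hyS (fun w hw => ?_) hfin
      · rwa [hins] at this
      · by_cases hwS : w ∈ S
        · simp [hwS]
        · simp only [Finset.mem_union, Finset.mem_erase]
          exact .inl ⟨hw.ne', mem_component.2 (huy.tail hw hwS)⟩
    intro S u t hu hN hSt
    obtain ⟨⟨x, hx⟩⟩ := (D.connected u).nonempty
    have hx : u ∈ D.bag x := hx
    obtain ⟨q, hq⟩ := (D.isTree.connected.preconnected t x).exists_isPath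
    clear ih
    induction q generalizing S with
    | nil => exact hmeet S u _ hu hN hSt ⟨u, mem_component.2 (.refl hu), hx⟩
    | @cons t t' x htt' q ihq =>
      by_cases hm : ∃ y ∈ component G S u, y ∈ D.bag t
      · exact hmeet S u t hu hN hSt hm
      push Not at hm
      have hq' := (Walk.cons_isPath_iff _ _).1 hq
      -- If the bag of `t` misses the component, all neighbours of the component in `S` survive in
      -- the bag of `t'`. So `S` may be cut down to `S ∩ D.bag t'` without changing the component,
      -- and the rest of `S` is introduced at the end.
      have hnb : ∀ y ∈ component G S u, ∀ s ∈ S, G.Adj y s → s ∈ D.bag t' := fun y hy s hs hys =>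
        D.mem_bag_of_adj htt' q hq'.2 hx hm hy hys (hSt hs)
      have hcomp : component G (S ∩ D.bag t') u = component G S u := by
        ext w
        refine ⟨fun hw => ?_, fun hw => mem_component.2
          ((mem_component.1 hw).mono Finset.inter_subset_left)⟩
        obtain ⟨-, h1⟩ := mem_component.1 hw
        clear hw
        induction h1 with
        | refl => exact mem_component.2 (.refl hu)
        | @tail w w' _ hww' ih' =>
          refine mem_component.2 ((mem_component.1 ih').tail hww'.1 fun hS => hww'.2 ?_)
          exact Finset.mem_inter.2 ⟨hS, hnb w ih' w' hS hww'.1⟩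
      have := ihq (S ∩ D.bag t') (fun h => hu (Finset.mem_inter.1 h).1) (by rw [hcomp, hN])
        Finset.inter_subset_right hx hx hq'.1
      rw [hcomp] at this
      refine this.introduce Finset.inter_subset_left ?_ (hcard t _ hSt)
      exact Finset.disjoint_left.2 fun w hw => (mem_component.1 hw).notMem
  have hne : Nonempty (Fin D.m) := D.isTree.connected.nonempty
  obtain ⟨t⟩ := hne
  refine separated_of_components (by simp) (by simp) (by simp)
    (fun w _ => main _ ∅ w t (by simp) rfl (by simp)) fun j hj => ?_
  rw [Finset.univ_inter]
  exact hF'' j hj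

end

/-! ### Dynamic programming along derivations -/

section DynamicProgram

variable {V : Type*} [Fintype V] [DecidableEq V]

/-- The vertices of the bag of a state.  A state assigns to each vertex `v` of the bag a colour and
the contribution of the forgotten vertices to the utility of `v`. -/
def stateDomain (σ : V → Option (ℕ × ℤ)) : Finset V := {v | σ v ≠ none}

@[simp] theorem mem_stateDomain {σ : V → Option (ℕ × ℤ)} {v : V} :
    v ∈ stateDomain σ ↔ σ v ≠ none := by simp [stateDomain]

/-- The rules of the dynamic program: `(U, σ)` is obtained in one step from elements of `T`. -/
def StateRule (G : SimpleGraph V) (b : ℕ) (val : V → V → ℤ) (ok : V → ℕ → Prop)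
    (T : Finset V → (V → Option (ℕ × ℤ)) → Prop) (U : Finset V) (σ : V → Option (ℕ × ℤ)) : Prop :=
  (U = ∅ ∧ (stateDomain σ).card ≤ b ∧ ∀ v, σ v = none ∨ ∃ c, σ v = some (c, 0)) ∨
  (∃ σ₁, T U σ₁ ∧ (stateDomain σ).card ≤ b ∧
    ∀ v, σ v = σ₁ v ∨ σ₁ v = none ∧ v ∉ U ∧ ∃ c, σ v = some (c, 0)) ∨
  (∃ U₁ σ₁ u cu hu, T U₁ σ₁ ∧ σ₁ u = some (cu, hu) ∧ σ u = none ∧ u ∈ U ∧ ok u cu ∧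
    (∀ v, v ≠ u → ((v ∈ U ↔ v ∈ U₁) ∧ (G.Adj u v → v ∈ U ∨ σ v ≠ none) ∧
      (σ v = none ∧ σ₁ v = none ∨ ∃ c h, σ₁ v = some (c, h) ∧
        σ v = some (c, h + if c = cu then val v u else 0)))) ∧
    0 ≤ hu + ∑ v, if (σ v).map Prod.fst = some cu then val u v else 0) ∨
  (∃ U₁ σ₁ U₂ σ₂, T U₁ σ₁ ∧ T U₂ σ₂ ∧ ∀ v, ¬ (v ∈ U₁ ∧ v ∈ U₂) ∧ (v ∈ U ↔ v ∈ U₁ ∨ v ∈ U₂) ∧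
    (σ v = none ∧ σ₁ v = none ∧ σ₂ v = none ∨
      ∃ c h₁ h₂, σ₁ v = some (c, h₁) ∧ σ₂ v = some (c, h₂) ∧ σ v = some (c, h₁ + h₂)))

variable {G : SimpleGraph V} {b : ℕ} {val : V → V → ℤ} {ok : V → ℕ → Prop}
  {T : Finset V → (V → Option (ℕ × ℤ)) → Prop} {U : Finset V} {σ : V → Option (ℕ × ℤ)}

theorem StateRule.mono {T' : Finset V → (V → Option (ℕ × ℤ)) → Prop} (hT : ∀ U σ, T U σ → T' U σ)
    (h : StateRule G b val ok T U σ) : StateRule G b val ok T' U σ := by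
  rcases h with h | ⟨σ₁, h1, h⟩ | ⟨U₁, σ₁, u, cu, hu, h1, h⟩ | ⟨U₁, σ₁, U₂, σ₂, h1, h2, h⟩
  · exact .inl h
  · exact .inr (.inl ⟨σ₁, hT _ _ h1, h⟩)
  · exact .inr (.inr (.inl ⟨U₁, σ₁, u, cu, hu, hT _ _ h1, h⟩))
  · exact .inr (.inr (.inr ⟨U₁, σ₁, U₂, σ₂, hT _ _ h1, hT _ _ h2, h⟩))

/-- The value that the vertices in `U` with the colour of `v` have for `v`. -/
def colorValue (val : V → V → ℤ) (c : V → ℕ) (U : Finset V) (v : V) : ℤ :=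
  ∑ y ∈ U, if c y = c v then val v y else 0

theorem colorValue_congr {c c' : V → ℕ} {v : V} (hv : c v = c' v)
    (h : ∀ y ∈ U, val v y ≠ 0 → c y = c' y) : colorValue val c U v = colorValue val c' U v := by
  refine Finset.sum_congr rfl fun y hy => ?_
  by_cases h0 : val v y = 0
  · simp [h0]
  · rw [hv, h y hy h0]

theorem colorValue_eq_zero {c : V → ℕ} {v : V} (h : ∀ y ∈ U, val v y = 0) :
    colorValue val c U v = 0 :=
  Finset.sum_eq_zero fun y hy => by simp [h y hy]

theorem colorValue_insert {c : V → ℕ} {u v : V} (hu : u ∉ U) :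
    colorValue val c (insert u U) v = colorValue val c U v + if c v = c u then val v u else 0 := by
  rw [colorValue, Finset.sum_insert hu, add_comm, colorValue]
  simp only [eq_comm]

theorem colorValue_union {c : V → ℕ} {U₁ U₂ : Finset V} {v : V} (h : Disjoint U₁ U₂) :
    colorValue val c (U₁ ∪ U₂) v = colorValue val c U₁ v + colorValue val c U₂ v :=
  Finset.sum_union h

/-- The utility of a vertex splits into the contributions of the forgotten vertices and of the bag. -/
theorem colorValue_split (hval : ∀ u v, val u v ≠ 0 → G.Adj u v) {c : V → ℕ} {u : V}
    (hU : ∀ v ∈ U, σ v = none) (hadj : ∀ v, G.Adj u v → v ∈ U ∨ σ v ≠ none)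
    (hσ : ∀ v x, σ v = some x → c v = x.1) :
    colorValue val c Finset.univ u = colorValue val c U u +
      ∑ v, if (σ v).map Prod.fst = some (c u) then val u v else 0 := by
  have h1 : colorValue val c U u = ∑ y, if y ∈ U then (if c y = c u then val u y else 0) else 0 := by
    simp [colorValue, Finset.sum_ite_mem]
  rw [h1, ← Finset.sum_add_distrib]
  refine Finset.sum_congr rfl fun y _ => ?_
  by_cases h0 : val u y = 0
  · simp [h0]
  by_cases hy : y ∈ U
  · simp [hy, hU y hy]
  · have := (hadj y (hval u y h0)).resolve_left hy
    obtain ⟨x, hx⟩ := Option.ne_none_iff_exists'.1 this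
    simp [hy, hx, hσ y x hx]

/-- What an entry of the table of the dynamic program means. -/
def StateSound (G : SimpleGraph V) (b : ℕ) (val : V → V → ℤ) (ok : V → ℕ → Prop) (U : Finset V)
    (σ : V → Option (ℕ × ℤ)) : Prop :=
  Separated G b Set.univ U (stateDomain σ) ∧ ∃ c : V → ℕ,
    (∀ v x, σ v = some x → c v = x.1 ∧ x.2 = colorValue val c U v) ∧
    ∀ u ∈ U, ok u (c u) ∧ 0 ≤ colorValue val c Finset.univ u

/-- The witnessing colouring is carried through the rules. Newly introduced vertices have no
forgotten neighbours, so recolouring them changes no utility of a forgotten vertex and their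
contribution is zero; at a join the two colourings agree on the common bag and the forgotten sets
see nothing of each other; at a forget step the utility splits into the stored contribution and that
of the bag, so the test is on the final utility. -/
theorem StateRule.sound (hval : ∀ u v, val u v ≠ 0 → G.Adj u v)
    (h : StateRule G b val ok (StateSound G b val ok) U σ) : StateSound G b val ok U σ := by
  have hz : ∀ {U S : Finset V}, Separated G b Set.univ U S → ∀ v, v ∉ U → v ∉ S →
      ∀ y ∈ U, val v y = 0 := by
    intro U S hU v hv hvS y hy
    by_contra h0
    have := hU.mem_of_adj y hy v (hval v y h0).symm
    simp [hv, hvS] at this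
  rcases h with ⟨rfl, h1, h2⟩ | ⟨σ₁, ⟨h1, c, hc, hc'⟩, h2, h3⟩ |
    ⟨U₁, σ₁, u, cu, hu, ⟨h1, c, hc, hc'⟩, h2, h3, h4, h5, h6, h7⟩ |
    ⟨U₁, σ₁, U₂, σ₂, ⟨h1, c₁, hc₁, hc₁'⟩, ⟨h2, c₂, hc₂, hc₂'⟩, h3⟩
  · refine ⟨.leaf _ h1 (Set.mem_univ _), fun v => ((σ v).map Prod.fst).getD 0, fun v x hx => ?_,
      by simp⟩
    rcases h2 v with h | ⟨c, h⟩
    · simp [h] at hx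
    · rw [h] at hx; cases hx; simp [h, colorValue]
  · have hd := Finset.disjoint_left.1 h1.disjoint
    have hsub : stateDomain σ₁ ⊆ stateDomain σ := fun v hv => by
      rw [mem_stateDomain] at hv ⊢
      rcases h3 v with h | ⟨h, -⟩
      · rwa [h]
      · exact absurd h hv
    have hdis : Disjoint U (stateDomain σ) := Finset.disjoint_left.2 fun v hv hv' => by
      rcases h3 v with h | ⟨-, h, -⟩
      · exact hd hv (by rw [mem_stateDomain] at hv' ⊢; rwa [← h])
      · exact h hv
    -- The old colouring is kept on `U` and the old bag, and the new bag vertices take their colours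
    -- from `σ`. The default colour `0` elsewhere is irrelevant.
    refine ⟨h1.introduce hsub hdis h2,
      fun v => if v ∈ stateDomain σ₁ ∨ v ∈ U then c v else ((σ v).map Prod.fst).getD 0,
      fun v x hx => ?_, fun u hu => ?_⟩
    · by_cases hv : σ₁ v = none
      · have hvU : v ∉ U := fun h => by
          have := Finset.disjoint_left.1 hdis h
          simp [hx] at this
        obtain ⟨c', hc'⟩ : ∃ c', σ v = some (c', 0) := by
          rcases h3 v with h | ⟨-, -, h⟩
          · rw [h, hv] at hx; cases hx
          · exact h
        rw [hc'] at hx; cases hx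
        refine ⟨by simp [hv, hvU, hc'], (colorValue_eq_zero (hz h1 v hvU ?_)).symm⟩
        simp [hv]
      · have hx' : σ₁ v = some x := by
          rcases h3 v with h | ⟨h, -⟩
          · rwa [← h]
          · exact absurd h hv
        obtain ⟨a1, a2⟩ := hc v x hx'
        refine ⟨by simp [hv, a1], a2.trans (colorValue_congr (by simp [hv]) fun y hy _ => ?_)⟩
        simp [hy]
    · obtain ⟨a1, a2⟩ := hc' u hu
      refine ⟨by simpa [hu] using a1, a2.trans_eq (colorValue_congr (by simp [hu])
        fun y _ hy => ?_)⟩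
      have := h1.mem_of_adj u hu y (hval u y hy)
      rw [Finset.mem_union] at this
      rw [if_pos this.symm]
  · have hd := Finset.disjoint_left.1 h1.disjoint
    have huU : u ∉ U₁ := fun h => hd h (by simp [h2])
    have hU : U = insert u U₁ := by
      ext v
      by_cases hv : v = u
      · simp [hv, h4]
      · simp [hv, (h6 v hv).1]
    have hdom : stateDomain σ₁ = insert u (stateDomain σ) := by
      ext v
      by_cases hv : v = u
      · simp [hv, h2]
      · obtain ⟨-, -, h | ⟨c', h', h⟩⟩ := h6 v hv
        · simp [hv, h]
        · simp [hv, h]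
    have hcu := hc u _ h2
    have hcu1 : c u = cu := hcu.1
    have hcu2 : hu = colorValue val c U₁ u := hcu.2
    have hadj : ∀ w, G.Adj u w → w ∈ U₁ ∨ σ w ≠ none := fun w hw => by
      rw [← (h6 w hw.ne').1]; exact (h6 w hw.ne').2.1 hw
    have hstate : ∀ v x, σ v = some x → v ≠ u ∧ c v = x.1 ∧ x.2 = colorValue val c U v := by
      intro v x hx
      have hv : v ≠ u := fun h => by rw [h, h3] at hx; cases hx
      obtain ⟨-, -, ⟨h, -⟩ | ⟨c', h', h, h''⟩⟩ := h6 v hv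
      · rw [h] at hx; cases hx
      · obtain ⟨b1, b2⟩ := hc v _ h
        rw [h''] at hx
        cases hx
        refine ⟨hv, b1, ?_⟩
        simp only at b1 b2 ⊢
        rw [hU, colorValue_insert huU, b2, b1, hcu1]
    refine ⟨?_, c, fun v x hx => (hstate v x hx).2, fun v hv => ?_⟩
    · rw [hdom] at h1
      rw [hU]
      refine h1.forget (by simp [h3]) (fun w hw => ?_) (Set.mem_univ _)
      simpa using hadj w hw
    · rw [hU] at hv
      rcases Finset.mem_insert.1 hv with rfl | hv
      · refine ⟨hcu1 ▸ h5, ?_⟩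
        rw [colorValue_split hval (fun w hw => ?_) hadj fun w x hx => (hstate w x hx).2.1, ← hcu2,
          hcu1]
        · exact h7
        · by_contra hne
          exact hd hw (by rw [hdom]; simp [hne])
      · exact hc' v hv
  · have hdom : stateDomain σ₁ = stateDomain σ ∧ stateDomain σ₂ = stateDomain σ := by
      constructor <;> ext v <;> obtain ⟨-, -, ⟨a, a1, a2⟩ | ⟨c, x, y, a, a1, a2⟩⟩ := h3 v <;> simp_all
    rw [hdom.1] at h1
    rw [hdom.2] at h2
    have hU : U = U₁ ∪ U₂ := by ext v; simp [(h3 v).2.1]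
    have hdis : Disjoint U₁ U₂ := Finset.disjoint_left.2 fun v hv hv' => (h3 v).1 ⟨hv, hv'⟩
    have d1 := Finset.disjoint_left.1 h1.disjoint
    have d2 := Finset.disjoint_left.1 h2.disjoint
    let c : V → ℕ := fun v => if v ∈ U₁ then c₁ v else c₂ v
    have e2 : ∀ v ∈ U₂ ∪ stateDomain σ, c v = c₂ v := fun v hv => by
      have : v ∉ U₁ := fun h => by
        rcases Finset.mem_union.1 hv with h' | h'
        · exact (h3 v).1 ⟨h, h'⟩
        · exact d1 h h'
      simp [c, this]
    have e1 : ∀ v ∈ U₁ ∪ stateDomain σ, c v = c₁ v := fun v hv => by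
      rcases Finset.mem_union.1 hv with h' | h'
      · simp [c, h']
      · rw [e2 v (by simp [mem_stateDomain.1 h'])]
        obtain ⟨-, -, ⟨a, -⟩ | ⟨c', x, y, a1, a2, a3⟩⟩ := h3 v
        · exact absurd a (mem_stateDomain.1 h')
        · exact (hc₂ v _ a2).1.trans (hc₁ v _ a1).1.symm
    refine ⟨hU ▸ h1.join h2 hdis (Set.mem_univ _), c, fun v x hx => ?_, fun u hu => ?_⟩
    · obtain ⟨-, -, ⟨a, -⟩ | ⟨c', x, y, a1, a2, a3⟩⟩ := h3 v
      · rw [a] at hx; cases hx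
      · have hv : v ∈ stateDomain σ := by simp [a3]
        rw [a3] at hx; cases hx
        obtain ⟨b1, b2⟩ := hc₁ v _ a1
        obtain ⟨b3, b4⟩ := hc₂ v _ a2
        simp only at b1 b2 b3 b4
        refine ⟨(e1 v (by simp [a3])).trans b1, ?_⟩
        rw [hU, colorValue_union hdis]
        simp only
        rw [b2, b4, colorValue_congr (e1 v (by simp [a3])) fun y hy _ => e1 y (by simp [hy]),
          colorValue_congr (e2 v (by simp [a3])) fun y hy _ => e2 y (by simp [hy])]
    · rw [hU] at hu
      rcases Finset.mem_union.1 hu with hu | hu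
      · rw [e1 u (by simp [hu]), colorValue_congr (e1 u (by simp [hu])) fun y _ hy =>
          e1 y (h1.mem_of_adj u hu y (hval u y hy))]
        exact hc₁' u hu
      · rw [e2 u (by simp [hu]), colorValue_congr (e2 u (by simp [hu])) fun y _ hy =>
          e2 y (h2.mem_of_adj u hu y (hval u y hy))]
        exact hc₂' u hu

/-- The state of a colouring of the whole graph. -/
def colorState (val : V → V → ℤ) (c : V → ℕ) (U S : Finset V) (v : V) : Option (ℕ × ℤ) :=
  if v ∈ S then some (c v, colorValue val c U v) else none

@[simp] theorem stateDomain_colorState {c : V → ℕ} {S : Finset V} :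
    stateDomain (colorState val c U S) = S := by
  ext v; simp [colorState]

/-- Fix a good colouring of the whole graph and follow the derivation: the states that this
colouring induces are related by the rules. Closure of `T` is needed only for sets in `F` and bags
of size at most `b`, which is what the finite tables can offer. -/
theorem Separated.state_complete {F : Set (Finset V)} (hval : ∀ u v, val u v ≠ 0 → G.Adj u v)
    {c : V → ℕ} (hok : ∀ u, ok u (c u)) (hc : ∀ u, 0 ≤ colorValue val c Finset.univ u)
    (hT : ∀ U S, U ∈ F → S.card ≤ b → StateRule G b val ok T U (colorState val c U S) →
      T U (colorState val c U S)) {S : Finset V} (h : Separated G b F U S) :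
    T U (colorState val c U S) := by
  induction h with
  | leaf S h1 h2 =>
    refine hT _ _ h2 h1 (.inl ⟨rfl, by simpa using h1, fun v => ?_⟩)
    by_cases hv : v ∈ S <;> simp [colorState, hv, colorValue]
  | @introduce U S S' h h1 h2 h3 ih =>
    refine hT _ _ h.mem_family h3 (.inr (.inl ⟨_, ih, by simpa using h3, fun v => ?_⟩))
    by_cases hv : v ∈ S
    · simp [colorState, hv, h1 hv]
    by_cases hv' : v ∈ S'
    · have hvU : v ∉ U := fun h' => Finset.disjoint_left.1 h2 h' hv'
      refine .inr ⟨by simp [colorState, hv], hvU, c v, ?_⟩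
      have : colorValue val c U v = 0 := colorValue_eq_zero fun y hy => by
        by_contra h0
        have := h.mem_of_adj y hy v (hval v y h0).symm
        simp [hv, hvU] at this
      simp [colorState, hv', this]
    · simp [colorState, hv, hv']
  | @forget U S u h h1 h2 h3 ih =>
    have hd := Finset.disjoint_left.1 h.disjoint
    have huU : u ∉ U := fun h' => hd h' (by simp)
    have hadj : ∀ v, G.Adj u v → v ∈ U ∨ colorState val c (insert u U) S v ≠ none := fun v hv => by
      have := h2 v hv
      simpa [colorState] using this
    refine hT _ _ h3 ((Finset.card_le_card (Finset.subset_insert u S)).trans h.card_le)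
      (.inr (.inr (.inl ⟨_, _, u, c u, colorValue val c U u, ih, by simp [colorState],
        by simp [colorState, h1], by simp, hok u, fun v hv => ⟨by simp [hv], fun h' => ?_, ?_⟩, ?_⟩)))
    · exact (hadj v h').imp_left fun h => by simp [h]
    · by_cases hvS : v ∈ S
      · refine .inr ⟨c v, colorValue val c U v, by simp [colorState, hvS], ?_⟩
        simp [colorState, hvS, colorValue_insert huU]
      · simp [colorState, hvS, hv]
    · rw [← colorValue_split hval (fun v hv => ?_) hadj fun v x hx => ?_]
      · exact hc u
      · have : v ∉ S := fun h' => hd hv (by simp [h'])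
        simp [colorState, this]
      · by_cases hvS : v ∈ S
        · simp only [colorState, hvS, if_true, Option.some.injEq] at hx
          rw [← hx]
        · simp [colorState, hvS] at hx
  | @join U₁ U₂ S hU₁ hU₂ h1 h2 ih1 ih2 =>
    refine hT _ _ h2 hU₁.card_le (.inr (.inr (.inr ⟨_, _, _, _, ih1, ih2, fun v => ⟨?_, by simp, ?_⟩⟩)))
    · exact fun h => Finset.disjoint_left.1 h1 h.1 h.2
    · by_cases hvS : v ∈ S
      · refine .inr ⟨c v, colorValue val c U₁ v, colorValue val c U₂ v, by simp [colorState, hvS],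
        by simp [colorState, hvS], ?_⟩
        simp [colorState, hvS, colorValue_union h1]
      · simp [colorState, hvS]

end DynamicProgram

/-! ### Colourings and coalition structures -/

/-- The coalitions are the colour classes. The colours in use are exactly those below `k`, so there
are exactly `k` nonempty classes. -/
theorem exists_finpartition_of_coloring {n k : ℕ} {c : Fin n → ℕ}
    (hc : ∀ i, i < k ↔ ∃ v, c v = i) :
    ∃ π : Finpartition (Finset.univ : Finset (Fin n)), π.parts.card = k ∧
      ∀ v y, y ∈ π.part v ↔ c y = c v := by
  let s : Setoid (Fin n) := Setoid.ker c
  have : DecidableRel s.r := fun a b => inferInstanceAs (Decidable (c a = c b))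
  let π := Finpartition.ofSetoid s
  have hmem : ∀ v y, y ∈ π.part v ↔ c y = c v := fun v y => by
    rw [Finpartition.mem_part_ofSetoid_iff_rel]
    exact eq_comm
  have heq : ∀ u v, π.part u = π.part v ↔ c u = c v := fun u v => by
    rw [← π.mem_part_iff_part_eq_part (Finset.mem_univ u) (Finset.mem_univ v), hmem]
  refine ⟨π, ?_, hmem⟩
  have hsurj : ∀ i : Fin k, ∃ v, c v = i := fun i => (hc i).1 i.2
  choose g hg using hsurj
  have himage : π.parts = Finset.univ.image fun i => π.part (g i) := by
    ext P
    simp only [Finset.mem_image, Finset.mem_univ, true_and]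
    constructor
    · intro hP
      obtain ⟨v, hv⟩ := π.nonempty_of_mem_parts hP
      refine ⟨⟨c v, (hc _).2 ⟨v, rfl⟩⟩, ?_⟩
      rw [← π.part_eq_of_mem hP hv, heq, hg]
    · rintro ⟨i, rfl⟩
      exact π.part_mem.2 (Finset.mem_univ _)
  rw [himage, Finset.card_image_of_injective]
  · simp
  · intro i j hij
    have := (heq _ _).1 hij
    rw [hg, hg] at this
    exact Fin.ext this

/-- A proper colouring with at most `k ≤ n` colours can be refined to one with exactly `k`. -/
theorem exists_coloring_of_le {n k b : ℕ} {G : SimpleGraph (Fin n)} (c : Fin n → Fin b)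
    (hc : ∀ u w, G.Adj u w → c u ≠ c w) (hbk : b ≤ k) (hkn : k ≤ n) :
    ∃ c : Fin n → ℕ, (∀ u w, G.Adj u w → c u ≠ c w) ∧ ∀ i, i < k ↔ ∃ v, c v = i := by
  set A := Finset.univ.image c with hA
  have hAk : A.card ≤ k := (A.card_le_univ.trans (by simp)).trans hbk
  suffices ∀ d, A.card + d ≤ n → ∃ c : Fin n → ℕ, (∀ u w, G.Adj u w → c u ≠ c w) ∧
      ∀ i, i < A.card + d ↔ ∃ v, c v = i by
    have := this (k - A.card) (by omega)
    rwa [Nat.add_sub_cancel' hAk] at this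
  intro d
  induction d with
  | zero =>
    intro _
    have hmem : ∀ v, c v ∈ A := fun v => by simp [hA]
    -- The colours in use are renumbered without gaps.
    refine ⟨fun v => A.equivFin ⟨c v, hmem v⟩, fun u w huw h => ?_, fun i => ⟨fun hi => ?_, ?_⟩⟩
    · have := A.equivFin.injective (Fin.ext h)
      exact hc u w huw (congrArg Subtype.val this)
    · obtain ⟨v, -, hv⟩ := Finset.mem_image.1 (A.equivFin.symm ⟨i, by simpa using hi⟩).2
      refine ⟨v, ?_⟩
      have : (⟨c v, hmem v⟩ : A) = A.equivFin.symm ⟨i, by simpa using hi⟩ := Subtype.ext hv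
      show (A.equivFin ⟨c v, hmem v⟩ : ℕ) = i
      rw [this]; simp
    · rintro ⟨v, rfl⟩
      simp
  | succ d ih =>
    intro hd
    obtain ⟨c, h1, h2⟩ := ih (by omega)
    set m := A.card + d with hm
    -- There are `m < n` colours, so two vertices share one; one of them gets the new colour `m`,
    -- and the old colour stays in use because of the other.
    have hinj : ¬ Function.Injective c := fun hinj => by
      have : Finset.univ.image c ⊆ Finset.range m := fun i hi => by
        obtain ⟨v, -, hv⟩ := Finset.mem_image.1 hi
        exact Finset.mem_range.2 ((h2 i).2 ⟨v, hv⟩)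
      have := Finset.card_le_card this
      rw [Finset.card_image_of_injective _ hinj] at this
      simp at this
      omega
    simp only [Function.Injective, not_forall] at hinj
    obtain ⟨u, v, huv, hne⟩ := hinj
    have hlt : ∀ w, c w < m := fun w => (h2 _).2 ⟨w, rfl⟩
    refine ⟨Function.update c u m, fun x y hxy => ?_, fun i => ?_⟩
    · have hx := hlt x
      have hy := hlt y
      have := h1 x y hxy
      have hxy' := hxy.ne
      simp only [Function.update_apply]
      split_ifs with a1 a2 a2
      · exact absurd (a1.trans a2.symm) hxy'
      · omega
      · omega
      · exact this
    · have hsucc : i < A.card + (d + 1) ↔ i < m ∨ i = m := by omega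
      rw [hsucc, h2]
      constructor
      · rintro (⟨w, rfl⟩ | rfl)
        · by_cases hw : w = u
          · exact ⟨v, by rw [Function.update_of_ne (Ne.symm hne), hw, huv]⟩
          · exact ⟨w, by rw [Function.update_of_ne hw]⟩
        · exact ⟨u, by simp⟩
      · rintro ⟨w, rfl⟩
        by_cases hw : w = u
        · exact .inr (by simp [hw])
        · exact .inl ⟨w, by rw [Function.update_of_ne hw]⟩

/-! ### Coalition structures as colourings, and the case of many coalitions -/

namespace KASHG

variable (Γ : KASHG)

theorem val_eq_zero_of_not_adj {Γ : KASHG} {i j : Fin Γ.n} (h : ¬ Γ.graph.Adj i j) :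
    Γ.val i j = 0 := by
  by_contra h0
  exact h (.inl h0)

/-- An optimal tree-decomposition gives a derivation with bags of size `tw + 1`, hence a proper
colouring with `tw + 1` colours, which is refined to exactly `k`. Inside a colour class all values
vanish. -/
theorem exists_independent_of_treewidth_lt (hk : treewidth Γ.graph + 1 ≤ Γ.k) (hkn : Γ.k ≤ Γ.n) :
    ∃ π : Γ.CoalitionStructure, π.parts.card = Γ.k ∧ Γ.IsIR π ∧
      ∀ C ∈ π.parts, Γ.graph.IsIndepSet (C : Set (Fin Γ.n)) := by
  obtain ⟨D, hD⟩ := treewidth_le_iff.1 (le_refl (treewidth Γ.graph))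
  have hsep : Separated Γ.graph (treewidth Γ.graph + 1) Set.univ Finset.univ ∅ :=
    D.separated hD (by simp) (by simp) (by simp)
  obtain ⟨c, -, hc⟩ := hsep.exists_coloring (fun _ => 0) (by simp)
  obtain ⟨c, h1, h2⟩ := exists_coloring_of_le (G := Γ.graph) c (fun u w => hc u (by simp) w) hk hkn
  obtain ⟨π, hπ, hmem⟩ := exists_finpartition_of_coloring h2
  refine ⟨π, hπ, fun i => ?_, fun C hC => ?_⟩
  · have : Γ.utility i (π.part i) = 0 := Finset.sum_eq_zero fun j hj =>
      val_eq_zero_of_not_adj fun hadj => h1 i j hadj ((hmem i j).1 hj).symm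
    rw [this]
    simp [utility, Γ.val_self]
  · intro x hx y hy _ hadj
    rw [← π.part_eq_of_mem hC hy] at hx
    exact h1 x y hadj ((hmem y x).1 hx)

/-- Numbering the coalitions gives the form on which the dynamic program works: a colouring onto the
colours below `k` with nonnegative utilities. -/
theorem admitsIR_iff : Γ.AdmitsIR ↔ ∃ c : Fin Γ.n → ℕ, (∀ i, i < Γ.k ↔ ∃ v, c v = i) ∧
    ∀ u, 0 ≤ colorValue Γ.val c Finset.univ u := by
  have hsum : ∀ (π : Γ.CoalitionStructure) (c : Fin Γ.n → ℕ),
      (∀ v y, y ∈ π.part v ↔ c y = c v) → ∀ u,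
      Γ.utility u (π.part u) = colorValue Γ.val c Finset.univ u := by
    intro π c h u
    rw [utility, colorValue, ← Finset.sum_filter]
    congr 1
    ext y
    simp [h]
  have hself : ∀ u, Γ.utility u {u} = 0 := fun u => by simp [utility, Γ.val_self]
  constructor
  · rintro ⟨π, hπ, hIR⟩
    have hp : ∀ v, π.part v ∈ π.parts := fun v => π.part_mem.2 (Finset.mem_univ v)
    let c : Fin Γ.n → ℕ := fun v => π.parts.equivFin ⟨π.part v, hp v⟩
    refine ⟨c, fun i => ⟨fun hi => ?_, ?_⟩, fun u => ?_⟩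
    · obtain ⟨⟨P, hP⟩, hPi⟩ := π.parts.equivFin.surjective ⟨i, by omega⟩
      obtain ⟨v, hv⟩ := π.nonempty_of_mem_parts hP
      refine ⟨v, ?_⟩
      simp only [c, π.part_eq_of_mem hP hv, hPi]
    · rintro ⟨v, rfl⟩
      rw [← hπ]
      simp [c]
    · rw [← hsum π c fun v y => ?_]
      · have := hIR u
        rwa [hself] at this
      · rw [π.mem_part_iff_part_eq_part (Finset.mem_univ y) (Finset.mem_univ v)]
        simp [c, Fin.val_inj]
  · rintro ⟨c, hc, hIR⟩
    obtain ⟨π, hπ, hmem⟩ := exists_finpartition_of_coloring hc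
    refine ⟨π, hπ, fun u => ?_⟩
    rw [hself, hsum π c hmem]
    exact hIR u

theorem admitsIR_of_treewidth_lt (hk : treewidth Γ.graph < Γ.k) : Γ.AdmitsIR ↔ Γ.k ≤ Γ.n := by
  refine ⟨fun ⟨π, hπ, _⟩ => ?_, fun h => ?_⟩
  · rw [← hπ]
    simpa using π.card_parts_le_card
  · obtain ⟨π, h1, h2, -⟩ := Γ.exists_independent_of_treewidth_lt hk h
    exact ⟨π, h1, h2⟩

end KASHG

/-! ### The tables of the algorithm -/

namespace RAM

namespace PolyPred

/-- Substitution of an expression for a variable. -/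
theorem bind {φ : (ℕ → ℕ) → Env → (ℕ → ℕ) → ℕ → Prop} {g : (ℕ → ℕ) → Env → (ℕ → ℕ) → ℕ}
    (hg : PolyTime g) (hφ : PolyPred fun m e w => φ m e (fun j => w (j + 1)) (w 0)) :
    PolyPred fun m e w => φ m e w (g m e w) := by
  refine (exists_lt (φ := fun m e w i => i = g m e w ∧ φ m e w i) (hg.add (.const 1))
    ((eq (.var 0) hg.shift).and hφ)).of_iff fun m e w => ?_
  simp

end PolyPred

/-- Addresses of the tables: binary numbers, sets, reachability, names of vertex sets, states. -/
def baseBits (e : Env) : ℕ := e.len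
def baseSets (e : Env) : ℕ := baseBits e + e.big * e.big
def baseReach (e : Env) : ℕ := baseSets e + e.big * e.big
def baseName (e : Env) : ℕ := baseReach e + e.big * e.big * e.big
/-- The number of names of vertex sets. -/
def names (e : Env) : ℕ := e.big * e.big * e.big * e.big
def baseState (e : Env) : ℕ := baseName e + names e * e.big

/-- The base of the number system in which sets are encoded. -/
def digitBase (e : Env) : ℕ := e.aux * e.aux * e.aux + 1

/-- The suffix of the input that begins at `i` and ends in front of the second separator is the
binary representation of `k`. -/
def LookBits (m : ℕ → ℕ) (e : Env) (i k : ℕ) : Prop := m (baseBits e + (i * e.big + k)) ≠ 0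

/-- `x` is an element of the set with code `s`. -/
def LookSet (m : ℕ → ℕ) (e : Env) (s x : ℕ) : Prop := m (baseSets e + (s * e.big + x)) ≠ 0

/-- `b` can be reached from `a` without the vertices of the set with code `s`. -/
def LookReach (m : ℕ → ℕ) (e : Env) (s a b : ℕ) : Prop :=
  m (baseReach e + ((s * e.big + a) * e.big + b)) ≠ 0

/-- The vertex `v` belongs to the set with name `a`. -/
def LookName (m : ℕ → ℕ) (e : Env) (a v : ℕ) : Prop := m (baseName e + (a * e.big + v)) ≠ 0

/-- The position of an entry in the table of states. -/
def stateIndex (e : Env) (μ ρ s a : ℕ) : ℕ := ((μ * e.big + ρ) * e.big + s) * names e + a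

def LookState (m : ℕ → ℕ) (e : Env) (μ ρ s a : ℕ) : Prop :=
  m (baseState e + stateIndex e μ ρ s a) ≠ 0

/-- The letter of the input that encodes the value of `v` for `u`. -/
def letterAt (m : ℕ → ℕ) (e : Env) (u v : ℕ) : ℕ := m (e.start + (u * e.num + v))

def LookAdj (m : ℕ → ℕ) (e : Env) (u v : ℕ) : Prop := letterAt m e u v ≠ 0 ∨ letterAt m e v u ≠ 0

open Classical in
/-- The entry (colour and contribution) of the state with code `s` at the vertex `v`; it is
`aux * aux` if there is none. -/
noncomputable def entry (m : ℕ → ℕ) (e : Env) (s v : ℕ) : ℕ :=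
  ∑ y ∈ Finset.range (e.aux * e.aux),
    if ∀ z < y + 1, ¬ LookSet m e s (v * (e.aux * e.aux) + z) then 1 else 0

/-- The index `c` stands for a pair of a position and a number. Position `start - 1` is the second
separator, where the empty suffix denotes `0`; any longer suffix must denote a positive number,
which rules out superfluous leading zeros. -/
def bitsRule (m : ℕ → ℕ) (e : Env) (c : ℕ) : Prop :=
  (c / e.big + 1 = e.start ∧ c % e.big = 0) ∨
  (c / e.big + 1 < e.start ∧ 0 < c % e.big ∧ (c % e.big) % 2 = m (c / e.big) ∧
    LookBits m e (c / e.big + 1) (c % e.big / 2))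

/-- An element `x` appears in a code as the digit `x + 1`; the digit `0` represents no element, so
that the code `0` is the empty set. -/
def setsRule (m : ℕ → ℕ) (e : Env) (c : ℕ) : Prop :=
  c / e.big % digitBase e = c % e.big + 1 ∨ LookSet m e (c / e.big / digitBase e) (c % e.big)

def reachRule (m : ℕ → ℕ) (e : Env) (c : ℕ) : Prop :=
  c / e.big % e.big < e.num ∧ c % e.big < e.num ∧
  ¬ LookSet m e (c / e.big / e.big) (c / e.big % e.big) ∧
  ¬ LookSet m e (c / e.big / e.big) (c % e.big) ∧
  (c / e.big % e.big = c % e.big ∨ ∃ z < e.num,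
    LookReach m e (c / e.big / e.big) (c / e.big % e.big) z ∧ LookAdj m e z (c % e.big))

/-- A name is a quadruple: two codes `S`, `S'`, a vertex `i` and a bound `j`. It denotes the
vertices in the component of `i` in `G - S` that also lie in a component of `G - S'` meeting `{0,
..., j - 1}`. The first condition is void when `i` is not a vertex. -/
def nameRule (m : ℕ → ℕ) (e : Env) (c : ℕ) : Prop :=
  c % e.big < e.num ∧
  (c / e.big / e.big % e.big < e.num →
    LookReach m e (c / e.big / e.big / e.big / e.big) (c / e.big / e.big % e.big) (c % e.big)) ∧
  ∃ w < e.num, w < c / e.big % e.big ∧ LookReach m e (c / e.big / e.big / e.big % e.big) w (c % e.big)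

/-- The colour `c` is allowed for the vertex `v`: it is one of the colours of which the set with code
`ρ` chooses a representative, and if `v` is a representative, it is that of `c`. -/
def ColorAllowed (m : ℕ → ℕ) (e : Env) (μ ρ v c : ℕ) : Prop :=
  μ = 0 → (∃ x < e.num, LookSet m e ρ (x * e.aux + c)) ∧
    ∀ i < e.aux, LookSet m e ρ (v * e.aux + i) → i = c

/-- An entry is `colour * aux + (contribution + num)`. The shift by `num` avoids negative numbers,
so a remainder equal to `num` means contribution zero. -/
def leafRule (m : ℕ → ℕ) (e : Env) (s : ℕ) (a : ℕ) : Prop :=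
  ∀ v < e.num, ¬ LookName m e a v ∧
    (¬ entry m e s v < e.aux * e.aux ∨ entry m e s v % e.aux = e.num)

def introduceRule (m : ℕ → ℕ) (e : Env) (s s₁ a a₁ : ℕ) : Prop :=
  ∀ v < e.num, (LookName m e a v ↔ LookName m e a₁ v) ∧
    (entry m e s v = entry m e s₁ v ∨ ¬ entry m e s₁ v < e.aux * e.aux ∧
      ¬ LookName m e a v ∧ entry m e s v < e.aux * e.aux ∧ entry m e s v % e.aux = e.num)

open Classical in
/-- The value of `v` for `u`, in the game of the given mode, is the one of the letter `x`. -/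
noncomputable def hasLetter (m : ℕ → ℕ) (e : Env) (μ x u v : ℕ) : ℕ :=
  if μ = 0 ∧ letterAt m e u v = x then 1 else 0

open Classical in
/-- The number of vertices of the bag with the colour of `u` that have the letter `x`. -/
noncomputable def countLetter (m : ℕ → ℕ) (e : Env) (μ s s₁ x u : ℕ) : ℕ :=
  ∑ v ∈ Finset.range e.num, if entry m e s v < e.aux * e.aux ∧
    entry m e s v / e.aux = entry m e s₁ u / e.aux then hasLetter m e μ x u v else 0

/-- Letter `1` is the value `1` and letter `2` the value `-1`; the latter is moved to the other side
of the equation, because the machine knows natural numbers only. -/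
def forgetVertexRule (m : ℕ → ℕ) (e : Env) (μ s s₁ a a₁ u v : ℕ) : Prop :=
  (LookName m e a v ↔ LookName m e a₁ v) ∧
  (LookAdj m e u v → LookName m e a v ∨ entry m e s v < e.aux * e.aux) ∧
  (¬ entry m e s v < e.aux * e.aux ∧ ¬ entry m e s₁ v < e.aux * e.aux ∨
    entry m e s v < e.aux * e.aux ∧ entry m e s₁ v < e.aux * e.aux ∧
    entry m e s v / e.aux = entry m e s₁ v / e.aux ∧
    (entry m e s₁ v / e.aux = entry m e s₁ u / e.aux → entry m e s v % e.aux + hasLetter m e μ 2 v u =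
      entry m e s₁ v % e.aux + hasLetter m e μ 1 v u) ∧
    (¬ entry m e s₁ v / e.aux = entry m e s₁ u / e.aux →
      entry m e s v % e.aux = entry m e s₁ v % e.aux))

def forgetRule (m : ℕ → ℕ) (e : Env) (μ ρ s s₁ a a₁ u : ℕ) : Prop :=
  entry m e s₁ u < e.aux * e.aux ∧ ¬ entry m e s u < e.aux * e.aux ∧ LookName m e a u ∧
  ColorAllowed m e μ ρ u (entry m e s₁ u / e.aux) ∧
  (∀ v < e.num, v ≠ u → forgetVertexRule m e μ s s₁ a a₁ u v) ∧
  e.num + countLetter m e μ s s₁ 2 u ≤ entry m e s₁ u % e.aux + countLetter m e μ s s₁ 1 u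

/-- Two shifted contributions carry the shift `num` twice, which is why it is added once on the
left. -/
def joinRule (m : ℕ → ℕ) (e : Env) (s s₁ s₂ a a₁ a₂ : ℕ) : Prop :=
  ∀ v < e.num, ¬ (LookName m e a₁ v ∧ LookName m e a₂ v) ∧
    (LookName m e a v ↔ LookName m e a₁ v ∨ LookName m e a₂ v) ∧
    (¬ entry m e s v < e.aux * e.aux ∧ ¬ entry m e s₁ v < e.aux * e.aux ∧
        ¬ entry m e s₂ v < e.aux * e.aux ∨
      entry m e s v < e.aux * e.aux ∧ entry m e s₁ v < e.aux * e.aux ∧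
        entry m e s₂ v < e.aux * e.aux ∧ entry m e s v / e.aux = entry m e s₁ v / e.aux ∧
        entry m e s v / e.aux = entry m e s₂ v / e.aux ∧
        entry m e s v % e.aux + e.num = entry m e s₁ v % e.aux + entry m e s₂ v % e.aux)

open Classical in
/-- The bag of the state with code `s` has at most `par + 1` elements (at most `par` in mode `2`). -/
def BagBounded (m : ℕ → ℕ) (e : Env) (μ s : ℕ) : Prop :=
  (∑ v ∈ Finset.range e.num, if entry m e s v < e.aux * e.aux then 1 else 0) ≤ e.par + 1 - (μ - 1)

/-- One step of the dynamic program. -/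
def stateStep (m : ℕ → ℕ) (e : Env) (μ ρ s a : ℕ) : Prop :=
  (BagBounded m e μ s ∧ leafRule m e s a) ∨
  (BagBounded m e μ s ∧ ∃ s₁ < e.big, ∃ a₁ < names e, LookState m e μ ρ s₁ a₁ ∧
    introduceRule m e s s₁ a a₁) ∨
  (∃ s₁ < e.big, ∃ a₁ < names e, LookState m e μ ρ s₁ a₁ ∧
    ∃ u < e.num, forgetRule m e μ ρ s s₁ a a₁ u) ∨
  (∃ s₁ < e.big, ∃ a₁ < names e, LookState m e μ ρ s₁ a₁ ∧
    ∃ s₂ < e.big, ∃ a₂ < names e, LookState m e μ ρ s₂ a₂ ∧ joinRule m e s s₁ s₂ a a₁ a₂)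

def stateRule (m : ℕ → ℕ) (e : Env) (c : ℕ) : Prop :=
  stateStep m e (c / names e / e.big / e.big) (c / names e / e.big % e.big)
    (c / names e % e.big) (c % names e)

/-- The name of the set of all vertices. -/
def nameAll (e : Env) : ℕ := e.num * e.big + e.num

/-- The shape of the input is that of the encoding of a game. -/
def WellFormed (m : ℕ → ℕ) (e : Env) : Prop :=
  (∀ i < e.num, m i = 1) ∧ e.num + 2 ≤ e.start ∧ e.start + e.num * e.num = e.len ∧ m e.num = 3 ∧ m (e.start - 1) = 3 ∧
  (∀ u < e.num, ∀ v < e.num, letterAt m e u v < 3) ∧ ∀ u < e.num, letterAt m e u u = 0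

/-- The final test. -/
def Accepts (m : ℕ → ℕ) (e : Env) : Prop :=
  WellFormed m e ∧ ∃ k < e.aux, LookBits m e (e.num + 1) k ∧
    (e.par = 0 ∨ ¬ LookState m e 2 0 0 (nameAll e)) ∧
    ((k ≤ e.par ∧ ∃ ρ < e.big, LookState m e 0 ρ 0 (nameAll e) ∧
      ∀ i < e.aux, (i < k ↔ ∃ v < e.num, LookSet m e ρ (v * e.aux + i))) ∨
    (e.par < k ∧ k ≤ e.num ∧ LookState m e 1 0 0 (nameAll e)))

/-! ### The rules and the final test are decided in polynomial time -/

section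

variable {f g h i j k l q : (ℕ → ℕ) → Env → (ℕ → ℕ) → ℕ}

open PolyTime PolyPred

theorem PolyTime.baseBits : PolyTime fun _ e _ => RAM.baseBits e := len
theorem PolyTime.baseSets : PolyTime fun _ e _ => RAM.baseSets e := baseBits.add (big.mul big)
theorem PolyTime.baseReach : PolyTime fun _ e _ => RAM.baseReach e := baseSets.add (big.mul big)
theorem PolyTime.baseName : PolyTime fun _ e _ => RAM.baseName e :=
  baseReach.add ((big.mul big).mul big)
theorem PolyTime.names : PolyTime fun _ e _ => RAM.names e := ((big.mul big).mul big).mul big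
theorem PolyTime.baseState : PolyTime fun _ e _ => RAM.baseState e := baseName.add (names.mul big)
theorem PolyTime.digitBase : PolyTime fun _ e _ => RAM.digitBase e :=
  ((aux.mul aux).mul aux).add (const 1)
theorem PolyTime.nameAll : PolyTime fun _ e _ => RAM.nameAll e := (num.mul big).add num

attribute [local irreducible] RAM.baseBits RAM.baseSets RAM.baseReach RAM.baseName RAM.names
  RAM.baseState RAM.digitBase RAM.nameAll

theorem PolyPred.lookBits (hf : PolyTime f) (hg : PolyTime g) :
    PolyPred fun m e w => LookBits m e (f m e w) (g m e w) :=
  ne (get (PolyTime.baseBits.add ((hf.mul big).add hg))) (const 0)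

theorem PolyPred.lookSet (hf : PolyTime f) (hg : PolyTime g) :
    PolyPred fun m e w => LookSet m e (f m e w) (g m e w) :=
  ne (get (PolyTime.baseSets.add ((hf.mul big).add hg))) (const 0)

theorem PolyPred.lookReach (hf : PolyTime f) (hg : PolyTime g) (hh : PolyTime h) :
    PolyPred fun m e w => LookReach m e (f m e w) (g m e w) (h m e w) :=
  ne (get (PolyTime.baseReach.add ((((hf.mul big).add hg).mul big).add hh))) (const 0)

theorem PolyPred.lookName (hf : PolyTime f) (hg : PolyTime g) :
    PolyPred fun m e w => LookName m e (f m e w) (g m e w) :=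
  ne (get (PolyTime.baseName.add ((hf.mul big).add hg))) (const 0)

theorem PolyPred.lookState (hf : PolyTime f) (hg : PolyTime g) (hh : PolyTime h) (hi : PolyTime i) :
    PolyPred fun m e w => LookState m e (f m e w) (g m e w) (h m e w) (i m e w) :=
  ne (get (PolyTime.baseState.add
    ((((((hf.mul big).add hg).mul big).add hh).mul PolyTime.names).add hi))) (const 0)

attribute [local irreducible] LookBits LookSet LookReach LookName LookState

theorem PolyTime.letterAt (hf : PolyTime f) (hg : PolyTime g) :
    PolyTime fun m e w => letterAt m e (f m e w) (g m e w) :=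
  get (start.add ((hf.mul num).add hg))

attribute [local irreducible] RAM.letterAt

theorem PolyPred.lookAdj (hf : PolyTime f) (hg : PolyTime g) :
    PolyPred fun m e w => LookAdj m e (f m e w) (g m e w) :=
  (ne (PolyTime.letterAt hf hg) (const 0)).or (ne (PolyTime.letterAt hg hf) (const 0))

attribute [local irreducible] LookAdj

theorem PolyTime.entry (hf : PolyTime f) (hg : PolyTime g) :
    PolyTime fun m e w => entry m e (f m e w) (g m e w) := by
  have h1 := hf.shift.shift
  have h2 := hg.shift.shift
  unfold RAM.entry
  refine sum (aux.mul aux) (ite (forall_lt ((var 0).add (const 1)) ?_) (const 1) (const 0))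
  exact (lookSet h1 ((h2.mul (aux.mul aux)).add (var 0))).not

attribute [local irreducible] RAM.entry

theorem PolyPred.isEntry (hf : PolyTime f) (hg : PolyTime g) :
    PolyPred fun m e w => RAM.entry m e (f m e w) (g m e w) < e.aux * e.aux :=
  lt (PolyTime.entry hf hg) (aux.mul aux)

theorem polyPred_bitsRule : PolyPred fun m e w => bitsRule m e (w 0) := by
  unfold bitsRule
  apply_rules (maxDepth := 500) [PolyPred.and, PolyPred.or, PolyPred.eq, PolyPred.lt, lookBits, PolyTime.add,
    PolyTime.div, PolyTime.mod, PolyTime.get, PolyTime.var, PolyTime.const, big, start]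

theorem polyPred_setsRule : PolyPred fun m e w => setsRule m e (w 0) := by
  unfold setsRule
  apply_rules (maxDepth := 500) [PolyPred.or, PolyPred.eq, lookSet, PolyTime.add,
    PolyTime.div, PolyTime.mod, PolyTime.var, PolyTime.const, big, PolyTime.digitBase]

theorem polyPred_reachRule : PolyPred fun m e w => reachRule m e (w 0) := by
  unfold reachRule
  apply_rules (maxDepth := 500) [PolyPred.and, PolyPred.or, PolyPred.not, PolyPred.eq, PolyPred.lt, lookSet,
    lookReach, lookAdj, PolyPred.exists_lt, PolyTime.div, PolyTime.mod, PolyTime.var, big, num]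

theorem polyPred_nameRule : PolyPred fun m e w => nameRule m e (w 0) := by
  unfold nameRule
  apply_rules (maxDepth := 500) [PolyPred.and, PolyPred.imp, PolyPred.lt, lookReach, PolyPred.exists_lt,
    PolyTime.div, PolyTime.mod, PolyTime.var, big, num]

theorem PolyPred.colorAllowed (hf : PolyTime f) (hg : PolyTime g) (hh : PolyTime h)
    (hi : PolyTime i) :
    PolyPred fun m e w => ColorAllowed m e (f m e w) (g m e w) (h m e w) (i m e w) := by
  have hg' := hg.shift
  have hh' := hh.shift
  have hi' := hi.shift
  unfold ColorAllowed
  apply_rules (maxDepth := 500) [PolyPred.and, PolyPred.imp, PolyPred.eq, lookSet, PolyPred.exists_lt,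
    PolyPred.forall_lt, PolyTime.add, PolyTime.mul, PolyTime.var, PolyTime.const, aux, num]

attribute [local irreducible] ColorAllowed

theorem PolyPred.leafRule (hf : PolyTime f) (hg : PolyTime g) :
    PolyPred fun m e w => leafRule m e (f m e w) (g m e w) := by
  have hf' := hf.shift
  have hg' := hg.shift
  unfold RAM.leafRule
  apply_rules (maxDepth := 500) [PolyPred.and, PolyPred.or, PolyPred.not, PolyPred.eq, isEntry, PolyTime.entry,
    lookName, PolyPred.forall_lt, PolyTime.mod, PolyTime.var, aux, num]

attribute [local irreducible] RAM.leafRule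

theorem PolyPred.introduceRule (hf : PolyTime f) (hg : PolyTime g) (hh : PolyTime h)
    (hi : PolyTime i) :
    PolyPred fun m e w => introduceRule m e (f m e w) (g m e w) (h m e w) (i m e w) := by
  have hi' := hi.shift
  have hf' := hf.shift
  have hg' := hg.shift
  have hh' := hh.shift
  unfold RAM.introduceRule
  apply_rules (maxDepth := 500) [PolyPred.and, PolyPred.iff, PolyPred.or, PolyPred.not, PolyPred.eq, isEntry, PolyTime.entry,
    lookName, PolyPred.forall_lt, PolyTime.mod, PolyTime.var, aux, num]

attribute [local irreducible] RAM.introduceRule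

theorem PolyTime.hasLetter (hf : PolyTime f) (hg : PolyTime g) (hh : PolyTime h)
    (hi : PolyTime i) :
    PolyTime fun m e w => hasLetter m e (f m e w) (g m e w) (h m e w) (i m e w) :=
  ite ((PolyPred.eq hf (const 0)).and (PolyPred.eq (PolyTime.letterAt hh hi) hg)) (const 1) (const 0)

attribute [local irreducible] RAM.hasLetter

theorem PolyTime.countLetter (hf : PolyTime f) (hg : PolyTime g) (hh : PolyTime h)
    (hi : PolyTime i) (hj : PolyTime j) :
    PolyTime fun m e w => countLetter m e (f m e w) (g m e w) (h m e w) (i m e w) (j m e w) := by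
  unfold RAM.countLetter
  refine sum num (ite ((isEntry hg.shift (var 0)).and (PolyPred.eq ((PolyTime.entry hg.shift (var 0)).div aux)
    ((PolyTime.entry hh.shift hj.shift).div aux))) (PolyTime.hasLetter hf.shift hi.shift hj.shift
    (var 0)) (const 0))

attribute [local irreducible] RAM.countLetter

theorem PolyPred.forgetVertexRule (hf : PolyTime f) (hg : PolyTime g) (hh : PolyTime h)
    (hi : PolyTime i) (hj : PolyTime j) (hk : PolyTime k) (hl : PolyTime l) :
    PolyPred fun m e w => forgetVertexRule m e (f m e w) (g m e w) (h m e w) (i m e w) (j m e w)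
      (k m e w) (l m e w) := by
  unfold RAM.forgetVertexRule
  apply_rules (maxDepth := 500) [PolyPred.and, PolyPred.or, PolyPred.not, PolyPred.imp, PolyPred.iff, PolyPred.eq,
    isEntry, PolyTime.entry, PolyTime.hasLetter, PolyTime.const,
    lookName, lookAdj, PolyTime.add, PolyTime.div, PolyTime.mod, aux]

attribute [local irreducible] RAM.forgetVertexRule

theorem PolyPred.forgetRule (hf : PolyTime f) (hg : PolyTime g) (hh : PolyTime h)
    (hi : PolyTime i) (hj : PolyTime j) (hk : PolyTime k) (hl : PolyTime l) :
    PolyPred fun m e w => forgetRule m e (f m e w) (g m e w) (h m e w) (i m e w) (j m e w)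
      (k m e w) (l m e w) := by
  have hf' := hf.shift
  have hh' := hh.shift
  have hi' := hi.shift
  have hj' := hj.shift
  have hk' := hk.shift
  have hl' := hl.shift
  unfold RAM.forgetRule
  apply_rules (maxDepth := 500) [PolyPred.and, isEntry, PolyPred.ne, PolyPred.not, PolyPred.imp, PolyPred.le,
    PolyTime.entry, PolyTime.countLetter, PolyPred.forgetVertexRule, PolyTime.const, lookName,
    PolyPred.forall_lt, PolyPred.colorAllowed, PolyTime.add, PolyTime.div, PolyTime.mod,
    PolyTime.var, aux, num]

attribute [local irreducible] RAM.forgetRule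

theorem PolyPred.joinRule (hf : PolyTime f) (hg : PolyTime g) (hh : PolyTime h)
    (hi : PolyTime i) (hj : PolyTime j) (hk : PolyTime k) :
    PolyPred fun m e w => joinRule m e (f m e w) (g m e w) (h m e w) (i m e w) (j m e w)
      (k m e w) := by
  have hf' := hf.shift
  have hg' := hg.shift
  have hh' := hh.shift
  have hi' := hi.shift
  have hj' := hj.shift
  have hk' := hk.shift
  unfold RAM.joinRule
  apply_rules (maxDepth := 500) [PolyPred.and, PolyPred.or, PolyPred.not, PolyPred.iff, PolyPred.eq, isEntry,
    PolyTime.entry, lookName, PolyPred.forall_lt, PolyTime.add, PolyTime.div, PolyTime.mod,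
    PolyTime.var, aux, num]

attribute [local irreducible] RAM.joinRule

theorem PolyPred.bagBounded (hf : PolyTime f) (hg : PolyTime g) :
    PolyPred fun m e w => BagBounded m e (f m e w) (g m e w) :=
  PolyPred.le (sum num (ite (isEntry hg.shift (var 0)) (const 1) (const 0)))
    ((par.add (const 1)).sub (hf.sub (const 1)))

attribute [local irreducible] BagBounded

theorem polyPred_stateRule : PolyPred fun m e w => stateRule m e (w 0) := by
  have hN := PolyTime.names
  have h3 := ((var 0).div hN).div big
  -- The four components of the index are bound to variables one after the other, so that the rule
  -- has to be treated for variables only.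
  refine bind (φ := fun m e w x => stateStep m e x (w 0 / RAM.names e / e.big % e.big)
    (w 0 / RAM.names e % e.big) (w 0 % RAM.names e)) (h3.div big) ?_
  refine bind (φ := fun m e w x => stateStep m e (w 0) x
    (w 1 / RAM.names e % e.big) (w 1 % RAM.names e)) (h3.mod big).shift ?_
  refine bind (φ := fun m e w x => stateStep m e (w 1) (w 0) x (w 2 % RAM.names e))
    (((var 0).div hN).mod big).shift.shift ?_
  refine bind (φ := fun m e w x => stateStep m e (w 2) (w 1) (w 0) x)
    ((var 0).mod hN).shift.shift.shift ?_
  unfold stateStep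
  apply_rules (maxDepth := 500) [PolyPred.and, PolyPred.or, PolyPred.bagBounded,
    PolyPred.leafRule, PolyPred.introduceRule, PolyPred.forgetRule, PolyPred.joinRule,
    PolyPred.exists_lt, lookState, PolyTime.var, big, num, PolyTime.names]

theorem polyPred_accepts : PolyPred fun m e _ => Accepts m e := by
  unfold Accepts WellFormed
  apply_rules (maxDepth := 500) [PolyPred.and, PolyPred.or, PolyPred.not, PolyPred.iff, PolyPred.eq,
    PolyPred.lt, PolyPred.le, lookState, lookBits, lookSet, PolyTime.letterAt, PolyPred.exists_lt,
    PolyPred.forall_lt, PolyTime.nameAll, PolyTime.add, PolyTime.sub, PolyTime.mul, PolyTime.get,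
    PolyTime.var, PolyTime.const, aux, num, big, par, start, len]

end

end RAM

namespace RAM

/-! ### What the tables contain -/

/-- All table indices are iterated pairs of the form `x * M + y` with `y < M`. -/
theorem pair_lt {A M x y : ℕ} (hx : x < A) (hy : y < M) : x * M + y < A * M := by
  nlinarith [Nat.mul_le_mul_right M (Nat.succ_le_of_lt hx)]

theorem pair_div {M x y : ℕ} (hy : y < M) : (x * M + y) / M = x := by
  rw [mul_comm, Nat.mul_add_div (by omega), Nat.div_eq_of_lt hy, add_zero]

theorem pair_mod {M x y : ℕ} (hy : y < M) : (x * M + y) % M = y := by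
  rw [mul_comm, Nat.mul_add_mod, Nat.mod_eq_of_lt hy]

noncomputable def memBits (m : ℕ → ℕ) (e : Env) : ℕ → ℕ :=
  saturate (baseBits e) (e.big * e.big) (fun m c => bitsRule m e c) m

noncomputable def memSets (m : ℕ → ℕ) (e : Env) : ℕ → ℕ :=
  saturate (baseSets e) (e.big * e.big) (fun m c => setsRule m e c) (memBits m e)

noncomputable def memReach (m : ℕ → ℕ) (e : Env) : ℕ → ℕ :=
  saturate (baseReach e) (e.big * e.big * e.big) (fun m c => reachRule m e c) (memSets m e)

noncomputable def memName (m : ℕ → ℕ) (e : Env) : ℕ → ℕ :=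
  saturate (baseName e) (names e * e.big) (fun m c => nameRule m e c) (memReach m e)

/-- The memory after all tables have been filled. -/
noncomputable def memState (m : ℕ → ℕ) (e : Env) : ℕ → ℕ :=
  saturate (baseState e) (e.big * e.big * e.big * names e) (fun m c => stateRule m e c)
    (memName m e)

theorem polyCmd_memState : PolyCmd fun m e _ => memState m e := by
  have hM := PolyTime.big
  have h1 := PolyCmd.saturate (β := baseBits) (K := fun e => e.big * e.big)
    PolyTime.baseBits (hM.mul hM) polyPred_bitsRule
  have h2 := PolyCmd.saturate (β := baseSets) (K := fun e => e.big * e.big)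
    PolyTime.baseSets (hM.mul hM) polyPred_setsRule
  have h3 := PolyCmd.saturate (β := baseReach) (K := fun e => e.big * e.big * e.big)
    PolyTime.baseReach ((hM.mul hM).mul hM) polyPred_reachRule
  have h4 := PolyCmd.saturate (β := baseName) (K := fun e => names e * e.big)
    PolyTime.baseName (PolyTime.names.mul hM) polyPred_nameRule
  have h5 := PolyCmd.saturate (β := baseState) (K := fun e => e.big * e.big * e.big * names e)
    PolyTime.baseState (((hM.mul hM).mul hM).mul PolyTime.names) polyPred_stateRule
  exact (((h1.seq h2).seq h3).seq h4).seq h5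

/-- The environment and the memory at the beginning of the computation of the tables. -/
structure Ready (m : ℕ → ℕ) (e : Env) : Prop where
  mem_zero : ∀ a, e.len ≤ a → m a = 0
  aux_eq : e.aux = e.len + e.par + 2
  big_eq : e.big = digitBase e ^ (e.par + 1)
  start_le : e.start ≤ e.len
  num_le : e.num ≤ e.len

theorem mem_table {β K x : ℕ} {m : ℕ → ℕ} (hx : x < K) : x ∈ table β K m ↔ m (β + x) ≠ 0 := by
  simp [table, hx]

/-- Saturation of a table behind which the memory is empty. -/
theorem saturate_stage {β K : ℕ} {φ : (ℕ → ℕ) → ℕ → Prop} {Φ : Set ℕ → ℕ → Prop} {m : ℕ → ℕ}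
    (hm : ∀ a, β ≤ a → m a = 0) (hΦ : ∀ X Y c, X ⊆ Y → Φ X c → Φ Y c)
    (hφ : ∀ m', (∀ a < β, m' a = m a) → ∀ c < K, (φ m' c ↔ Φ (table β K m') c)) :
    ∀ c < K, (saturate β K φ m (β + c) ≠ 0 ↔ Lfp K Φ c) :=
  saturate_spec (fun c _ => hm _ (by omega)) hΦ fun m' hm' => hφ m' fun a ha => hm' a (.inl ha)

/-- The set of vertices with code `s`, with respect to the base `D`. -/
def codeSet (n D s : ℕ) : Finset (Fin n) := {v | (v : ℕ) + 1 ∈ Nat.digits D s}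

theorem mem_codeSet {n D s : ℕ} {v : Fin n} : v ∈ codeSet n D s ↔ (v : ℕ) + 1 ∈ Nat.digits D s := by
  simp [codeSet]

open Classical in
/-- The vertex set with name `a`. -/
noncomputable def nameSet {n : ℕ} (G : SimpleGraph (Fin n)) (D M a : ℕ) : Finset (Fin n) :=
  {w | (∀ u : Fin n, (u : ℕ) = a / M % M → ConnectedAvoiding G (codeSet n D (a / M / M / M)) u w) ∧
    ∃ x : Fin n, (x : ℕ) < a % M ∧ ConnectedAvoiding G (codeSet n D (a / M / M % M)) x w}

theorem mem_nameSet {n D M a : ℕ} {G : SimpleGraph (Fin n)} {w : Fin n} : w ∈ nameSet G D M a ↔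
    (∀ u : Fin n, (u : ℕ) = a / M % M → ConnectedAvoiding G (codeSet n D (a / M / M / M)) u w) ∧
    ∃ x : Fin n, (x : ℕ) < a % M ∧ ConnectedAvoiding G (codeSet n D (a / M / M % M)) x w := by
  simp [nameSet]

/-- The input contains the matrix of `Γ`. -/
structure Describes (m : ℕ → ℕ) (e : Env) (Γ : KASHG) : Prop where
  num_eq : e.num = Γ.n
  start_add : e.start + Γ.n * Γ.n = e.len
  letter_eq : ∀ u v : Fin Γ.n, letterAt m e u v = (KASHG.letter (Γ.val u v) : ℕ)

theorem Describes.congr {m m' : ℕ → ℕ} {e : Env} {Γ : KASHG} (h : Describes m e Γ)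
    (hm : ∀ a < e.len, m' a = m a) : Describes m' e Γ := by
  refine ⟨h.num_eq, h.start_add, fun u v => ?_⟩
  rw [← h.letter_eq, letterAt, letterAt]
  refine hm _ ?_
  have := pair_lt u.2 v.2
  have := h.start_add
  rw [h.num_eq]
  omega

theorem letter_ne_zero_iff {x : ℤ} (hx : x = -1 ∨ x = 0 ∨ x = 1) :
    (KASHG.letter x : ℕ) ≠ 0 ↔ x ≠ 0 := by
  rcases hx with rfl | rfl | rfl <;> simp [KASHG.letter]

theorem Describes.lookAdj_iff {m : ℕ → ℕ} {e : Env} {Γ : KASHG} (h : Describes m e Γ)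
    (hΓ : Γ.IsBinary) (u v : Fin Γ.n) : LookAdj m e u v ↔ Γ.graph.Adj u v := by
  rw [LookAdj, h.letter_eq, h.letter_eq, letter_ne_zero_iff (hΓ u v), letter_ne_zero_iff (hΓ v u)]
  rfl

theorem Describes.exists_iff {m : ℕ → ℕ} {e : Env} {Γ : KASHG} (h : Describes m e Γ)
    {P : ℕ → Prop} : (∃ v < e.num, P v) ↔ ∃ v : Fin Γ.n, P v := by
  rw [h.num_eq, Fin.exists_iff]
  simp

theorem Describes.forall_iff {m : ℕ → ℕ} {e : Env} {Γ : KASHG} (h : Describes m e Γ)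
    {P : ℕ → Prop} : (∀ v < e.num, P v) ↔ ∀ v : Fin Γ.n, P v := by
  rw [h.num_eq, Fin.forall_iff]

namespace Ready

variable {m : ℕ → ℕ} {e : Env} {Γ : KASHG} (h : Ready m e)

include h

theorem digitBase_le_big : digitBase e ≤ e.big := by
  rw [h.big_eq, pow_succ]
  exact Nat.le_mul_of_pos_left _ (Nat.pow_pos (by simp [digitBase]))

theorem aux_lt_digitBase : e.aux < digitBase e := by
  have : 1 ≤ e.aux := by rw [h.aux_eq]; omega
  unfold digitBase
  nlinarith [Nat.mul_le_mul this this, Nat.mul_le_mul_right e.aux (Nat.mul_le_mul this this)]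

theorem aux_lt_big : e.aux < e.big := h.aux_lt_digitBase.trans_le h.digitBase_le_big

theorem two_le_digitBase : 3 ≤ digitBase e := by
  have := h.aux_lt_digitBase
  have := h.aux_eq
  omega

theorem num_lt_big : e.num < e.big := by
  have := h.aux_lt_big
  have := h.aux_eq
  have := h.num_le
  omega

/-- The tables lie one behind the other, and filling one leaves the cells behind it zero. So each
saturation starts from an empty table. -/
theorem memBits_zero {a : ℕ} (ha : baseSets e ≤ a) : memBits m e a = 0 := by
  unfold baseSets at ha
  rw [memBits, saturate_of_outside _ (.inr ha)]
  exact h.mem_zero a (by unfold baseBits at ha; omega)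

theorem memSets_zero {a : ℕ} (ha : baseReach e ≤ a) : memSets m e a = 0 := by
  unfold baseReach at ha
  rw [memSets, saturate_of_outside _ (.inr ha)]
  exact h.memBits_zero (by omega)

theorem memReach_zero {a : ℕ} (ha : baseName e ≤ a) : memReach m e a = 0 := by
  unfold baseName at ha
  rw [memReach, saturate_of_outside _ (.inr ha)]
  exact h.memSets_zero (by omega)

theorem memName_zero {a : ℕ} (ha : baseState e ≤ a) : memName m e a = 0 := by
  unfold baseState at ha
  rw [memName, saturate_of_outside _ (.inr ha)]
  exact h.memReach_zero (by omega)

omit h in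
theorem memBits_eq {a : ℕ} (ha : a < e.len) : memBits m e a = m a :=
  saturate_of_outside _ (.inl ha)

omit h in
theorem memSets_eq {a : ℕ} (ha : a < baseSets e) : memSets m e a = memBits m e a :=
  saturate_of_outside _ (.inl ha)

omit h in
theorem memReach_eq {a : ℕ} (ha : a < baseReach e) : memReach m e a = memSets m e a :=
  saturate_of_outside _ (.inl ha)

omit h in
theorem memName_eq {a : ℕ} (ha : a < baseName e) : memName m e a = memReach m e a :=
  saturate_of_outside _ (.inl ha)

omit h in
theorem memState_eq {a : ℕ} (ha : a < baseState e) : memState m e a = memName m e a :=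
  saturate_of_outside _ (.inl ha)

/-- The rule is the recursion of `Nat.digits`, read from the least significant bit, with the empty
list for `0` at the separator. -/
theorem lookBits_memBits {i k : ℕ} (hi : i < e.big) (hk : k < e.big) :
    LookBits (memBits m e) e i k ↔ i + 1 ≤ e.start ∧
      Nat.digits 2 k = (List.range' i (e.start - 1 - i)).map m := by
  set M := e.big with hM
  have hstart : e.start < M := by
    have := h.start_le
    have := h.aux_lt_big
    have := h.aux_eq
    omega
  let Φ : Set ℕ → ℕ → Prop := fun X c => (c / M + 1 = e.start ∧ c % M = 0) ∨
    (c / M + 1 < e.start ∧ 0 < c % M ∧ (c % M) % 2 = m (c / M) ∧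
      (c / M + 1) * M + c % M / 2 ∈ X)
  have hΦ : ∀ X Y c, X ⊆ Y → Φ X c → Φ Y c := fun X Y c hXY hc =>
    hc.imp_right fun h => ⟨h.1, h.2.1, h.2.2.1, hXY h.2.2.2⟩
  have key := saturate_stage (β := baseBits e) (K := M * M) (φ := fun m c => bitsRule m e c)
    (Φ := Φ) (m := m) h.mem_zero hΦ (by
      intro m' hm' c hc
      have hlt : ∀ i k, i < M → k < M → (i * M + k ∈ table (baseBits e) (M * M) m' ↔
          LookBits m' e i k) := fun i k hi hk => mem_table (pair_lt hi hk)
      have hcM : c % M < M := Nat.mod_lt _ (by omega)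
      unfold bitsRule
      rw [← hM]
      refine or_congr_right (and_congr_right fun h1 => and_congr_right fun h2 => ?_)
      rw [hm' _ (by have := h.start_le; unfold baseBits; omega),
        hlt _ _ (by omega) (by omega)])
  rw [LookBits, memBits, key _ (pair_lt hi hk)]
  constructor
  · intro hL
    -- The least fixed point lies in every closed set, in particular in the set of correct pairs.
    have := hL {c | c / M + 1 ≤ e.start ∧
      Nat.digits 2 (c % M) = (List.range' (c / M) (e.start - 1 - c / M)).map m} ?_
    · rw [Set.mem_ofPred_eq, pair_div hk, pair_mod hk] at this
      exact this
    · rintro c hc (⟨h1, h2⟩ | ⟨h1, h2, h3, h4⟩)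
      · rw [Set.mem_ofPred_eq, h2]
        have : e.start - 1 - c / M = 0 := by omega
        simp [this, h1]
      · have hlt : c % M / 2 < M := by
          have : c % M < M := Nat.mod_lt _ (by omega)
          omega
        rw [Set.mem_ofPred_eq, pair_div hlt, pair_mod hlt] at h4
        refine ⟨by omega, ?_⟩
        rw [Nat.digits_def' (by omega) h2, h4.2, h3]
        have : e.start - 1 - c / M = e.start - 1 - (c / M + 1) + 1 := by omega
        rw [this, List.range'_succ, List.map_cons]
  · rintro ⟨h1, h2⟩
    obtain ⟨d, hd⟩ : ∃ d, d = e.start - 1 - i := ⟨_, rfl⟩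
    induction d generalizing i k with
    | zero =>
      rw [← hd] at h2
      refine Lfp.step hΦ (pair_lt hi hk) (.inl ?_)
      rw [pair_div hk, pair_mod hk]
      refine ⟨by omega, (Nat.digits_eq_nil_iff_eq_zero (b := 2)).1 ?_⟩
      simpa using h2
    | succ d ih =>
      refine Lfp.step hΦ (pair_lt hi hk) (.inr ?_)
      rw [pair_div hk, pair_mod hk]
      have h3 : e.start - 1 - i = e.start - 1 - (i + 1) + 1 := by omega
      have hk0 : 0 < k := by
        rcases Nat.eq_zero_or_pos k with rfl | hk0
        · rw [h3, List.range'_succ] at h2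
          simp at h2
        · exact hk0
      rw [Nat.digits_def' (by omega) hk0, h3, List.range'_succ, List.map_cons, List.cons.injEq] at h2
      have hi' : i + 1 < M := by omega
      have hk' : k / 2 < M := by omega
      exact ⟨by omega, hk0, h2.1, pair_lt hi' hk', ih hi' hk' (by omega) h2.2 (by omega)⟩

/-- Removing the last digit of the code is the recursion of `Nat.digits` in base `D`. -/
theorem lookSet_memSets {s x : ℕ} (hs : s < e.big) (hx : x < e.big) :
    LookSet (memSets m e) e s x ↔ x + 1 ∈ Nat.digits (digitBase e) s := by
  set M := e.big with hM
  set D := digitBase e with hD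
  have hD3 := h.two_le_digitBase
  let Φ : Set ℕ → ℕ → Prop := fun X c => c / M % D = c % M + 1 ∨ (c / M / D) * M + c % M ∈ X
  have hΦ : ∀ X Y c, X ⊆ Y → Φ X c → Φ Y c := fun X Y c hXY hc => hc.imp_right (hXY ·)
  have key := saturate_stage (β := baseSets e) (K := M * M) (φ := fun m c => setsRule m e c)
    (Φ := Φ) (m := memBits m e) (fun a => h.memBits_zero) hΦ (by
      intro m' hm' c hc
      have hM0 : 0 < M := by omega
      have h1 : c / M / D < M := (Nat.div_le_self _ _).trans_lt (Nat.div_lt_of_lt_mul hc)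
      have := mem_table (β := baseSets e) (m := m') (pair_lt h1 (Nat.mod_lt c hM0))
      unfold setsRule
      exact or_congr_right this.symm)
  rw [LookSet, memSets, key _ (pair_lt hs hx)]
  -- The conjunct `s ≠ 0` ensures `s / D < s`, which the induction below needs.
  have hdig : ∀ s, x + 1 ∈ Nat.digits D s ↔ s % D = x + 1 ∨ s ≠ 0 ∧ x + 1 ∈ Nat.digits D (s / D) := by
    intro s
    rcases Nat.eq_zero_or_pos s with rfl | hs
    · simp
    · rw [Nat.digits_def' (by omega) hs, List.mem_cons]
      have : s ≠ 0 := by omega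
      simp [this, eq_comm]
  constructor
  · intro hL
    have := hL {c | c % M = x → x + 1 ∈ Nat.digits D (c / M)} ?_
    · rw [Set.mem_ofPred_eq, pair_div hx, pair_mod hx] at this
      exact this rfl
    · rintro c hc hc' hcx
      rw [hdig]
      rcases hc' with h1 | h1
      · exact .inl (by rw [h1, hcx])
      · rw [Set.mem_ofPred_eq, hcx, pair_div hx, pair_mod hx] at h1
        have h1 := h1 rfl
        refine .inr ⟨fun h0 => ?_, h1⟩
        rw [h0] at h1
        simp at h1
  · induction s using Nat.strong_induction_on with
    | _ s ih =>
      intro hsx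
      rcases (hdig s).1 hsx with h1 | ⟨h0, h1⟩
      · refine Lfp.step hΦ (pair_lt hs hx) (.inl ?_)
        rw [pair_div hx, pair_mod hx, h1]
      · refine Lfp.step hΦ (pair_lt hs hx) (.inr ?_)
        rw [pair_div hx, pair_mod hx]
        have hlt : s / D < s := Nat.div_lt_self (by omega) (by omega)
        exact ⟨pair_lt (hlt.trans hs) hx, ih _ hlt (hlt.trans hs) h1⟩

/-- The contents of the table of sets. -/
theorem lookSet_iff {m' : ℕ → ℕ} (hm' : ∀ a < baseReach e, m' a = memSets m e a) {s x : ℕ}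
    (hs : s < e.big) (hx : x < e.big) : LookSet m' e s x ↔ x + 1 ∈ Nat.digits (digitBase e) s := by
  rw [← h.lookSet_memSets hs hx, LookSet, LookSet, hm']
  have := pair_lt hs hx
  unfold baseReach
  omega

omit h in
theorem describes_congr (hΓ : Describes m e Γ) {m' : ℕ → ℕ}
    (hm' : ∀ a < baseReach e, m' a = memSets m e a) : Describes m' e Γ :=
  hΓ.congr fun a ha => by
    have h1 : a < baseSets e := by unfold baseSets baseBits; omega
    rw [hm' a (by unfold baseReach; omega), memSets_eq h1, memBits_eq ha]

/-- The rule extends a path by one edge at its end, so the least fixed point consists of the pairs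
joined by a path. -/
theorem lookReach_memReach (hΓ : Describes m e Γ) (hbin : Γ.IsBinary) {s : ℕ} (hs : s < e.big)
    (a b : Fin Γ.n) : LookReach (memReach m e) e s a b ↔
      ConnectedAvoiding Γ.graph (codeSet Γ.n (digitBase e) s) a b := by
  set M := e.big with hM
  set D := digitBase e with hD
  have hn : Γ.n < M := hΓ.num_eq ▸ h.num_lt_big
  have hv : ∀ v : Fin Γ.n, (v : ℕ) < M := fun v => v.2.trans hn
  let Φ : Set ℕ → ℕ → Prop := fun X c => ∃ a b : Fin Γ.n, (a : ℕ) = c / M % M ∧ (b : ℕ) = c % M ∧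
    a ∉ codeSet Γ.n D (c / M / M) ∧ b ∉ codeSet Γ.n D (c / M / M) ∧
    (a = b ∨ ∃ z : Fin Γ.n, (c / M / M * M + c / M % M) * M + z ∈ X ∧ Γ.graph.Adj z b)
  have hΦ : ∀ X Y c, X ⊆ Y → Φ X c → Φ Y c := by
    rintro X Y c hXY ⟨a, b, h1, h2, h3, h4, h5⟩
    exact ⟨a, b, h1, h2, h3, h4, h5.imp_right fun ⟨z, h6, h7⟩ => ⟨z, hXY h6, h7⟩⟩
  have key := saturate_stage (β := baseReach e) (K := M * M * M) (φ := fun m c => reachRule m e c)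
    (Φ := Φ) (m := memSets m e) (fun a => h.memSets_zero) hΦ (by
      intro m' hm' c hc
      have hM0 : 0 < M := by omega
      have hΓ' := describes_congr hΓ hm'
      have hc1 : c / M / M < M := by
        rw [Nat.div_div_eq_div_mul]
        exact Nat.div_lt_of_lt_mul (by linarith)
      have hset : ∀ v : Fin Γ.n, LookSet m' e (c / M / M) v ↔ v ∈ codeSet Γ.n D (c / M / M) :=
        fun v => (h.lookSet_iff hm' hc1 (hv v)).trans mem_codeSet.symm
      have htab : ∀ z : Fin Γ.n, (c / M / M * M + c / M % M) * M + z ∈ table (baseReach e) (M * M * M) m' ↔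
          LookReach m' e (c / M / M) (c / M % M) z := fun z =>
        mem_table (pair_lt (pair_lt hc1 (Nat.mod_lt _ hM0)) (hv z))
      unfold reachRule
      rw [← hM]
      constructor
      · rintro ⟨h1, h2, h3, h4, h5⟩
        rw [hΓ.num_eq] at h1 h2
        refine ⟨⟨_, h1⟩, ⟨_, h2⟩, rfl, rfl, fun h' => h3 ((hset ⟨_, h1⟩).2 h'),
          fun h' => h4 ((hset ⟨_, h2⟩).2 h'), ?_⟩
        rcases h5 with h5 | ⟨z, hz, h6, h7⟩
        · exact .inl (Fin.ext h5)
        · rw [hΓ.num_eq] at hz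
          exact .inr ⟨⟨z, hz⟩, (htab ⟨z, hz⟩).2 h6,
            (hΓ'.lookAdj_iff hbin ⟨z, hz⟩ ⟨_, h2⟩).1 h7⟩
      · rintro ⟨a, b, h1, h2, h3, h4, h5⟩
        rw [← hset, h1] at h3
        rw [← hset, h2] at h4
        refine ⟨by rw [← h1, hΓ.num_eq]; exact a.2, by rw [← h2, hΓ.num_eq]; exact b.2, h3, h4, ?_⟩
        rcases h5 with rfl | ⟨z, h6, h7⟩
        · exact .inl (h1.symm.trans h2)
        · refine .inr ⟨z, by rw [hΓ.num_eq]; exact z.2, (htab z).1 h6, ?_⟩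
          rw [← h2]
          exact (hΓ'.lookAdj_iff hbin z b).2 h7)
  have hpair : ∀ a b : Fin Γ.n, ((s * M + a) * M + b) / M / M = s ∧
      ((s * M + a) * M + b) / M % M = a ∧ ((s * M + a) * M + b) % M = b := fun a b => by
    rw [pair_div (hv b), pair_div (hv a), pair_mod (hv a), pair_mod (hv b)]; simp
  have hlt : ∀ a b : Fin Γ.n, (s * M + a) * M + b < M * M * M := fun a b =>
    pair_lt (pair_lt hs (hv a)) (hv b)
  rw [LookReach, memReach, key _ (hlt a b)]
  constructor
  · intro hL
    have := hL {c | ∀ a b : Fin Γ.n, (a : ℕ) = c / M % M → (b : ℕ) = c % M →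
      ConnectedAvoiding Γ.graph (codeSet Γ.n D (c / M / M)) a b} ?_
    · obtain ⟨h1, h2, h3⟩ := hpair a b
      have := this a b h2.symm h3.symm
      rwa [h1] at this
    · rintro c hc ⟨a, b, h1, h2, h3, h4, h5⟩ a' b' ha' hb'
      obtain rfl : a' = a := Fin.ext (ha'.trans h1.symm)
      obtain rfl : b' = b := Fin.ext (hb'.trans h2.symm)
      rcases h5 with rfl | ⟨z, h6, h7⟩
      · exact .refl h3
      · refine ConnectedAvoiding.tail ?_ h7 h4
        have hdiv : ((c / M / M * M + c / M % M) * M + z) / M = c / M := by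
          rw [pair_div (hv z)]; exact Nat.div_add_mod' _ _
        have := h6 a' z (by rw [hdiv]; exact h1) (by rw [pair_mod (hv z)])
        rwa [hdiv] at this
  · rintro ⟨h1, h2⟩
    induction h2 with
    | refl =>
      refine Lfp.step hΦ (hlt a a) ⟨a, a, ?_⟩
      obtain ⟨b1, b2, b3⟩ := hpair a a
      rw [b1, b2, b3]
      exact ⟨rfl, rfl, h1, h1, .inl rfl⟩
    | @tail z b _ hzb ih =>
      refine Lfp.step hΦ (hlt a b) ⟨a, b, ?_⟩
      obtain ⟨b1, b2, b3⟩ := hpair a b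
      rw [b1, b2, b3]
      exact ⟨rfl, rfl, h1, hzb.2, .inr ⟨z, ⟨hlt a z, ih⟩, hzb.1⟩⟩

/-- The contents of the table of reachability. -/
theorem lookReach_iff (hΓ : Describes m e Γ) (hbin : Γ.IsBinary) {m' : ℕ → ℕ}
    (hm' : ∀ a < baseName e, m' a = memReach m e a) {s : ℕ} (hs : s < e.big)
    (a b : Fin Γ.n) : LookReach m' e s a b ↔
      ConnectedAvoiding Γ.graph (codeSet Γ.n (digitBase e) s) a b := by
  rw [← h.lookReach_memReach hΓ hbin hs, LookReach, LookReach, hm']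
  have hn : Γ.n < e.big := hΓ.num_eq ▸ h.num_lt_big
  have := pair_lt (pair_lt hs (a.2.trans hn)) (b.2.trans hn)
  unfold baseName
  omega

/-- The rule does not refer to its own table but only to reachability, so the fixed point is one
application of it. -/
theorem lookName_memName (hΓ : Describes m e Γ) (hbin : Γ.IsBinary) {a : ℕ} (ha : a < names e)
    (v : Fin Γ.n) : LookName (memName m e) e a v ↔
      v ∈ nameSet Γ.graph (digitBase e) e.big a := by
  set M := e.big with hM
  set D := digitBase e with hD
  have hn : Γ.n < M := hΓ.num_eq ▸ h.num_lt_big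
  have hv : ∀ v : Fin Γ.n, (v : ℕ) < M := fun v => v.2.trans hn
  let Φ : Set ℕ → ℕ → Prop := fun _ c => ∃ v : Fin Γ.n, (v : ℕ) = c % M ∧
    v ∈ nameSet Γ.graph D M (c / M)
  have hΦ : ∀ X Y c, X ⊆ Y → Φ X c → Φ Y c := fun _ _ _ _ h => h
  have key := saturate_stage (β := baseName e) (K := names e * M) (φ := fun m c => nameRule m e c)
    (Φ := Φ) (m := memReach m e) (fun a => h.memReach_zero) hΦ (by
      intro m' hm' c hc
      have hM0 : 0 < M := by omega
      have hc1 : c / M / M / M / M < M := by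
        rw [Nat.div_div_eq_div_mul, Nat.div_div_eq_div_mul, Nat.div_div_eq_div_mul]
        refine Nat.div_lt_of_lt_mul ?_
        have : names e * M = M * (M * (M * M)) * M := by simp only [names, ← hM]; ring
        linarith
      have hr : ∀ s < M, ∀ a b : Fin Γ.n, LookReach m' e s a b ↔
          ConnectedAvoiding Γ.graph (codeSet Γ.n D s) a b := fun s hs => h.lookReach_iff hΓ hbin hm' hs
      unfold nameRule
      rw [← hM, hΓ.num_eq]
      constructor
      · rintro ⟨h1, h2, w, hw, h3, h4⟩
        refine ⟨⟨_, h1⟩, rfl, mem_nameSet.2 ⟨fun u hu => ?_, ⟨w, hw⟩, h3, ?_⟩⟩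
        · rw [← hu] at h2
          exact (hr _ hc1 u ⟨_, h1⟩).1 (h2 u.2)
        · exact (hr _ (Nat.mod_lt _ hM0) ⟨w, hw⟩ ⟨_, h1⟩).1 h4
      · rintro ⟨v, hv', hv''⟩
        obtain ⟨h1, x, hx, h2⟩ := mem_nameSet.1 hv''
        rw [← hv']
        refine ⟨v.2, fun hu => ?_, x, x.2, hx, (hr _ (Nat.mod_lt _ hM0) x v).2 h2⟩
        exact (hr _ hc1 ⟨_, hu⟩ v).2 (h1 ⟨_, hu⟩ rfl))
  rw [LookName, memName, key _ (pair_lt ha (hv v))]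
  constructor
  · intro hL
    have := hL {c | Φ ∅ c} fun c _ hc => hc
    obtain ⟨v', h1, h2⟩ := this
    rw [pair_mod (hv v)] at h1
    rw [pair_div (hv v), Fin.ext h1] at h2
    exact h2
  · intro hva
    refine Lfp.step hΦ (pair_lt ha (hv v)) ⟨v, ?_, ?_⟩
    · rw [pair_mod (hv v)]
    · rwa [pair_div (hv v)]

/-- The contents of the table of names. -/
theorem lookName_iff (hΓ : Describes m e Γ) (hbin : Γ.IsBinary) {m' : ℕ → ℕ}
    (hm' : ∀ a < baseState e, m' a = memName m e a) {a : ℕ} (ha : a < names e)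
    (v : Fin Γ.n) : LookName m' e a v ↔ v ∈ nameSet Γ.graph (digitBase e) e.big a := by
  rw [← h.lookName_memName hΓ hbin ha, LookName, LookName, hm']
  have hn : Γ.n < e.big := hΓ.num_eq ▸ h.num_lt_big
  have := pair_lt ha (v.2.trans hn)
  unfold baseState
  omega

end Ready

end RAM

namespace RAM

/-! ### The table of states -/

/-- The colour and the contribution that are encoded in an entry. -/
def unpack (n Z y : ℕ) : Option (ℕ × ℤ) :=
  if y < Z * Z then some (y / Z, ((y % Z : ℕ) : ℤ) - n) else none

theorem unpack_eq_none {n Z y : ℕ} : unpack n Z y = none ↔ ¬ y < Z * Z := by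
  simp [unpack]

theorem unpack_eq_some {n Z y c : ℕ} {h : ℤ} : unpack n Z y = some (c, h) ↔
    y < Z * Z ∧ y / Z = c ∧ ((y % Z : ℕ) : ℤ) = h + n := by
  unfold unpack
  split_ifs with hy
  · simp [hy, sub_eq_iff_eq_add]
  · simp [hy]

/-- Within the range `y ≤ Z * Z` the only number that stands for "no entry" is `Z * Z` itself. Hence
states may be compared by comparing entries. -/
theorem unpack_inj {n Z y y' : ℕ} (hy : y ≤ Z * Z) (hy' : y' ≤ Z * Z) :
    unpack n Z y = unpack n Z y' ↔ y = y' := by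
  refine ⟨fun h => ?_, fun h => h ▸ rfl⟩
  by_cases h0 : y' < Z * Z
  · have h1 : unpack n Z y' = some (y' / Z, ((y' % Z : ℕ) : ℤ) - n) := by simp [unpack, h0]
    rw [h1, unpack_eq_some] at h
    have h2 : y % Z = y' % Z := by have := h.2.2; omega
    rw [← Nat.div_add_mod y Z, ← Nat.div_add_mod y' Z, h.2.1, h2]
  · rw [unpack_eq_none.2 h0, unpack_eq_none] at h
    omega

/-- The entry at the vertex `v` of the state with code `s`. -/
def entryOf (D Z s v : ℕ) : ℕ :=
  ∑ y ∈ Finset.range (Z * Z), if ∀ z < y + 1, v * (Z * Z) + z + 1 ∉ Nat.digits D s then 1 else 0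

theorem entryOf_le {D Z s v : ℕ} : entryOf D Z s v ≤ Z * Z := by
  refine (Finset.sum_le_card_nsmul _ _ 1 fun y _ => ?_).trans (by simp)
  split_ifs <;> simp

/-- The sum counts the numbers below the first `z` that is stored for `v`, so it equals that `z`; if
nothing is stored it is `Z * Z`. -/
theorem entryOf_eq {D Z s v y : ℕ} (hy : y ≤ Z * Z)
    (h : ∀ z < Z * Z, v * (Z * Z) + z + 1 ∈ Nat.digits D s ↔ z = y) : entryOf D Z s v = y := by
  have : entryOf D Z s v = ∑ x ∈ Finset.range (Z * Z), if x < y then 1 else 0 := by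
    refine Finset.sum_congr rfl fun x hx => if_congr ?_ rfl rfl
    rw [Finset.mem_range] at hx
    constructor
    · intro h'
      by_contra hxy
      exact h' y (by omega) ((h y (by omega)).2 rfl)
    · intro h' z hz hz'
      have := (h z (by omega)).1 hz'
      omega
  rw [this, Finset.sum_boole]
  have : Finset.filter (fun x => x < y) (Finset.range (Z * Z)) = Finset.range y := by
    ext x; simp; omega
  simp [this]

/-- The state with code `s`. -/
def decode (n D Z s : ℕ) (v : Fin n) : Option (ℕ × ℤ) := unpack n Z (entryOf D Z s v)

/-- The values of a game in mode `μ`; only mode `0` takes them into account. -/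
def gameVal (Γ : KASHG) (μ : ℕ) (u v : Fin Γ.n) : ℤ := if μ = 0 then Γ.val u v else 0

/-- The colours that are allowed for the vertex `v`, if the set with code `ρ` chooses the
representatives. -/
def colorOk (n D Z μ ρ : ℕ) (v : Fin n) (c : ℕ) : Prop :=
  c < Z ∧ (μ = 0 → (∃ x : Fin n, x * Z + c + 1 ∈ Nat.digits D ρ) ∧
    ∀ i < Z, v * Z + i + 1 ∈ Nat.digits D ρ → i = c)

/-- The rules of the dynamic program for codes. -/
def CodeRule (Γ : KASHG) (D M Z N p : ℕ) (μ ρ : ℕ) (T : ℕ → ℕ → Prop) (s a : ℕ) : Prop :=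
  StateRule Γ.graph (p + 1 - (μ - 1)) (gameVal Γ μ) (colorOk Γ.n D Z μ ρ)
    (fun U σ => ∃ s < M, ∃ a < N, T s a ∧ nameSet Γ.graph D M a = U ∧ decode Γ.n D Z s = σ)
    (nameSet Γ.graph D M a) (decode Γ.n D Z s)

/-! ### The numerical rules agree with those of the dynamic program -/

namespace Ready

variable {m : ℕ → ℕ} {e : Env} {Γ : KASHG} (h : Ready m e) {m' : ℕ → ℕ}
  (hm' : ∀ a < baseState e, m' a = memName m e a)

include h hm'

omit h in
theorem agree_memReach {a : ℕ} (ha : a < baseName e) : m' a = memReach m e a := by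
  rw [hm' a (by unfold baseState; omega), memName_eq ha]

omit h in
theorem agree_memSets {a : ℕ} (ha : a < baseReach e) : m' a = memSets m e a := by
  rw [agree_memReach hm' (by unfold baseName; omega), memReach_eq ha]

omit hm' in
-- The elements of a coded state are below `aux ^ 3`. This is what dictates the base `aux ^ 3 + 1`,
-- whose digits reach `aux ^ 3`.
theorem pair_lt_big {v y : ℕ} (hv : v < e.num) (hy : y < e.aux * e.aux) :
    v * (e.aux * e.aux) + y < e.big := by
  have h1 : e.num < e.aux := by have := h.aux_eq; have := h.num_le; omega
  have h2 := pair_lt (hv.trans h1) hy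
  have h3 := h.digitBase_le_big
  unfold digitBase at h3
  linarith

theorem entry_eq {s v : ℕ} (hs : s < e.big) (hv : v < e.num) :
    entry m' e s v = entryOf (digitBase e) e.aux s v := by
  unfold entry entryOf
  refine Finset.sum_congr rfl fun y hy => ?_
  rw [Finset.mem_range] at hy
  have : (∀ z < y + 1, ¬ LookSet m' e s (v * (e.aux * e.aux) + z)) ↔
      ∀ z < y + 1, v * (e.aux * e.aux) + z + 1 ∉ Nat.digits (digitBase e) s :=
    forall₂_congr fun z hz => not_congr <|
      h.lookSet_iff (fun a => agree_memSets hm') hs (h.pair_lt_big hv (by omega))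
  simp only [this]

theorem decode_eq {s : ℕ} (hs : s < e.big) (hn : e.num = Γ.n) (v : Fin Γ.n) :
    decode Γ.n (digitBase e) e.aux s v = unpack Γ.n e.aux (entry m' e s v) := by
  rw [h.entry_eq hm' hs (v.2.trans_eq hn.symm), decode]

theorem entry_le {s v : ℕ} (hs : s < e.big) (hv : v < e.num) : entry m' e s v ≤ e.aux * e.aux := by
  rw [h.entry_eq hm' hs hv]
  exact entryOf_le

variable (hΓ : Describes m e Γ) (hbin : Γ.IsBinary)

include hΓ

omit h in
theorem describes : Describes m' e Γ := describes_congr hΓ fun _ => agree_memSets hm'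

include hbin

omit h in
-- A value in `{-1, 0, 1}` is the difference of the indicators of the letters `1` and `2`. In modes
-- other than `0` both vanish.
theorem hasLetter_sub (μ : ℕ) (u v : Fin Γ.n) :
    (hasLetter m' e μ 1 u v : ℤ) - hasLetter m' e μ 2 u v = gameVal Γ μ u v := by
  have h1 := (describes hm' hΓ).letter_eq u v
  unfold hasLetter gameVal
  rw [h1]
  by_cases hμ : μ = 0
  · rcases hbin u v with h2 | h2 | h2 <;> simp [h2, hμ, KASHG.letter]
  · simp [hμ]

omit hbin in
theorem colorAllowed_iff {μ ρ c : ℕ} (hρ : ρ < e.big) (v : Fin Γ.n) (hc : c < e.aux) :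
    ColorAllowed m' e μ ρ v c ↔ colorOk Γ.n (digitBase e) e.aux μ ρ v c := by
  have hlt : ∀ (x : Fin Γ.n) (i : ℕ), i < e.aux → (x : ℕ) * e.aux + i < e.big := fun x i hi => by
    have h1 : e.num < e.aux := by have := h.aux_eq; have := h.num_le; omega
    have h2 := pair_lt ((x.2.trans_eq hΓ.num_eq.symm).trans h1) hi
    have h3 := h.digitBase_le_big
    unfold digitBase at h3
    nlinarith [Nat.mul_le_mul_left (e.aux * e.aux) (by omega : 1 ≤ e.aux)]
  have hset : ∀ (x : Fin Γ.n) (i : ℕ), i < e.aux → (LookSet m' e ρ (x * e.aux + i) ↔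
      x * e.aux + i + 1 ∈ Nat.digits (digitBase e) ρ) := fun x i hi =>
    h.lookSet_iff (fun a => agree_memSets hm') hρ (hlt x i hi)
  unfold ColorAllowed colorOk
  rw [hΓ.exists_iff (P := fun x => LookSet m' e ρ (x * e.aux + c))]
  simp only [hc, true_and, hset _ c hc]
  refine forall_congr' fun _ => and_congr_right fun _ => forall₂_congr fun i hi => ?_
  rw [hset v i hi]

omit hbin in
theorem bagBounded_iff {μ s : ℕ} (hs : s < e.big) : BagBounded m' e μ s ↔
    (stateDomain (decode Γ.n (digitBase e) e.aux s)).card ≤ e.par + 1 - (μ - 1) := by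
  unfold BagBounded
  rw [hΓ.num_eq, Finset.sum_range]
  have : ∀ v : Fin Γ.n, entry m' e s v < e.aux * e.aux ↔
      v ∈ stateDomain (decode Γ.n (digitBase e) e.aux s) := fun v => by
    rw [mem_stateDomain, h.decode_eq hm' hs hΓ.num_eq, Ne, unpack_eq_none, not_not]
  simp only [this, Finset.sum_boole, Finset.filter_univ_mem, Nat.cast_id]

theorem lookName {a : ℕ} (ha : a < names e) (v : Fin Γ.n) :
    LookName m' e a v ↔ v ∈ nameSet Γ.graph (digitBase e) e.big a :=
  h.lookName_iff hΓ hbin hm' ha v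

theorem leafRule_iff {s a : ℕ} (hs : s < e.big) (ha : a < names e) : leafRule m' e s a ↔
    nameSet Γ.graph (digitBase e) e.big a = ∅ ∧ ∀ v, decode Γ.n (digitBase e) e.aux s v = none ∨
      ∃ c, decode Γ.n (digitBase e) e.aux s v = some (c, 0) := by
  rw [leafRule, hΓ.forall_iff (P := fun v => ¬ LookName m' e a v ∧ (¬ entry m' e s v < e.aux * e.aux ∨
    entry m' e s v % e.aux = e.num)), forall_and, Finset.eq_empty_iff_forall_notMem]
  refine and_congr (forall_congr' fun v => by rw [h.lookName hm' hΓ hbin ha]) (forall_congr' fun v => ?_)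
  simp only [h.decode_eq hm' hs hΓ.num_eq, unpack_eq_none, unpack_eq_some, hΓ.num_eq, zero_add,
    Nat.cast_inj]
  constructor
  · rintro (h1 | h1)
    · exact .inl h1
    · by_cases h2 : entry m' e s v < e.aux * e.aux
      · exact .inr ⟨_, h2, rfl, h1⟩
      · exact .inl h2
  · rintro (h1 | ⟨c, -, -, h1⟩)
    · exact .inl h1
    · exact .inr h1

theorem introduceRule_iff {s s₁ a a₁ : ℕ} (hs : s < e.big) (hs₁ : s₁ < e.big) (ha : a < names e)
    (ha₁ : a₁ < names e) : introduceRule m' e s s₁ a a₁ ↔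
      nameSet Γ.graph (digitBase e) e.big a₁ = nameSet Γ.graph (digitBase e) e.big a ∧
      ∀ v, decode Γ.n (digitBase e) e.aux s v = decode Γ.n (digitBase e) e.aux s₁ v ∨
        decode Γ.n (digitBase e) e.aux s₁ v = none ∧ v ∉ nameSet Γ.graph (digitBase e) e.big a ∧
          ∃ c, decode Γ.n (digitBase e) e.aux s v = some (c, 0) := by
  unfold introduceRule
  refine (hΓ.forall_iff (P := fun v => _ ∧ _)).trans ?_
  rw [forall_and, Finset.ext_iff]
  refine and_congr (forall_congr' fun v => ?_) (forall_congr' fun v => ?_)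
  · rw [h.lookName hm' hΓ hbin ha, h.lookName hm' hΓ hbin ha₁]
    exact iff_comm
  have hv : (v : ℕ) < e.num := v.2.trans_eq hΓ.num_eq.symm
  rw [h.decode_eq hm' hs hΓ.num_eq, h.decode_eq hm' hs₁ hΓ.num_eq,
    unpack_inj (h.entry_le hm' hs hv) (h.entry_le hm' hs₁ hv), unpack_eq_none,
    h.lookName hm' hΓ hbin ha]
  refine or_congr_right (and_congr_right fun _ => and_congr_right fun _ => ?_)
  simp only [unpack_eq_some, hΓ.num_eq, zero_add, Nat.cast_inj]
  exact ⟨fun h => ⟨_, h.1, rfl, h.2⟩, fun ⟨_, h1, _, h2⟩ => ⟨h1, h2⟩⟩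

theorem joinRule_iff {s s₁ s₂ a a₁ a₂ : ℕ} (hs : s < e.big) (hs₁ : s₁ < e.big) (hs₂ : s₂ < e.big)
    (ha : a < names e) (ha₁ : a₁ < names e) (ha₂ : a₂ < names e) :
    joinRule m' e s s₁ s₂ a a₁ a₂ ↔ ∀ v : Fin Γ.n,
      ¬ (v ∈ nameSet Γ.graph (digitBase e) e.big a₁ ∧ v ∈ nameSet Γ.graph (digitBase e) e.big a₂) ∧
      (v ∈ nameSet Γ.graph (digitBase e) e.big a ↔
        v ∈ nameSet Γ.graph (digitBase e) e.big a₁ ∨ v ∈ nameSet Γ.graph (digitBase e) e.big a₂) ∧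
      (decode Γ.n (digitBase e) e.aux s v = none ∧ decode Γ.n (digitBase e) e.aux s₁ v = none ∧
        decode Γ.n (digitBase e) e.aux s₂ v = none ∨
      ∃ c h₁ h₂, decode Γ.n (digitBase e) e.aux s₁ v = some (c, h₁) ∧
        decode Γ.n (digitBase e) e.aux s₂ v = some (c, h₂) ∧
        decode Γ.n (digitBase e) e.aux s v = some (c, h₁ + h₂)) := by
  unfold joinRule
  refine (hΓ.forall_iff (P := fun v => _)).trans (forall_congr' fun v => ?_)
  rw [h.decode_eq hm' hs hΓ.num_eq, h.decode_eq hm' hs₁ hΓ.num_eq, h.decode_eq hm' hs₂ hΓ.num_eq,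
    unpack_eq_none, unpack_eq_none, unpack_eq_none,
    h.lookName hm' hΓ hbin ha, h.lookName hm' hΓ hbin ha₁, h.lookName hm' hΓ hbin ha₂, hΓ.num_eq]
  refine and_congr_right fun _ => and_congr_right fun _ => or_congr_right ?_
  simp only [unpack_eq_some]
  constructor
  · rintro ⟨h1, h2, h3, h4, h5, h6⟩
    refine ⟨entry m' e s v / e.aux, ((entry m' e s₁ v % e.aux : ℕ) : ℤ) - Γ.n,
      ((entry m' e s₂ v % e.aux : ℕ) : ℤ) - Γ.n, ⟨h2, h4.symm, by ring⟩, ⟨h3, h5.symm, by ring⟩, h1, rfl, ?_⟩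
    omega
  · rintro ⟨c, x, y, ⟨h2, h4, h6⟩, ⟨h3, h5, h7⟩, h1, h8, h9⟩
    exact ⟨h1, h2, h3, h8.trans h4.symm, h8.trans h5.symm, by omega⟩

/-- Each condition on integers matches its numerical form after adding the shift `n` and splitting
the values into differences of indicators; the utility of the bag becomes the difference of two
counts. -/
theorem forgetRule_iff {μ ρ s s₁ a a₁ : ℕ} (hρ : ρ < e.big) (hs : s < e.big) (hs₁ : s₁ < e.big)
    (ha : a < names e) (ha₁ : a₁ < names e) (u : Fin Γ.n) :
    forgetRule m' e μ ρ s s₁ a a₁ u ↔ ∃ cu hu,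
      decode Γ.n (digitBase e) e.aux s₁ u = some (cu, hu) ∧
      decode Γ.n (digitBase e) e.aux s u = none ∧ u ∈ nameSet Γ.graph (digitBase e) e.big a ∧
      colorOk Γ.n (digitBase e) e.aux μ ρ u cu ∧
      (∀ v, v ≠ u → ((v ∈ nameSet Γ.graph (digitBase e) e.big a ↔
          v ∈ nameSet Γ.graph (digitBase e) e.big a₁) ∧
        (Γ.graph.Adj u v → v ∈ nameSet Γ.graph (digitBase e) e.big a ∨
          decode Γ.n (digitBase e) e.aux s v ≠ none) ∧
        (decode Γ.n (digitBase e) e.aux s v = none ∧ decode Γ.n (digitBase e) e.aux s₁ v = none ∨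
          ∃ c h, decode Γ.n (digitBase e) e.aux s₁ v = some (c, h) ∧
            decode Γ.n (digitBase e) e.aux s v =
              some (c, h + if c = cu then gameVal Γ μ v u else 0)))) ∧
      0 ≤ hu + ∑ v, if (decode Γ.n (digitBase e) e.aux s v).map Prod.fst = some cu then
        gameVal Γ μ u v else 0 := by
  have hdec := h.decode_eq hm' hs hΓ.num_eq
  have hdec₁ := h.decode_eq hm' hs₁ hΓ.num_eq
  have hΓ' := describes hm' hΓ
  have hZ : 0 < e.aux := by rw [h.aux_eq]; omega
  have hcount : ((countLetter m' e μ s s₁ 1 u : ℕ) : ℤ) - countLetter m' e μ s s₁ 2 u =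
      ∑ v : Fin Γ.n, if (decode Γ.n (digitBase e) e.aux s v).map Prod.fst =
        some (entry m' e s₁ u / e.aux) then gameVal Γ μ u v else 0 := by
    unfold countLetter
    rw [hΓ.num_eq, Finset.sum_range, Finset.sum_range, Nat.cast_sum, Nat.cast_sum,
      ← Finset.sum_sub_distrib]
    refine Finset.sum_congr rfl fun v _ => ?_
    have hiff : (decode Γ.n (digitBase e) e.aux s v).map Prod.fst = some (entry m' e s₁ u / e.aux) ↔
        entry m' e s v < e.aux * e.aux ∧ entry m' e s v / e.aux = entry m' e s₁ u / e.aux := by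
      rw [hdec, unpack]
      split_ifs with h0 <;> simp [h0]
    rw [← hasLetter_sub hm' hΓ hbin]
    by_cases hc : entry m' e s v < e.aux * e.aux ∧ entry m' e s v / e.aux = entry m' e s₁ u / e.aux
    · rw [if_pos hc, if_pos hc, if_pos (hiff.2 hc)]
    · rw [if_neg hc, if_neg hc, if_neg fun h0 => hc (hiff.1 h0)]
      simp
  have hvertex : ∀ v : Fin Γ.n, forgetVertexRule m' e μ s s₁ a a₁ u v ↔
      ((v ∈ nameSet Γ.graph (digitBase e) e.big a ↔
          v ∈ nameSet Γ.graph (digitBase e) e.big a₁) ∧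
        (Γ.graph.Adj u v → v ∈ nameSet Γ.graph (digitBase e) e.big a ∨
          decode Γ.n (digitBase e) e.aux s v ≠ none) ∧
        (decode Γ.n (digitBase e) e.aux s v = none ∧ decode Γ.n (digitBase e) e.aux s₁ v = none ∨
          ∃ c h, decode Γ.n (digitBase e) e.aux s₁ v = some (c, h) ∧
            decode Γ.n (digitBase e) e.aux s v =
              some (c, h + if c = entry m' e s₁ u / e.aux then gameVal Γ μ v u else 0))) := by
    intro v
    unfold forgetVertexRule
    rw [h.lookName hm' hΓ hbin ha, h.lookName hm' hΓ hbin ha₁, hΓ'.lookAdj_iff hbin, hdec, hdec₁,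
      Ne, unpack_eq_none, unpack_eq_none, not_not]
    refine and_congr_right fun _ => and_congr_right fun _ => or_congr_right ?_
    simp only [unpack_eq_some]
    have hl := hasLetter_sub hm' hΓ hbin μ v u
    constructor
    · rintro ⟨h1, h2, h3, h4, h5⟩
      refine ⟨_, ((entry m' e s₁ v % e.aux : ℕ) : ℤ) - Γ.n, ⟨h2, rfl, by ring⟩, h1, h3, ?_⟩
      split_ifs with h6
      · have := h4 h6; omega
      · have := h5 h6; omega
    · rintro ⟨c, x, ⟨h1, rfl, h2⟩, h3, h4, h5⟩
      refine ⟨h3, h1, h4, fun h6 => ?_, fun h6 => ?_⟩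
      · rw [if_pos h6] at h5; omega
      · rw [if_neg h6] at h5; omega
  have hall : (∀ v < e.num, v ≠ (u : ℕ) → forgetVertexRule m' e μ s s₁ a a₁ u v) ↔
      ∀ v : Fin Γ.n, v ≠ u → forgetVertexRule m' e μ s s₁ a a₁ u v := by
    refine (hΓ.forall_iff (P := fun v => v ≠ (u : ℕ) → _)).trans (forall_congr' fun v => ?_)
    rw [Ne, Fin.val_inj]
  unfold forgetRule
  rw [hall, h.lookName hm' hΓ hbin ha]
  simp only [hvertex]
  constructor
  · rintro ⟨h1, h2, h3, h4, h5, h6⟩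
    refine ⟨entry m' e s₁ u / e.aux, ((entry m' e s₁ u % e.aux : ℕ) : ℤ) - Γ.n, ?_, ?_, h3, ?_, h5, ?_⟩
    · rw [hdec₁, unpack_eq_some]; exact ⟨h1, rfl, by ring⟩
    · rwa [hdec, unpack_eq_none]
    · rwa [← h.colorAllowed_iff hm' hΓ hρ u (Nat.div_lt_of_lt_mul h1)]
    · rw [hΓ.num_eq] at h6
      omega
  · rintro ⟨cu, hu, h1, h2, h3, h4, h5, h6⟩
    rw [hdec₁, unpack_eq_some] at h1
    rw [hdec, unpack_eq_none] at h2
    obtain ⟨h1, rfl, h7⟩ := h1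
    refine ⟨h1, h2, h3, ?_, h5, ?_⟩
    · rwa [h.colorAllowed_iff hm' hΓ hρ u (Nat.div_lt_of_lt_mul h1)]
    · rw [hΓ.num_eq]
      omega

theorem stateStep_iff {μ ρ s a : ℕ} (hρ : ρ < e.big) (hs : s < e.big) (ha : a < names e) :
    stateStep m' e μ ρ s a ↔ CodeRule Γ (digitBase e) e.big e.aux (names e) e.par μ ρ
      (LookState m' e μ ρ) s a := by
  unfold stateStep CodeRule StateRule
  rw [h.bagBounded_iff hm' hΓ hs, h.leafRule_iff hm' hΓ hbin hs ha]
  refine or_congr (by tauto) (or_congr ?_ (or_congr ?_ ?_))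
  · constructor
    · rintro ⟨h1, s₁, hs₁, a₁, ha₁, h2, h3⟩
      obtain ⟨h4, h5⟩ := (h.introduceRule_iff hm' hΓ hbin hs hs₁ ha ha₁).1 h3
      exact ⟨_, ⟨s₁, hs₁, a₁, ha₁, h2, h4, rfl⟩, h1, h5⟩
    · rintro ⟨_, ⟨s₁, hs₁, a₁, ha₁, h2, h3, rfl⟩, h1, h4⟩
      exact ⟨h1, s₁, hs₁, a₁, ha₁, h2, (h.introduceRule_iff hm' hΓ hbin hs hs₁ ha ha₁).2 ⟨h3, h4⟩⟩
  · constructor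
    · rintro ⟨s₁, hs₁, a₁, ha₁, h1, u, hu, h2⟩
      rw [hΓ.num_eq] at hu
      obtain ⟨cu, hu', h3⟩ := (h.forgetRule_iff hm' hΓ hbin hρ hs hs₁ ha ha₁ ⟨u, hu⟩).1 h2
      exact ⟨_, _, _, cu, hu', ⟨s₁, hs₁, a₁, ha₁, h1, rfl, rfl⟩, h3⟩
    · rintro ⟨_, _, u, cu, hu', ⟨s₁, hs₁, a₁, ha₁, h1, rfl, rfl⟩, h3⟩
      exact ⟨s₁, hs₁, a₁, ha₁, h1, u, u.2.trans_eq hΓ.num_eq.symm,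
        (h.forgetRule_iff hm' hΓ hbin hρ hs hs₁ ha ha₁ u).2 ⟨cu, hu', h3⟩⟩
  · constructor
    · rintro ⟨s₁, hs₁, a₁, ha₁, h1, s₂, hs₂, a₂, ha₂, h2, h3⟩
      exact ⟨_, _, _, _, ⟨s₁, hs₁, a₁, ha₁, h1, rfl, rfl⟩, ⟨s₂, hs₂, a₂, ha₂, h2, rfl, rfl⟩,
        (h.joinRule_iff hm' hΓ hbin hs hs₁ hs₂ ha ha₁ ha₂).1 h3⟩
    · rintro ⟨_, _, _, _, ⟨s₁, hs₁, a₁, ha₁, h1, rfl, rfl⟩, ⟨s₂, hs₂, a₂, ha₂, h2, rfl, rfl⟩, h3⟩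
      exact ⟨s₁, hs₁, a₁, ha₁, h1, s₂, hs₂, a₂, ha₂, h2,
        (h.joinRule_iff hm' hΓ hbin hs hs₁ hs₂ ha ha₁ ha₂).2 h3⟩

end Ready

end RAM

namespace RAM

/-! ### Existence of codes -/

/-- List the elements, each increased by one, as digits in any order. No digit is zero, so no
leading digit is lost, and at most `q` digits give a code below `D ^ q`. -/
theorem exists_code {D q B : ℕ} (hB : B < D) (F : Finset ℕ) (hF : ∀ x ∈ F, x < B)
    (hcard : F.card ≤ q) : ∃ s < D ^ q, ∀ x, x + 1 ∈ Nat.digits D s ↔ x ∈ F := by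
  rcases F.eq_empty_or_nonempty with rfl | ⟨x₀, hx₀⟩
  · exact ⟨0, Nat.pow_pos (by omega), by simp⟩
  have hD : 1 < D := by have := hF x₀ hx₀; omega
  have hmem : ∀ y ∈ F.toList.map Nat.succ, ∃ x ∈ F, x + 1 = y := fun y hy => by
    obtain ⟨x, hx, rfl⟩ := List.mem_map.1 hy
    exact ⟨x, Finset.mem_toList.1 hx, rfl⟩
  have hlt : ∀ y ∈ F.toList.map Nat.succ, y < D := fun y hy => by
    obtain ⟨x, hx, rfl⟩ := hmem y hy
    have := hF x hx
    omega
  refine ⟨Nat.ofDigits D (F.toList.map Nat.succ), ?_, fun x => ?_⟩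
  · refine (Nat.ofDigits_lt_base_pow_length hD hlt).trans_le (Nat.pow_le_pow_right (by omega) ?_)
    simpa using hcard
  · rw [Nat.digits_ofDigits D hD _ hlt fun hne => ?_]
    · simp
    · obtain ⟨x, -, hx⟩ := hmem _ (List.getLast_mem hne)
      omega

theorem exists_codeSet {n D q : ℕ} (hn : n < D) (S : Finset (Fin n)) (hS : S.card ≤ q) :
    ∃ s < D ^ q, codeSet n D s = S := by
  obtain ⟨s, hs, h⟩ := exists_code hn (S.map Fin.valEmbedding)
    (fun x hx => by
      obtain ⟨v, -, rfl⟩ := Finset.mem_map.1 hx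
      exact v.2) (by simpa using hS)
  refine ⟨s, hs, Finset.ext fun v => ?_⟩
  rw [mem_codeSet, h]
  simp [Fin.val_inj]

theorem decode_eq_of_digits {n D Z s : ℕ} {σ : Fin n → Option (ℕ × ℤ)} {y : Fin n → ℕ}
    (hy : ∀ v, y v ≤ Z * Z) (hσ : ∀ v, σ v = unpack n Z (y v))
    (h : ∀ v : Fin n, ∀ z < Z * Z, v * (Z * Z) + z + 1 ∈ Nat.digits D s ↔ z = y v) :
    decode n D Z s = σ := by
  funext v
  rw [decode, entryOf_eq (hy v) (h v), hσ]

/-- The code is that of the set of all `v * (Z * Z) + y v`, where `v` runs through the bag and `y v`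
packs colour and shifted contribution; it has one digit per vertex of the bag. -/
theorem exists_decode {n D Z q : ℕ} (hn : n ≤ Z) (hD : Z * Z * Z < D) {σ : Fin n → Option (ℕ × ℤ)}
    (hσ : ∀ v c h, σ v = some (c, h) → c < Z ∧ 0 ≤ h + n ∧ h + n < Z)
    (hcard : (stateDomain σ).card ≤ q) : ∃ s < D ^ q, decode n D Z s = σ := by
  have key : ∀ v, ∃ y ≤ Z * Z, σ v = unpack n Z y := by
    intro v
    rcases hv : σ v with _ | ⟨c, h⟩
    · exact ⟨Z * Z, le_rfl, (unpack_eq_none.2 (lt_irrefl _)).symm⟩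
    · obtain ⟨h1, h2, h3⟩ := hσ v c h hv
      obtain ⟨k, hk⟩ := Int.eq_ofNat_of_zero_le h2
      have hkZ : k < Z := by omega
      have := pair_lt h1 hkZ
      refine ⟨c * Z + k, this.le, (unpack_eq_some.2 ⟨this, pair_div hkZ, ?_⟩).symm⟩
      rw [pair_mod hkZ, hk]
  choose y hy hyσ using key
  have hdom : ∀ v, v ∈ stateDomain σ ↔ y v < Z * Z := fun v => by
    rw [mem_stateDomain, hyσ, Ne, unpack_eq_none, not_not]
  obtain ⟨s, hs, h⟩ := exists_code (q := q) (hD) ((stateDomain σ).image fun v => v * (Z * Z) + y v)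
    (fun x hx => by
      obtain ⟨v, hv, rfl⟩ := Finset.mem_image.1 hx
      have := pair_lt (v.2.trans_le hn) ((hdom v).1 hv)
      linarith) (Finset.card_image_le.trans hcard)
  refine ⟨s, hs, decode_eq_of_digits hy hyσ fun v z hz => ?_⟩
  rw [h, Finset.mem_image]
  constructor
  · rintro ⟨w, hw, hwz⟩
    have hw' := (hdom w).1 hw
    have h1 : (w : ℕ) = v := by
      rw [← pair_div (x := w) hw', hwz, pair_div hz]
    obtain rfl := Fin.ext h1
    omega
  · rintro rfl
    exact ⟨v, (hdom v).2 hz, rfl⟩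

theorem CodeRule.mono {Γ : KASHG} {D M Z N p μ ρ s a : ℕ} {T T' : ℕ → ℕ → Prop}
    (hT : ∀ s < M, ∀ a < N, T s a → T' s a) (h : CodeRule Γ D M Z N p μ ρ T s a) :
    CodeRule Γ D M Z N p μ ρ T' s a :=
  StateRule.mono (fun _ _ ⟨s, hs, a, ha, h1, h2⟩ => ⟨s, hs, a, ha, hT s hs a ha h1, h2⟩) h

theorem gameVal_adj {Γ : KASHG} {μ : ℕ} (u v : Fin Γ.n) (h : gameVal Γ μ u v ≠ 0) :
    Γ.graph.Adj u v := by
  by_contra h0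
  exact h (by simp [gameVal, KASHG.val_eq_zero_of_not_adj h0])

/-- Binary valuations enter here: contributions lie between `-n` and `n`, so the shift by `n` makes
them nonnegative and there are polynomially many. -/
theorem abs_colorValue_le {Γ : KASHG} (hbin : Γ.IsBinary) (μ : ℕ) (c : Fin Γ.n → ℕ)
    (U : Finset (Fin Γ.n)) (v : Fin Γ.n) : |colorValue (gameVal Γ μ) c U v| ≤ Γ.n := by
  refine (Finset.abs_sum_le_sum_abs _ _).trans ((Finset.sum_le_card_nsmul _ _ 1 fun y _ => ?_).trans ?_)
  · unfold gameVal
    rcases hbin v y with h | h | h <;> split_ifs <;> simp [h]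
  · simpa using U.card_le_univ

/-! ### Soundness and completeness of the table of states -/

namespace Ready

variable {m : ℕ → ℕ} {e : Env} {Γ : KASHG} (h : Ready m e) (hΓ : Describes m e Γ)
  (hbin : Γ.IsBinary)

include h

omit h in
theorem stateIndex_lt {μ ρ s a : ℕ} (hμ : μ < e.big) (hρ : ρ < e.big) (hs : s < e.big)
    (ha : a < names e) : stateIndex e μ ρ s a < e.big * e.big * e.big * names e :=
  pair_lt (pair_lt (pair_lt hμ hρ) hs) ha

omit h in
theorem stateIndex_decomp {μ ρ s a : ℕ} (hρ : ρ < e.big) (hs : s < e.big)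
    (ha : a < names e) : stateIndex e μ ρ s a / names e / e.big / e.big = μ ∧
      stateIndex e μ ρ s a / names e / e.big % e.big = ρ ∧
      stateIndex e μ ρ s a / names e % e.big = s ∧ stateIndex e μ ρ s a % names e = a := by
  unfold stateIndex
  rw [pair_div ha, pair_mod ha, pair_div hs, pair_mod hs, pair_div hρ, pair_mod hρ]
  simp

include hΓ hbin

/-- The table of states is the least fixed point of the rules. -/
theorem lookState_memState : ∃ Φ : Set ℕ → ℕ → Prop,
    (∀ X Y c, X ⊆ Y → Φ X c → Φ Y c) ∧
    (∀ X, ∀ μ < e.big, ∀ ρ < e.big, ∀ s < e.big, ∀ a < names e, Φ X (stateIndex e μ ρ s a) ↔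
      CodeRule Γ (digitBase e) e.big e.aux (names e) e.par μ ρ
        (fun s a => stateIndex e μ ρ s a ∈ X) s a) ∧
    ∀ μ < e.big, ∀ ρ < e.big, ∀ s < e.big, ∀ a < names e, LookState (memState m e) e μ ρ s a ↔
      Lfp (e.big * e.big * e.big * names e) Φ (stateIndex e μ ρ s a) := by
  -- A rule never changes the mode or the set of representatives, so the table consists of
  -- independent fixed points, one for each pair `μ`, `ρ`.
  let Φ : Set ℕ → ℕ → Prop := fun X c =>
    CodeRule Γ (digitBase e) e.big e.aux (names e) e.par (c / names e / e.big / e.big)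
      (c / names e / e.big % e.big)
      (fun s a => stateIndex e (c / names e / e.big / e.big) (c / names e / e.big % e.big) s a ∈ X)
      (c / names e % e.big) (c % names e)
  have hΦ : ∀ X Y c, X ⊆ Y → Φ X c → Φ Y c := fun X Y c hXY hc =>
    hc.mono fun s _ a _ h1 => hXY h1
  have key := saturate_stage (β := baseState e) (K := e.big * e.big * e.big * names e)
    (φ := fun m c => stateRule m e c) (Φ := Φ) (m := memName m e) (fun a => h.memName_zero) hΦ (by
      intro m' hm' c hc
      have hM0 : 0 < e.big := by have := h.aux_lt_big; omega
      have hN0 : 0 < names e := by unfold names; positivity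
      have hμ : c / names e / e.big / e.big < e.big := by
        rw [Nat.div_div_eq_div_mul, Nat.div_div_eq_div_mul]
        exact Nat.div_lt_of_lt_mul (by linarith)
      have hρ : c / names e / e.big % e.big < e.big := Nat.mod_lt _ hM0
      unfold stateRule
      rw [h.stateStep_iff hm' hΓ hbin hρ (Nat.mod_lt _ hM0) (Nat.mod_lt _ hN0)]
      have htab : ∀ s < e.big, ∀ a < names e,
          (stateIndex e (c / names e / e.big / e.big) (c / names e / e.big % e.big) s a ∈
            table (baseState e) (e.big * e.big * e.big * names e) m' ↔
          LookState m' e (c / names e / e.big / e.big) (c / names e / e.big % e.big) s a) :=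
        fun s hs a ha => mem_table (stateIndex_lt hμ hρ hs ha)
      exact ⟨fun hc => hc.mono fun s hs a ha => (htab s hs a ha).2,
        fun hc => hc.mono fun s hs a ha => (htab s hs a ha).1⟩)
  refine ⟨Φ, hΦ, fun X μ hμ ρ hρ s hs a ha => ?_, fun μ hμ ρ hρ s hs a ha =>
    key _ (stateIndex_lt hμ hρ hs ha)⟩
  obtain ⟨h1, h2, h3, h4⟩ := stateIndex_decomp (μ := μ) hρ hs ha
  simp only [Φ, h1, h2, h3, h4]

/-- Fixed-point induction: the indices all of whose readings in mode `μ` with representatives `ρ`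
are sound form a closed set, since the rules preserve soundness. -/
theorem stateSound_of_lookState {μ ρ s a : ℕ} (hμ : μ < e.big) (hρ : ρ < e.big) (hs : s < e.big)
    (ha : a < names e) (hL : LookState (memState m e) e μ ρ s a) :
    StateSound Γ.graph (e.par + 1 - (μ - 1)) (gameVal Γ μ)
      (colorOk Γ.n (digitBase e) e.aux μ ρ) (nameSet Γ.graph (digitBase e) e.big a)
      (decode Γ.n (digitBase e) e.aux s) := by
  obtain ⟨Φ, -, h2, h3⟩ := h.lookState_memState hΓ hbin
  have := (h3 μ hμ ρ hρ s hs a ha).1 hL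
    {c | ∀ s < e.big, ∀ a < names e, c = stateIndex e μ ρ s a →
      StateSound Γ.graph (e.par + 1 - (μ - 1)) (gameVal Γ μ)
        (colorOk Γ.n (digitBase e) e.aux μ ρ) (nameSet Γ.graph (digitBase e) e.big a)
        (decode Γ.n (digitBase e) e.aux s)} ?_
  · exact this s hs a ha rfl
  · rintro c - hc s hs a ha rfl
    rw [h2 _ μ hμ ρ hρ s hs a ha] at hc
    refine StateRule.sound gameVal_adj (StateRule.mono ?_ hc)
    rintro U σ ⟨s', hs', a', ha', h4, rfl, rfl⟩
    exact h4 s' hs' a' ha' rfl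

omit hbin in
-- The matrix alone has `n * n` letters, so `aux ≥ n * n + 2 > 2 * n`. Thus shifted contributions,
-- which are at most `2 * n`, are below `aux`.
theorem two_mul_num_lt : Γ.n + Γ.n < e.aux := by
  have h1 := h.aux_eq
  have h2 := hΓ.start_add
  have : 2 * Γ.n < Γ.n * Γ.n + 2 := by
    rcases Γ.n with _ | _ | k
    · simp
    · simp
    · nlinarith
  omega

omit hbin in
theorem exists_set {S : Finset (Fin Γ.n)} (hS : S.card ≤ e.par + 1) :
    ∃ s < e.big, codeSet Γ.n (digitBase e) s = S := by
  rw [h.big_eq]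
  refine exists_codeSet ?_ S hS
  have := h.two_mul_num_lt hΓ
  have := h.aux_lt_digitBase
  omega

omit hbin in
theorem exists_name {S S' : Finset (Fin Γ.n)} (hS : S.card ≤ e.par + 1) (hS' : S'.card ≤ e.par + 1)
    {i j : ℕ} (hi : i < e.big) (hj : j < e.big) : ∃ a < names e, ∀ w,
      w ∈ nameSet Γ.graph (digitBase e) e.big a ↔
        (∀ u : Fin Γ.n, (u : ℕ) = i → ConnectedAvoiding Γ.graph S u w) ∧
        ∃ x : Fin Γ.n, (x : ℕ) < j ∧ ConnectedAvoiding Γ.graph S' x w := by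
  obtain ⟨s, hs, rfl⟩ := h.exists_set hΓ hS
  obtain ⟨s', hs', rfl⟩ := h.exists_set hΓ hS'
  refine ⟨((s * e.big + s') * e.big + i) * e.big + j,
    pair_lt (pair_lt (pair_lt hs hs') hi) hj, fun w => ?_⟩
  rw [mem_nameSet, pair_div hj, pair_mod hj, pair_div hi, pair_mod hi, pair_div hs', pair_mod hs']

omit hbin in
-- All three kinds of sets that a derivation needs have names: for a single component take `S' = ∅`
-- and `j = n`, for an intersection use all parts of the name, and for a union of components take `i
-- = n`, which voids the first condition.
theorem separated_names {b : ℕ} (hb : b ≤ e.par + 1) (D : TreeDecomposition Γ.graph)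
    (hD : ∀ t, (D.bag t).card ≤ b) : Separated Γ.graph b
      {U | ∃ a < names e, nameSet Γ.graph (digitBase e) e.big a = U} Finset.univ ∅ := by
  have hn : Γ.n < e.big := hΓ.num_eq ▸ h.num_lt_big
  refine D.separated hD (fun S u hS => ?_) (fun S S' u j hS hS' hj => ?_) (fun j hj => ?_)
  · obtain ⟨a, ha, haU⟩ := h.exists_name hΓ (hS.trans hb) (S' := ∅) (by simp) (u.2.trans hn) hn
    refine ⟨a, ha, Finset.ext fun w => ?_⟩
    rw [haU, mem_component]
    refine ⟨fun h' => h'.1 u rfl, fun h' => ⟨fun u' hu => Fin.ext hu ▸ h', w, w.2, .refl (by simp)⟩⟩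
  · obtain ⟨a, ha, haU⟩ := h.exists_name hΓ (hS.trans hb) (hS'.trans hb) (u.2.trans hn)
      (hj.trans_lt hn)
    refine ⟨a, ha, Finset.ext fun w => ?_⟩
    rw [haU, Finset.mem_inter, mem_component, mem_components]
    exact and_congr_left fun _ => ⟨fun h' => h' u rfl, fun h' u' hu => Fin.ext hu ▸ h'⟩
  · obtain ⟨a, ha, haU⟩ := h.exists_name hΓ (S := ∅) (S' := ∅) (by simp) (by simp) hn
      (hj.trans_lt hn)
    refine ⟨a, ha, Finset.ext fun w => ?_⟩
    rw [haU, mem_components]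
    exact ⟨fun h' => h'.2, fun h' => ⟨fun u hu => absurd hu u.2.ne, h'⟩⟩

omit hΓ hbin in
theorem nameAll_lt : nameAll e < names e := by
  have h1 := pair_lt h.num_lt_big h.num_lt_big
  have h2 : 0 < e.big := (Nat.zero_le _).trans_lt h.num_lt_big
  have : e.big * e.big * 1 ≤ e.big * e.big * (e.big * e.big) :=
    Nat.mul_le_mul_left _ (Nat.mul_pos h2 h2)
  unfold nameAll names
  linarith

omit hbin in
theorem nameSet_nameAll : nameSet Γ.graph (digitBase e) e.big (nameAll e) = Finset.univ := by
  have h1 := h.num_lt_big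
  refine Finset.eq_univ_of_forall fun w => mem_nameSet.2 ?_
  unfold nameAll
  rw [pair_div h1, pair_mod h1, Nat.div_eq_of_lt h1, Nat.mod_eq_of_lt h1, hΓ.num_eq]
  refine ⟨fun u hu => absurd hu u.2.ne, w, w.2, .refl ?_⟩
  simp [mem_codeSet]

omit h hΓ hbin in
theorem decode_zero {n D Z : ℕ} (v : Fin n) : decode n D Z 0 v = none := by
  rw [decode, unpack_eq_none, entryOf]
  simp

/-- Forwards, soundness of the entry with all vertices forgotten and empty bag gives a derivation,
hence a tree-decomposition, and a colouring. Backwards, the decomposition gives a derivation through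
named sets, and the states of the colouring along it have codes and get marked. -/
theorem lookState_nameAll {μ ρ : ℕ} (hμ : μ < e.big) (hρ : ρ < e.big) :
    LookState (memState m e) e μ ρ 0 (nameAll e) ↔
      (∃ D : TreeDecomposition Γ.graph, ∀ t, (D.bag t).card ≤ e.par + 1 - (μ - 1)) ∧
      ∃ c : Fin Γ.n → ℕ, (∀ u, colorOk Γ.n (digitBase e) e.aux μ ρ u (c u)) ∧
        ∀ u, 0 ≤ colorValue (gameVal Γ μ) c Finset.univ u := by
  have hM0 : 0 < e.big := by omega
  constructor
  · intro hL
    obtain ⟨h1, c, -, h2⟩ := h.stateSound_of_lookState hΓ hbin hμ hρ hM0 h.nameAll_lt hL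
    rw [h.nameSet_nameAll hΓ] at h1 h2
    have h3 : stateDomain (decode Γ.n (digitBase e) e.aux 0) = ∅ := by
      ext v; simp [decode_zero]
    rw [h3] at h1
    exact ⟨h1.exists_treeDecomposition, c, fun u => (h2 u (Finset.mem_univ u)).1,
      fun u => (h2 u (Finset.mem_univ u)).2⟩
  · rintro ⟨⟨D, hD⟩, c, hc, hc'⟩
    obtain ⟨Φ, h1, h2, h3⟩ := h.lookState_memState hΓ hbin
    have hb : e.par + 1 - (μ - 1) ≤ e.par + 1 := by omega
    -- Codes and names are not unique. Demanding that every code and name of the pair is marked, and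
    -- that some exist, makes the predicate independent of choices; in the end it applies to the
    -- particular code `0` and name `nameAll e`.
    let T : Finset (Fin Γ.n) → (Fin Γ.n → Option (ℕ × ℤ)) → Prop := fun U σ =>
      (∃ s < e.big, decode Γ.n (digitBase e) e.aux s = σ) ∧
      (∃ a < names e, nameSet Γ.graph (digitBase e) e.big a = U) ∧
      ∀ s < e.big, ∀ a < names e, decode Γ.n (digitBase e) e.aux s = σ →
        nameSet Γ.graph (digitBase e) e.big a = U → LookState (memState m e) e μ ρ s a
    have hcode : ∀ U S, S.card ≤ e.par + 1 - (μ - 1) → ∃ s < e.big,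
        decode Γ.n (digitBase e) e.aux s = colorState (gameVal Γ μ) c U S := by
      intro U S hS
      have hn := h.two_mul_num_lt hΓ
      rw [h.big_eq]
      refine exists_decode (by omega) (by unfold digitBase; omega) (fun v c' x hv => ?_)
        (by simpa using hS.trans hb)
      by_cases hvS : v ∈ S
      · simp only [colorState, hvS, if_true, Option.some.injEq, Prod.mk.injEq] at hv
        obtain ⟨rfl, rfl⟩ := hv
        have := abs_le.1 (abs_colorValue_le hbin μ c U v)
        exact ⟨(hc v).1, by omega, by omega⟩
      · simp [colorState, hvS] at hv
    have hT := (h.separated_names hΓ hb D hD).state_complete (T := T) gameVal_adj hc hc' (by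
      intro U S hU hS hrule
      refine ⟨hcode U S hS, hU, fun s hs a ha hsσ haU => ?_⟩
      rw [h3 μ hμ ρ hρ s hs a ha]
      refine Lfp.step h1 (stateIndex_lt hμ hρ hs ha) ((h2 _ μ hμ ρ hρ s hs a ha).2 ?_)
      unfold CodeRule
      rw [hsσ, haU]
      refine hrule.mono ?_
      rintro U' σ' ⟨⟨s', hs', h4⟩, ⟨a', ha', h5⟩, h6⟩
      exact ⟨s', hs', a', ha', ⟨stateIndex_lt hμ hρ hs' ha',
        (h3 μ hμ ρ hρ s' hs' a' ha').1 (h6 s' hs' a' ha' h4 h5)⟩, h5, h4⟩)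
    refine hT.2.2 0 hM0 _ h.nameAll_lt ?_ (h.nameSet_nameAll hΓ)
    funext v
    simp [decode_zero, colorState]

end Ready

end RAM

/-! ### Words that encode games -/

namespace KASHG

theorem map_encode (Γ : KASHG) : Γ.encode.map Fin.val = List.replicate Γ.n 1 ++ ([3] ++
    (Nat.digits 2 Γ.k ++ ([3] ++ List.ofFn fun i : Fin (Γ.n * Γ.n) =>
      (letter (Γ.val i.divNat i.modNat) : ℕ)))) := by
  have h1 : (Γ.k.bits.map fun b => if b then (1 : Fin 4) else 0).map Fin.val = Nat.digits 2 Γ.k := by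
    rw [Nat.digits_two_eq_bits, List.map_map]
    refine List.map_congr_left fun b _ => ?_
    cases b <;> rfl
  have h2 : ((List.finRange Γ.n).flatMap fun i => (List.finRange Γ.n).map fun j =>
      letter (Γ.val i j)).map Fin.val = List.ofFn fun i : Fin (Γ.n * Γ.n) =>
        (letter (Γ.val i.divNat i.modNat) : ℕ) := by
    rw [List.ofFn_mul, List.flatMap, List.map_flatten, List.map_map, ← List.ofFn_eq_map]
    congr 2
    funext i
    simp only [Function.comp, ← List.ofFn_eq_map, List.map_ofFn]
    congr 1
    funext j
    have e1 : Fin.divNat (⟨i * Γ.n + j, RAM.pair_lt i.2 j.2⟩ : Fin (Γ.n * Γ.n)) = i :=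
      Fin.ext (RAM.pair_div j.2)
    have e2 : Fin.modNat (⟨i * Γ.n + j, RAM.pair_lt i.2 j.2⟩ : Fin (Γ.n * Γ.n)) = j :=
      Fin.ext (RAM.pair_mod j.2)
    rw [Function.comp, e1, e2]
  rw [encode, List.map_append, List.map_append, List.map_append, List.map_append, h1, h2]
  simp

theorem length_encode (Γ : KASHG) :
    Γ.encode.length = Γ.n + 2 + (Nat.digits 2 Γ.k).length + Γ.n * Γ.n := by
  rw [← List.length_map (f := Fin.val), map_encode]
  simp
  ring

/-- The letters of the encoding of a game, position by position. -/
theorem eq_encode_iff {Γ : KASHG} {x : List (Fin 4)} {m : ℕ → ℕ} {s : ℕ}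
    (hm : ∀ i (hi : i < x.length), m i = x[i]) (hs : Γ.n + 2 ≤ s)
    (hlen : s + Γ.n * Γ.n = x.length) : x = Γ.encode ↔
      (∀ i < Γ.n, m i = 1) ∧ m Γ.n = 3 ∧
      Nat.digits 2 Γ.k = (List.range' (Γ.n + 1) (s - 1 - (Γ.n + 1))).map m ∧ m (s - 1) = 3 ∧
      ∀ u v : Fin Γ.n, m (s + (u * Γ.n + v)) = (letter (Γ.val u v) : ℕ) := by
  have hx : x.map Fin.val = (List.range' 0 Γ.n).map m ++ ([m Γ.n] ++
      ((List.range' (Γ.n + 1) (s - 1 - (Γ.n + 1))).map m ++ ([m (s - 1)] ++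
        List.ofFn fun i : Fin (Γ.n * Γ.n) => m (s + i)))) := by
    have h0 : (List.range' s (Γ.n * Γ.n)).map m = List.ofFn fun i : Fin (Γ.n * Γ.n) => m (s + i) := by
      refine List.ext_getElem (by simp) fun i _ _ => by simp
    have h1 : x.map Fin.val = (List.range' 0 x.length).map m := by
      refine List.ext_getElem (by simp) fun i h1 h2 => ?_
      simp only [List.length_map] at h1
      simp [hm i h1]
    have h2 : x.length = Γ.n + (1 + (s - 1 - (Γ.n + 1) + (1 + Γ.n * Γ.n))) := by omega
    rw [h1, h2, ← List.range'_append_1, ← List.range'_append_1, ← List.range'_append_1,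
      ← List.range'_append_1, List.map_append, List.map_append, List.map_append, List.map_append,
      ← h0]
    have e1 : 0 + Γ.n + 1 + (s - 1 - (Γ.n + 1)) = s - 1 := by omega
    have e2 : s - 1 + 1 = s := by omega
    rw [e1, e2, zero_add]
    simp
  have hmatrix : ((List.ofFn fun i : Fin (Γ.n * Γ.n) => m (s + i)) =
      List.ofFn fun i : Fin (Γ.n * Γ.n) => (letter (Γ.val i.divNat i.modNat) : ℕ)) ↔
      ∀ u v : Fin Γ.n, m (s + (u * Γ.n + v)) = (letter (Γ.val u v) : ℕ) := by
    rw [List.ofFn_inj, funext_iff]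
    constructor
    · intro h u v
      have hv := v.2
      have := h ⟨u * Γ.n + v, RAM.pair_lt u.2 hv⟩
      have e1 : Fin.divNat (⟨u * Γ.n + v, RAM.pair_lt u.2 hv⟩ : Fin (Γ.n * Γ.n)) = u :=
        Fin.ext (RAM.pair_div hv)
      have e2 : Fin.modNat (⟨u * Γ.n + v, RAM.pair_lt u.2 hv⟩ : Fin (Γ.n * Γ.n)) = v :=
        Fin.ext (RAM.pair_mod hv)
      rwa [e1, e2] at this
    · intro h i
      rw [← h i.divNat i.modNat]
      congr 2
      simp only [Fin.coe_divNat, Fin.coe_modNat]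
      exact (Nat.div_add_mod' _ _).symm
  rw [← hmatrix]
  constructor
  · rintro rfl
    have hl := Γ.length_encode
    rw [map_encode] at hx
    obtain ⟨a1, hx⟩ := List.append_inj hx (by simp)
    obtain ⟨a2, hx⟩ := List.append_inj hx (by simp)
    obtain ⟨a3, hx⟩ := List.append_inj hx (by simp; omega)
    obtain ⟨a4, hx⟩ := List.append_inj hx (by simp)
    refine ⟨fun i hi => ?_, by simpa using a2.symm, a3, by simpa using a4.symm, hx.symm⟩
    exact (List.eq_replicate_iff.1 a1.symm).2 _ (List.mem_map.2 ⟨i, by simp [hi], rfl⟩)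
  · rintro ⟨a1, a2, a3, a4, a5⟩
    refine List.map_injective_iff.2 Fin.val_injective ?_
    rw [hx, map_encode, a2, a3, a4, a5]
    congr 1
    refine (List.map_eq_replicate_iff.2 fun i hi => a1 i ?_).trans (by simp)
    simpa using hi

end KASHG

namespace RAM

/-! ### Correctness of the final test -/

namespace Ready

variable {m : ℕ → ℕ} {e : Env} {Γ : KASHG} (h : Ready m e)

include h

theorem two_lt_big : 2 < e.big := h.two_le_digitBase.trans h.digitBase_le_big

theorem lookSet_memState {s x : ℕ} (hs : s < e.big) (hx : x < e.big) :
    LookSet (memState m e) e s x ↔ x + 1 ∈ Nat.digits (digitBase e) s :=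
  h.lookSet_iff (fun _ ha => agree_memSets (fun _ ha => memState_eq ha) ha) hs hx

theorem lookBits_memState {i k : ℕ} (hi : i < e.big) (hk : k < e.big) :
    LookBits (memState m e) e i k ↔ i + 1 ≤ e.start ∧
      Nat.digits 2 k = (List.range' i (e.start - 1 - i)).map m := by
  rw [← h.lookBits_memBits hi hk, LookBits, LookBits]
  have := pair_lt hi hk
  have hlt : baseBits e + (i * e.big + k) < baseSets e := by unfold baseSets; omega
  have hlt' : baseBits e + (i * e.big + k) < baseReach e := by unfold baseReach; omega
  rw [agree_memSets (fun _ ha => memState_eq ha) hlt', memSets_eq hlt]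

omit h in
theorem memState_eq_self {a : ℕ} (ha : a < e.len) : memState m e a = m a := by
  have h1 : a < baseSets e := by unfold baseSets baseBits; omega
  have h2 : a < baseReach e := by unfold baseReach; omega
  rw [agree_memSets (fun _ ha => memState_eq ha) h2, memSets_eq h1, memBits_eq ha]

variable (hΓ : Describes m e Γ) (hbin : Γ.IsBinary)

include hΓ hbin

/-- Without values every colouring has utility zero, so a constant colour will do and only the
existence of a decomposition is tested. -/
theorem lookState_unweighted {μ : ℕ} (hμ : μ < e.big) (hμ0 : μ ≠ 0) :
    LookState (memState m e) e μ 0 0 (nameAll e) ↔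
      ∃ D : TreeDecomposition Γ.graph, ∀ t, (D.bag t).card ≤ e.par + 1 - (μ - 1) := by
  rw [h.lookState_nameAll hΓ hbin hμ (by omega)]
  refine and_iff_left ⟨fun _ => 0, fun u => ⟨by simp only [h.aux_eq]; omega, fun h0 => absurd h0 hμ0⟩,
    fun u => ?_⟩
  simp [colorValue, gameVal, hμ0]

theorem lookState_one :
    LookState (memState m e) e 1 0 0 (nameAll e) ↔ treewidth Γ.graph ≤ e.par := by
  rw [h.lookState_unweighted hΓ hbin (by have := h.two_lt_big; omega) one_ne_zero, treewidth_le_iff]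
  rfl

/-- Mode `2` has bags of size at most `par`, so for positive `par` it tests treewidth at most `par -
1`. For `par = 0` there is nothing to test. -/
theorem lookState_two : (e.par = 0 ∨ ¬ LookState (memState m e) e 2 0 0 (nameAll e)) ↔
    e.par ≤ treewidth Γ.graph := by
  rcases hp : e.par with _ | p
  · simp
  · rw [h.lookState_unweighted hΓ hbin h.two_lt_big two_ne_zero, hp]
    have : p + 1 + 1 - (2 - 1) = p + 1 := by omega
    rw [this, ← treewidth_le_iff]
    omega

/-- A colouring uses exactly the colours below `k` precisely if it respects some choice of
representatives for these colours: representatives force each colour to occur, and vertices may only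
take colours that have a representative. -/
theorem exists_representatives_iff (hk : Γ.k ≤ e.par) :
    (∃ ρ < e.big, LookState (memState m e) e 0 ρ 0 (nameAll e) ∧
      ∀ i < e.aux, (i < Γ.k ↔ ∃ v < e.num, LookSet (memState m e) e ρ (v * e.aux + i))) ↔
    treewidth Γ.graph ≤ e.par ∧ Γ.AdmitsIR := by
  have hZ := h.aux_eq
  have hn := h.two_mul_num_lt hΓ
  have hval : gameVal Γ 0 = Γ.val := by funext u v; simp [gameVal]
  have hlt : ∀ (x : Fin Γ.n) (i : ℕ), i < e.aux → (x : ℕ) * e.aux + i < e.aux * e.aux * e.aux :=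
    fun x i hi => by
      have h2 := pair_lt (x.2.trans (by omega : Γ.n < e.aux)) hi
      nlinarith [Nat.mul_le_mul_left (e.aux * e.aux) (by omega : 1 ≤ e.aux)]
  have hbig : e.aux * e.aux * e.aux < e.big := by
    have := h.digitBase_le_big
    unfold digitBase at this
    omega
  have hrep : ∀ ρ < e.big, ((∀ i < e.aux, (i < Γ.k ↔ ∃ v < e.num,
      LookSet (memState m e) e ρ (v * e.aux + i))) ↔ ∀ i < e.aux, (i < Γ.k ↔
        ∃ v : Fin Γ.n, v * e.aux + i + 1 ∈ Nat.digits (digitBase e) ρ)) := fun ρ hρ => by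
    refine forall₂_congr fun i hi => iff_congr Iff.rfl ?_
    rw [hΓ.exists_iff (P := fun v => LookSet (memState m e) e ρ (v * e.aux + i))]
    exact exists_congr fun v => h.lookSet_memState hρ ((hlt v i hi).trans hbig)
  constructor
  · rintro ⟨ρ, hρ, h1, h2⟩
    obtain ⟨h3, c, h4, h5⟩ := (h.lookState_nameAll hΓ hbin (by omega) hρ).1 h1
    rw [hrep ρ hρ] at h2
    refine ⟨treewidth_le_iff.2 h3, Γ.admitsIR_iff.2 ⟨c, fun i => ⟨fun hi => ?_, ?_⟩, hval ▸ h5⟩⟩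
    · obtain ⟨v, hv⟩ := (h2 i (by omega)).1 hi
      exact ⟨v, (((h4 v).2 rfl).2 i (by omega) hv).symm⟩
    · rintro ⟨v, rfl⟩
      exact (h2 _ (h4 v).1).2 ((h4 v).2 rfl).1
  · rintro ⟨htw, hIR⟩
    obtain ⟨c, hc, hc'⟩ := Γ.admitsIR_iff.1 hIR
    have hr : ∀ i : Fin Γ.k, ∃ v, c v = i := fun i => (hc i).1 i.2
    choose r hr using hr
    -- One digit for each of the `k ≤ par` pairs of a representative and its colour, so the code has
    -- at most `par + 1` digits.
    obtain ⟨ρ, hρ, hmem⟩ := exists_code (q := e.par + 1) (Nat.lt_succ_self (e.aux * e.aux * e.aux))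
      (Finset.univ.image fun i : Fin Γ.k => (r i : ℕ) * e.aux + i)
      (fun x hx => by
        obtain ⟨i, -, rfl⟩ := Finset.mem_image.1 hx
        exact hlt _ _ (by omega)) (Finset.card_image_le.trans (by simp; omega))
    have hmem' : ∀ (v : Fin Γ.n) (i : ℕ), i < e.aux →
        (v * e.aux + i + 1 ∈ Nat.digits (digitBase e) ρ ↔ ∃ hi : i < Γ.k, r ⟨i, hi⟩ = v) := by
      intro v i hi
      refine (hmem _).trans ?_
      rw [Finset.mem_image]
      constructor
      · rintro ⟨j, -, hj⟩
        have hjZ : (j : ℕ) < e.aux := by omega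
        have h1 := congrArg (· / e.aux) hj
        have h2 := congrArg (· % e.aux) hj
        simp only [pair_div hjZ, pair_div hi, pair_mod hjZ, pair_mod hi] at h1 h2
        subst h2
        exact ⟨j.2, Fin.ext h1⟩
      · rintro ⟨hik, rfl⟩
        exact ⟨⟨i, hik⟩, Finset.mem_univ _, rfl⟩
    have hρ' : ρ < e.big := by rw [h.big_eq]; exact hρ
    refine ⟨ρ, hρ', (h.lookState_nameAll hΓ hbin (by omega) hρ').2 ⟨?_, c, fun v => ?_, ?_⟩,
      (hrep ρ hρ').2 fun i hi => ?_⟩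
    · exact treewidth_le_iff.1 htw
    · have hck : c v < Γ.k := (hc _).2 ⟨v, rfl⟩
      refine ⟨by omega, fun _ => ⟨⟨r ⟨c v, hck⟩, (hmem' _ _ (by omega)).2 ⟨hck, rfl⟩⟩,
        fun i hi hvi => ?_⟩⟩
      obtain ⟨hik, rfl⟩ := (hmem' _ _ hi).1 hvi
      exact (hr ⟨i, hik⟩).symm
    · rwa [hval]
    · exact ⟨fun hik => ⟨r ⟨i, hik⟩, (hmem' _ _ hi).2 ⟨hik, rfl⟩⟩,
        fun ⟨v, hv⟩ => ((hmem' _ _ hi).1 hv).1⟩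

/-- The first test gives `par ≤ tw`, and both alternatives of the second include `tw ≤ par`. Once
`par = tw`, the case `k ≤ par` is settled by the dynamic program and the case `k > par` by part (2),
where only `k ≤ n` remains to be checked. -/
theorem decision_iff : ((e.par = 0 ∨ ¬ LookState (memState m e) e 2 0 0 (nameAll e)) ∧
    ((Γ.k ≤ e.par ∧ ∃ ρ < e.big, LookState (memState m e) e 0 ρ 0 (nameAll e) ∧
      ∀ i < e.aux, (i < Γ.k ↔ ∃ v < e.num, LookSet (memState m e) e ρ (v * e.aux + i))) ∨
    (e.par < Γ.k ∧ Γ.k ≤ e.num ∧ LookState (memState m e) e 1 0 0 (nameAll e)))) ↔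
    e.par = treewidth Γ.graph ∧ Γ.AdmitsIR := by
  rw [h.lookState_two hΓ hbin, h.lookState_one hΓ hbin, hΓ.num_eq]
  constructor
  · rintro ⟨h1, ⟨h2, h3⟩ | ⟨h2, h3, h4⟩⟩
    · rw [← hΓ.num_eq, h.exists_representatives_iff hΓ hbin h2] at h3
      exact ⟨le_antisymm h1 h3.1, h3.2⟩
    · exact ⟨le_antisymm h1 h4, (Γ.admitsIR_of_treewidth_lt (by omega)).2 h3⟩
  · rintro ⟨h1, h2⟩
    refine ⟨h1.le, ?_⟩
    rcases le_or_gt Γ.k e.par with h3 | h3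
    · refine .inl ⟨h3, ?_⟩
      rw [← hΓ.num_eq, h.exists_representatives_iff hΓ hbin h3]
      exact ⟨h1.ge, h2⟩
    · exact .inr ⟨h3, (Γ.admitsIR_of_treewidth_lt (by omega)).1 h2, h1.ge⟩

end Ready

theorem wellFormed_congr {m m' : ℕ → ℕ} {e : Env} (hm : ∀ a < e.len, m' a = m a) :
    WellFormed m' e ↔ WellFormed m e := by
  unfold WellFormed letterAt
  have hlt : e.num + 2 ≤ e.start → e.start + e.num * e.num = e.len → ∀ u < e.num, ∀ v < e.num,
      m' (e.start + (u * e.num + v)) = m (e.start + (u * e.num + v)) := fun _ h1 u hu v hv =>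
    hm _ (by have := pair_lt hu hv; omega)
  have hlt' : e.num + 2 ≤ e.start → e.start + e.num * e.num = e.len → ∀ i, i < e.start → m' i = m i :=
    fun _ h1 i hi => hm _ (by omega)
  constructor
  · rintro ⟨h1, h2, h3, h4, h5, h6, h7⟩
    have k1 := hlt h2 h3
    have k2 := hlt' h2 h3
    refine ⟨fun i hi => ?_, h2, h3, ?_, ?_, fun u hu v hv => ?_, fun u hu => ?_⟩
    · rw [← k2 _ (by omega), h1 i hi]
    · rw [← k2 _ (by omega), h4]
    · rw [← k2 _ (by omega), h5]
    · rw [← k1 u hu v hv]; exact h6 u hu v hv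
    · rw [← k1 u hu u hu]; exact h7 u hu
  · rintro ⟨h1, h2, h3, h4, h5, h6, h7⟩
    have k1 := hlt h2 h3
    have k2 := hlt' h2 h3
    refine ⟨fun i hi => ?_, h2, h3, ?_, ?_, fun u hu v hv => ?_, fun u hu => ?_⟩
    · rw [k2 _ (by omega), h1 i hi]
    · rw [k2 _ (by omega), h4]
    · rw [k2 _ (by omega), h5]
    · rw [k1 u hu v hv]; exact h6 u hu v hv
    · rw [k1 u hu u hu]; exact h7 u hu

open Classical in
/-- The number of leading letters `1`. -/
noncomputable def leadingOnes (m : ℕ → ℕ) (len : ℕ) : ℕ :=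
  ∑ i ∈ Finset.range len, if ∀ j < i + 1, m j = 1 then 1 else 0

theorem leadingOnes_eq {m : ℕ → ℕ} {len n : ℕ} (hn : n < len) (h : ∀ i < n, m i = 1) (hn' : m n ≠ 1) :
    leadingOnes m len = n := by
  have : ∀ i, (∀ j < i + 1, m j = 1) ↔ i < n := fun i => by
    constructor
    · intro h1
      by_contra h2
      exact hn' (h1 n (by omega))
    · exact fun hi j hj => h j (by omega)
  simp only [leadingOnes, this, Finset.sum_boole, Nat.cast_id]
  have : Finset.filter (fun i => i < n) (Finset.range len) = Finset.range n := by
    ext i; simp; omega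
  simp [this]

theorem leadingOnes_le {m : ℕ → ℕ} {len : ℕ} : leadingOnes m len ≤ len := by
  refine (Finset.sum_le_card_nsmul _ _ 1 fun y _ => ?_).trans (by simp)
  split_ifs <;> simp

/-- The final test decides the problem. -/
theorem accepts_iff {x : List (Fin 4)} {m : ℕ → ℕ} {e : Env} (h : Ready m e)
    (hlen : e.len = x.length) (hm : ∀ i (hi : i < x.length), m i = x[i])
    (hnum : e.num = leadingOnes m e.len) (hstart : e.start = e.len - e.num * e.num) :
    Accepts (memState m e) e ↔ (x, e.par) ∈ KASHG.irProblem := by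
  have hself : ∀ a < e.len, memState m e a = m a := fun a ha => Ready.memState_eq_self ha
  have hnb := h.num_lt_big
  have hab := h.aux_lt_big
  have haux := h.aux_eq
  have hsl := h.start_le
  unfold Accepts
  rw [wellFormed_congr hself]
  constructor
  · rintro ⟨⟨h1, h2, h3, h4, h5, h6, h7⟩, k, hk, h8, h9⟩
    rw [h.lookBits_memState (by omega) (by omega)] at h8
    let Γ : KASHG :=
      { n := e.num
        val := fun u v => if letterAt m e u v = 1 then 1 else if letterAt m e u v = 2 then -1 else 0
        val_self := fun i => by simp [h7 i i.2]
        k := k }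
    have hbin : Γ.IsBinary := fun i j => by
      simp only [Γ]; split_ifs <;> simp
    have hlet : ∀ u v : Fin Γ.n, letterAt m e u v = (KASHG.letter (Γ.val u v) : ℕ) := fun u v => by
      have := h6 u u.2 v v.2
      simp only [Γ]
      generalize letterAt m e u v = y at this
      interval_cases y <;> simp [KASHG.letter]
    have hΓ : Describes m e Γ := ⟨rfl, h3, hlet⟩
    obtain ⟨h10, h11⟩ := (h.decision_iff hΓ hbin).1 h9
    refine ⟨Γ, hbin, ?_, h10, h11⟩
    exact (KASHG.eq_encode_iff hm h2 (h3.trans hlen)).2 ⟨h1, h4, h8.2, h5, hlet⟩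
  · rintro ⟨Γ, hbin, hx, hp, hIR⟩
    dsimp only at hx hp
    have hxl := congrArg List.length hx
    rw [Γ.length_encode] at hxl
    obtain ⟨h1, h2, h3, h4, h5⟩ := (KASHG.eq_encode_iff hm
      (s := Γ.n + 2 + (Nat.digits 2 Γ.k).length) (by omega) hxl.symm).1 hx
    -- The unary prefix is followed by the separator `3`, so the leading ones are exactly the `n`
    -- letters of the prefix.
    have hn : e.num = Γ.n := hnum.trans (leadingOnes_eq (by omega) h1 (by omega))
    have hs : e.start = Γ.n + 2 + (Nat.digits 2 Γ.k).length := by rw [hstart, hn]; omega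
    rw [← hs] at h3 h4 h5
    have hΓ : Describes m e Γ := ⟨hn, by omega, fun u v => by rw [letterAt, hn]; exact h5 u v⟩
    -- In a yes-instance `k ≤ n < aux`, so the search for `k` below `aux` misses nothing, although
    -- `k` is written in binary.
    have hkn : Γ.k ≤ Γ.n := by
      obtain ⟨π, hπ, -⟩ := hIR
      rw [← hπ]
      simpa using π.card_parts_le_card
    have hn2 := h.two_mul_num_lt hΓ
    refine ⟨⟨?_, by omega, ?_, ?_, h4, ?_, ?_⟩, Γ.k, by omega,
      (h.lookBits_memState (by omega) (by omega)).2 ⟨by omega, ?_⟩,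
      (h.decision_iff hΓ hbin).2 ⟨hp, hIR⟩⟩
    · rwa [hn]
    · rw [hn]; omega
    · rwa [hn]
    · rw [hΓ.forall_iff (P := fun u => ∀ v < e.num, letterAt m e u v < 3)]
      intro u
      rw [hΓ.forall_iff (P := fun v => letterAt m e u v < 3)]
      intro v
      rw [hΓ.letter_eq]
      rcases hbin u v with h0 | h0 | h0 <;> simp [h0, KASHG.letter]
    · rw [hΓ.forall_iff (P := fun u => letterAt m e u u = 0)]
      intro u
      rw [hΓ.letter_eq, Γ.val_self]
      simp [KASHG.letter]
    · rwa [hn]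

end RAM

namespace RAM

/-! ### The program -/

/-- Store the value of an expression in one of the first six registers. -/
theorem exec_assign {f : (ℕ → ℕ) → Env → ℕ} (hf : PolyTime fun m e _ => f m e) {q : ℕ} (hq : q < 6) :
    ∃ (p : Prog) (C : ℕ), ∀ s B, 2 ≤ B → (∀ a, s.mem a ≤ B) → (∀ i < 6, s.reg i ≤ B) →
      ∃ s' t, Exec p s s' t ∧ t ≤ B ^ C ∧ s'.mem = s.mem ∧ s'.reg q = f s.mem s.env ∧
        ∀ i < 6, i ≠ q → s'.reg i = s.reg i := by
  obtain ⟨N, hf⟩ := hf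
  obtain ⟨p, C, hp⟩ := hf (fun _ => 0) 6 le_rfl (by simp)
  refine ⟨.seq p (.seq (.const q 0) (.add q q 6)), C + 1 + 1, fun s B hB hm hr => ?_⟩
  obtain ⟨-, s₁, t₁, e₁, ht, hm₁, hr₁, hv⟩ := hp s (fun _ => s.reg 0) B
    ⟨hB, hm, hr, fun _ _ => rfl, fun _ _ => hr 0 (by omega)⟩
  refine ⟨_, _, e₁.seq (.seq (.const q 0 s₁) (.add q q 6 _)),
    pow_bound_add hB ht (by rw [pow_one]; exact hB), hm₁, ?_, fun i hi hiq => ?_⟩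
  · have : (6 : ℕ) ≠ q := by omega
    simp [Function.update, hv, this]
  · simp [Function.update, hiq, hr₁ i hi]

/-- Store a power in one of the first six registers. -/
theorem exec_power {f g : (ℕ → ℕ) → Env → ℕ} (hf : PolyTime fun m e _ => f m e)
    (hg : PolyTime fun m e _ => g m e) {q : ℕ} (hq : q < 6) :
    ∃ (p : Prog) (C : ℕ), ∀ s B, 2 ≤ B → (∀ a, s.mem a ≤ B) → (∀ i < 6, s.reg i ≤ B) →
      1 ≤ f s.mem s.env → f s.mem s.env ^ g s.mem s.env ≤ B →
      ∃ s' t, Exec p s s' t ∧ t ≤ B ^ C ∧ s'.mem = s.mem ∧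
        s'.reg q = f s.mem s.env ^ g s.mem s.env ∧ ∀ i < 6, i ≠ q → s'.reg i = s.reg i := by
  have hit : ∀ x i, iterate (fun a _ => a * x) 1 i = x ^ i := fun x i => by
    induction i with
    | zero => rfl
    | succ i ih => rw [iterate, ih, pow_succ]
  obtain ⟨N, h⟩ := exec_iterate (b := fun m e _ => g m e)
    (F := fun m e _ a _ => a * f m e) hg ((PolyTime.var 0).mul hf) 1 1
  obtain ⟨p, C, hp⟩ := h (fun _ => 0) 6 le_rfl (by simp)
  refine ⟨.seq p (.seq (.const q 0) (.add q q 6)), C + 1 + 1, fun s B hB hm hr h1 hpow => ?_⟩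
  obtain ⟨s₁, t₁, e₁, ht, hm₁, hr₁, hv⟩ := hp s (fun _ => s.reg 0) B
    ⟨hB, hm, hr, fun _ _ => rfl, fun _ _ => hr 0 (by omega)⟩ (fun i hi => by
      rw [hit, pow_one]
      exact (Nat.pow_le_pow_right h1 hi).trans hpow)
  rw [hit] at hv
  refine ⟨_, _, e₁.seq (.seq (.const q 0 s₁) (.add q q 6 _)),
    pow_bound_add hB ht (by rw [pow_one]; exact hB), hm₁, ?_, fun i hi hiq => ?_⟩
  · have : (6 : ℕ) ≠ q := by omega
    simp [Function.update, hv, this]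
  · simp [Function.update, hiq, hr₁ i hi]

theorem polyTime_leadingOnes : PolyTime fun m e _ => leadingOnes m e.len := by
  unfold leadingOnes
  exact PolyTime.sum PolyTime.len (PolyTime.ite (PolyPred.forall_lt ((PolyTime.var 0).add (.const 1))
    (PolyPred.eq (PolyTime.var 0).get (.const 1))) (.const 1) (.const 0))

/-- The size of the numbers that occur in the computation. -/
def sizeBound (l p : ℕ) : ℕ := ((l + p + 2) * (l + p + 2) * (l + p + 2) + 1) ^ (p + 1)

theorem le_sizeBound (l p : ℕ) : l + p + 2 < sizeBound l p := by
  have h1 : l + p + 2 ≤ (l + p + 2) * (l + p + 2) * (l + p + 2) := by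
    nlinarith [Nat.mul_le_mul (Nat.le_add_left 1 (l + p + 1)) (Nat.le_add_left 1 (l + p + 1))]
  unfold sizeBound
  rw [pow_succ]
  refine (Nat.lt_succ_of_le h1).trans_le (Nat.le_mul_of_pos_left _ (Nat.pow_pos (by omega)))

/-- The sum `l + p + 2` is at most `y ^ (p + 4)`; taking the cube, adding one and raising to the
power `p + 1` gives an exponent that depends on `p` only. -/
theorem sizeBound_le {l p y : ℕ} (hy : 2 ≤ y) (hl : l ≤ y) :
    sizeBound l p ≤ y ^ ((3 * (p + 4) + 1) * (p + 1)) := by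
  have h1 : l + (p + 2) ≤ y ^ (1 + (p + 2) + 1) :=
    pow_bound_add hy (by rwa [pow_one]) (pow_bound_const hy _)
  have h2 : (l + (p + 2)) * (l + (p + 2)) * (l + (p + 2)) + 1 ≤ y ^ (_ + _ + _ + 0 + 1) :=
    pow_bound_add hy (pow_bound_mul (pow_bound_mul h1 h1) h1) (pow_zero y).ge
  unfold sizeBound
  rw [pow_mul]
  refine Nat.pow_le_pow_left ?_ _
  rw [add_assoc l]
  refine h2.trans_eq ?_
  congr 1
  ring

/-- The algorithm. -/
theorem exists_program : ∃ (P : Prog) (C : ℕ), ∀ (x : List (Fin 4)) (p : ℕ),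
    DecidesWithin P x p ((x, p) ∈ KASHG.irProblem) (sizeBound x.length p ^ C) := by
  obtain ⟨P₁, C₁, h₁⟩ := exec_assign (f := fun _ e => e.len + e.par + 2)
    ((PolyTime.len.add PolyTime.par).add (.const 2)) (q := 3) (by omega)
  obtain ⟨P₂, C₂, h₂⟩ := exec_power (f := fun _ e => digitBase e) (g := fun _ e => e.par + 1)
    PolyTime.digitBase (PolyTime.par.add (.const 1)) (q := 2) (by omega)
  obtain ⟨P₃, C₃, h₃⟩ := exec_assign (f := fun m e => leadingOnes m e.len) polyTime_leadingOnes
    (q := 4) (by omega)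
  obtain ⟨P₄, C₄, h₄⟩ := exec_assign (f := fun _ e => e.len - e.num * e.num)
    (PolyTime.len.sub (PolyTime.num.mul PolyTime.num)) (q := 5) (by omega)
  obtain ⟨hbit, N, h₅⟩ := polyCmd_memState
  obtain ⟨P₅, C₅, h₅⟩ := h₅ (fun _ => 0) 6 le_rfl (by simp)
  obtain ⟨g, hg, hgA⟩ := polyPred_accepts
  obtain rfl : g = fun m e _ => open Classical in if Accepts m e then 1 else 0 := by
    funext m e w; exact hgA m e w
  obtain ⟨P₆, C₆, h₆⟩ := exec_assign hg (q := 0) (by omega)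
  refine ⟨.seq P₁ (.seq P₂ (.seq P₃ (.seq P₄ (.seq P₅ P₆)))),
    C₁ + (C₂ + (C₃ + (C₄ + (C₅ + C₆ + 1) + 1) + 1) + 1) + 1, fun x p => ?_⟩
  -- This is the number later held by `big`, the range of all set codes. Every phase of the program
  -- is polynomial in it.
  set B := sizeBound x.length p with hB
  have hlB := le_sizeBound x.length p
  rw [← hB] at hlB
  have hB2 : 2 ≤ B := by omega
  set s₀ := State.init x p with hs₀
  have hm₀ : ∀ i (hi : i < x.length), s₀.mem i = x[i] := fun i hi => by simp [hs₀, State.init, hi]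
  have hz₀ : ∀ a, x.length ≤ a → s₀.mem a = 0 := fun a ha => by
    simp [hs₀, State.init, not_lt.2 ha]
  have hB4 : 4 ≤ B := by
    refine le_trans ?_ (Nat.le_self_pow (Nat.succ_ne_zero p) _)
    have h2 : 2 ≤ x.length + p + 2 := Nat.le_add_left _ _
    have := Nat.mul_le_mul (Nat.mul_le_mul h2 h2) h2
    omega
  have hmB : ∀ a, s₀.mem a ≤ B := fun a => by
    by_cases ha : a < x.length
    · rw [hm₀ a ha]; omega
    · rw [hz₀ a (by omega)]; omega
  have r0 : s₀.reg 0 = x.length := rfl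
  have r1 : s₀.reg 1 = p := rfl
  have r2 : ∀ i, 2 ≤ i → s₀.reg i = 0 := fun i hi => by
    have h0 : i ≠ 0 := by omega
    have h1 : i ≠ 1 := by omega
    simp [hs₀, State.init, h0, h1]
  have hrB : ∀ i < 6, s₀.reg i ≤ B := fun i hi => by
    rcases i with _ | _ | i
    · omega
    · rw [zero_add]; omega
    · rw [r2 _ (by omega)]; omega
  -- the prologue
  obtain ⟨s₁, t₁, e₁, ht₁, hm₁, hv₁, hr₁⟩ := h₁ s₀ B hB2 hmB hrB
  have hv₁' : s₁.reg 3 = x.length + p + 2 := hv₁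
  have hrB₁ : ∀ i < 6, s₁.reg i ≤ B := fun i hi => by
    by_cases h : i = 3
    · rw [h, hv₁']; omega
    · rw [hr₁ i hi h]; exact hrB i hi
  have hpow : digitBase s₁.env ^ (s₁.env.par + 1) = B := by
    have h1 : s₁.env.aux = x.length + p + 2 := hv₁'
    have h2 : s₁.env.par = p := hr₁ 1 (by omega) (by omega)
    rw [digitBase, h1, h2, hB, sizeBound]
  obtain ⟨s₂, t₂, e₂, ht₂, hm₂, hv₂, hr₂⟩ := h₂ s₁ B hB2 (by rwa [hm₁]) hrB₁
    (by simp [digitBase]) hpow.le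
  rw [hpow] at hv₂
  have hrB₂ : ∀ i < 6, s₂.reg i ≤ B := fun i hi => by
    by_cases h : i = 2
    · rw [h, hv₂]
    · rw [hr₂ i hi h]; exact hrB₁ i hi
  obtain ⟨s₃, t₃, e₃, ht₃, hm₃, hv₃, hr₃⟩ := h₃ s₂ B hB2 (by rwa [hm₂, hm₁]) hrB₂
  have hl₂ : s₂.env.len = x.length := (hr₂ 0 (by omega) (by omega)).trans (hr₁ 0 (by omega) (by omega))
  have hv₃' : s₃.reg 4 = leadingOnes s₀.mem x.length := by rw [hv₃, hm₂, hm₁, hl₂]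
  have hlead := leadingOnes_le (m := s₀.mem) (len := x.length)
  have hrB₃ : ∀ i < 6, s₃.reg i ≤ B := fun i hi => by
    by_cases h : i = 4
    · rw [h, hv₃']; omega
    · rw [hr₃ i hi h]; exact hrB₂ i hi
  obtain ⟨s₄, t₄, e₄, ht₄, hm₄, hv₄, hr₄⟩ := h₄ s₃ B hB2 (by rwa [hm₃, hm₂, hm₁]) hrB₃
  have hlen : s₄.env.len = x.length :=
    (hr₄ 0 (by omega) (by omega)).trans ((hr₃ 0 (by omega) (by omega)).trans hl₂)
  have hpar : s₄.env.par = p := (hr₄ 1 (by omega) (by omega)).trans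
    ((hr₃ 1 (by omega) (by omega)).trans ((hr₂ 1 (by omega) (by omega)).trans
      (hr₁ 1 (by omega) (by omega))))
  have hbig : s₄.env.big = B :=
    (hr₄ 2 (by omega) (by omega)).trans ((hr₃ 2 (by omega) (by omega)).trans hv₂)
  have haux : s₄.env.aux = x.length + p + 2 := (hr₄ 3 (by omega) (by omega)).trans
    ((hr₃ 3 (by omega) (by omega)).trans ((hr₂ 3 (by omega) (by omega)).trans hv₁'))
  have hnum : s₄.env.num = leadingOnes s₀.mem x.length := (hr₄ 4 (by omega) (by omega)).trans hv₃'
  have hnum₃ : s₃.env.num = s₄.env.num := (hr₄ 4 (by omega) (by omega)).symm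
  have hlen₃ : s₃.env.len = s₄.env.len := (hr₄ 0 (by omega) (by omega)).symm
  have hstart : s₄.env.start = s₄.env.len - s₄.env.num * s₄.env.num := by
    rw [← hnum₃, ← hlen₃]; exact hv₄
  have hrB₄ : ∀ i < 6, s₄.reg i ≤ B := fun i hi => by
    by_cases h : i = 5
    · have : s₄.reg 5 ≤ x.length := hlen ▸ hstart.trans_le (Nat.sub_le _ _)
      rw [h]; omega
    · rw [hr₄ i hi h]; exact hrB₃ i hi
  have hmem₄ : s₄.mem = s₀.mem := by rw [hm₄, hm₃, hm₂, hm₁]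
  have hready : Ready s₀.mem s₄.env :=
    { mem_zero := by rw [hlen]; exact hz₀
      aux_eq := by rw [haux, hlen, hpar]
      big_eq := by rw [hbig, digitBase, haux, hpar, hB, sizeBound]
      start_le := hstart.trans_le (Nat.sub_le _ _)
      num_le := by rw [hnum, hlen]; exact hlead }
  -- the tables and the test
  obtain ⟨s₅, t₅, e₅, ht₅, hm₅, hr₅⟩ := h₅ s₄ (fun _ => s₄.reg 0) B
    ⟨hB2, by rwa [hmem₄], hrB₄, fun _ _ => rfl, fun _ _ => hrB₄ 0 (by omega)⟩
  have henv : s₅.env = s₄.env := State.env_congr hr₅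
  obtain ⟨s₆, t₆, e₆, ht₆, -, hv₆, -⟩ := h₆ s₅ B hB2
    (fun a => by
      rw [hm₅]
      rcases hbit s₄.mem s₄.env (fun _ => s₄.reg 0) a with h | h
      · omega
      · rw [h, hmem₄]; exact hmB a)
    (fun i hi => by rw [hr₅ i hi]; exact hrB₄ i hi)
  rw [hm₅, henv, hmem₄] at hv₆
  have hacc := accepts_iff hready hlen hm₀ (by rw [hnum, hlen]) hstart
  rw [hpar] at hacc
  rw [hacc] at hv₆
  refine ⟨s₆, _, e₁.seq (e₂.seq (e₃.seq (e₄.seq (e₅.seq e₆)))), ?_, fun h => ?_, fun h => ?_⟩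
  · exact pow_bound_add hB2 ht₁ (pow_bound_add hB2 ht₂ (pow_bound_add hB2 ht₃
      (pow_bound_add hB2 ht₄ (pow_bound_add hB2 ht₅ ht₆))))
  · rw [hv₆, if_pos h]
  · rw [hv₆, if_neg h]

end RAM

/-- The time is a fixed power `C` of the size bound, and the size bound is a power of `max(|x|, 2)`
with an exponent that is a polynomial in `p`, hence computable. -/
theorem KASHG.irProblem_inXP : InXP KASHG.irProblem := by
  obtain ⟨P, C, h⟩ := RAM.exists_program
  refine ⟨P, fun p => (3 * (p + 4) + 1) * (p + 1) * C, ?_, fun x p => ?_⟩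
  · refine Primrec.to_comp ?_
    refine Primrec.nat_mul.comp (Primrec.nat_mul.comp (Primrec.nat_add.comp (Primrec.nat_mul.comp
      (.const 3) (Primrec.nat_add.comp .id (.const 4))) (.const 1))
      (Primrec.nat_add.comp .id (.const 1))) (.const C)
  · obtain ⟨s, t, e, ht, h1, h2⟩ := h x p
    refine ⟨s, t, e, ht.trans ?_, h1, h2⟩
    rw [pow_mul]
    exact Nat.pow_le_pow_left (RAM.sizeBound_le (le_max_right _ _) (le_max_left _ _)) C

theorem mainTheorem8 :
    InXP KASHG.irProblem ∧
    ∀ Γ : KASHG, Γ.IsBinary → treewidth Γ.graph + 1 ≤ Γ.k → Γ.k ≤ Γ.n →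
      ∃ π : Γ.CoalitionStructure, π.parts.card = Γ.k ∧ Γ.IsIR π ∧
        ∀ C ∈ π.parts, Γ.graph.IsIndepSet (C : Set (Fin Γ.n)) :=
  ⟨KASHG.irProblem_inXP, fun Γ _ => Γ.exists_independent_of_treewidth_lt⟩
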